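/- \textbf{Setting.} Let $k$ be a field, and let $\mathcal C$ be a small $k$-linear abelian category with a monoidal structure $\otimes$ that is $k$-bilinear and right exact in each variable. \emph{The cyclic category.} $\Lambda$ denotes Connes' cyclic category. Its objects are $[n]$, $n\ge 1$, with a cyclically ordered set $V([n])$ of $n$ vertices. A map $f:[m]\to[n]$ amounts to a map $V([m])\to V([n])$ together with a total order on each (possibly empty) fibre $f^{-1}(v)$, such that listing the fibres one after another in the cyclic order of $V([n])$ gives $V([m])$ in its cyclic order. For such $f$ let $$f_!:\mathcal C^{V([m])}\to\mathcal C^{V([n])},\qquad (f_!M)_v=\bigotimes_{w\in f^{-1}(v)}M_w ,$$ where the tensor product is taken in the order of the fibre and is the unit object if the fibre is empty. $\mathcal C_\#$ is the category of pairs $\langle[n],M\rangle$, $M\in\mathcal C^{V([n])}$, in which a map $\langle[m],M\rangle\to\langle[n],N\rangle$ is a map $f:[m]\to[n]$ together with a map $\iota:f_!M\to N$; the map is cocartesian if $\iota$ is invertible. A \emph{right-exact trace functor} is a functor $\operatorname{tr}:\mathcal C_\#\to k\text{-Vect}$ which sends cocartesian maps to invertible maps and whose restriction to $\mathcal C=\mathcal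 C^{V([1])}$ is $k$-linear and right exact. Fix one. \emph{Sheaves.} $\operatorname{Shv}(\mathcal C^n)$ is the abelian category of $k$-polylinear functors $(\mathcal C^{opp})^{V([n])}\to k\text{-Vect}$ that are left exact in each variable. For $f:[m]\to[n]$, $(f_!)_!:\operatorname{Shv}(\mathcal C^m)\to\operatorname{Shv}(\mathcal C^n)$ is the left adjoint of $E\mapsto E\circ f_!$. The trace functor is extended to $\operatorname{Shv}(\mathcal C^n)$ by $\operatorname{tr}(E)=\int^{M}\operatorname{tr}(\langle[n],M\rangle)\otimes_k E(M)$, the coend over $M\in\mathcal C^{V([n])}$. $\operatorname{Shv}(\mathcal C_\#)$ is the category of functors $E_\#:(\mathcal C^{opp})_\#\to k\text{-Vect}$ whose restriction $E_\#([n])$ to $(\mathcal C^{opp})^{V([n])}$ lies in $\operatorname{Shv}(\mathcal C^n)$ for each $n$, and $\operatorname{tr}_\#:\operatorname{Shv}(\mathcal C_\#)\to\operatorname{Fun}(\Lambda,k)$ is the functor $\operatorname{tr}_\#(E_\#)([n])=\operatorname{tr}(E_\#([n]))$, where $f:[m]\to[n]$ acts through the maps $\operatorname{tr}(\langle[m],M\rangle)\to\operatorname{tr}(\langle[n],f_!M\rangle)$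 and $E_\#(M)\to E_\#(f_!M)$. $\operatorname{Shv}_{cart}(\mathcal C_\#)$ consists of the $E_\#$ for which all maps $(f_!)_!E_\#([m])\to E_\#([n])$ are isomorphisms and $E_\#([1])\cong\operatorname{Hom}_{\mathcal C}(-,X)$ for some $X\in\mathcal C$. $\mathcal D\Lambda(\mathcal C)\subset\mathcal D(\operatorname{Shv}(\mathcal C_\#))$ is the full subcategory, in the unbounded derived category, of complexes with all homology objects in $\operatorname{Shv}_{cart}(\mathcal C_\#)$. \emph{Homologically clean.} The pair $\langle\mathcal C,\operatorname{tr}\rangle$ is assumed to be homologically clean: for every $n$, every object of $\operatorname{Shv}(\mathcal C^n)$ is a quotient of an object $E$ such that (i) $E$ is acyclic for $\operatorname{tr}$ and for $(f_!)_!$ for all $f:[n]\to[n']$, and (ii) $(f_!)_!E$ is acyclic for $\operatorname{tr}$ for all $f:[n]\to[n']$. Here $E$ is acyclic for a right exact functor $F$ if the left derived functors of $F$ are defined at $E$ and vanish in positive degrees, that is, if every resolution $X_\bullet\to E$ admits a map $Q_\bullet\to X_\bullet$ over $E$ from a resolution $Q_\bullet$ of $E$ such that $F(Q_\bullet)$ is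 a resolution of $F(E)$. \emph{Hochschild homology.} For a complex $M$ in $\operatorname{Shv}(\mathcal C)$ put $HH_\bullet(M)=L^\bullet\operatorname{tr}(M)$. Let $j:\Delta^{opp}\to\Lambda$ be the standard functor, where $\Delta^{opp}$ is realized as the category of objects $[n]\in\Lambda$ equipped with a map $[1]\to[n]$. For $E\in\mathcal D(\Lambda,k)=\mathcal D(\operatorname{Fun}(\Lambda,k))$ put $HH_\bullet(E)=H_\bullet(\Delta^{opp},j^*E)=L^\bullet\operatorname{colim}_{\Delta^{opp}}(j^*E)$. \textbf{Lemma.} The total left derived functors $L^\bullet\operatorname{tr}:\mathcal D(\operatorname{Shv}(\mathcal C))\to\mathcal D(k\text{-Vect})$, $L^\bullet\operatorname{tr}_\#:\mathcal D(\operatorname{Shv}(\mathcal C_\#))\to\mathcal D(\Lambda,k)$ and $L^\bullet\operatorname{colim}_{\Delta^{opp}}:\mathcal D(\operatorname{Fun}(\Delta^{opp},k))\to\mathcal D(k\text{-Vect})$ exist on the unbounded derived categories. For any complex $M_\#$ representing an object of $\mathcal D\Lambda(\mathcal C)$, with first component $M=M_\#([1])$, there is an isomorphism $$HH_\bullet(M)\;\cong\;HH_\bullet\bigl(L^\bullet\operatorname{tr}_\#M_\#\bigr)$$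 in $\mathcal D(k\text{-Vect})$, and it can be chosen natural in $M_\#$ (with respect to maps of complexes). -/

import Mathlib

open CategoryTheory Limits MonoidalCategory Opposite

universe u w₁ w₂ w₃

namespace CyclicHH

/-- An object `[n]`, `n ≥ 1`, of the cyclic category `Λ`: the cyclic quiver with `n` vertices
`0, 1, …, n - 1`, in this cyclic order. -/
structure CyclicCat : Type where
  card : ℕ
  pos : 0 < card

namespace CyclicCat

/-- The set `V([n])` of vertices. -/
abbrev V (n : CyclicCat) : Type := Fin n.card

/-- A morphism `[m] ⟶ [n]` of the cyclic category, in terms of preimages of vertices: a map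
`V([m]) → V([n])` together with a total order on each fibre (`fib w` is the fibre over `w`, listed in
its order), such that listing the fibres over `0, 1, …, n - 1` one after another enumerates
`0, 1, …, m - 1` exactly once and in the right cyclic order. A fibre may be empty. -/
@[ext]
structure Hom (m n : CyclicCat) : Type where
  fib : n.V → List m.V
  cyclic : (List.finRange n.card).flatMap fib ~r List.finRange m.card

theorem isRotated_flatMap {α β : Type} {l l' : List α} (h : l ~r l') (φ : α → List β) :
    l.flatMap φ ~r l'.flatMap φ := by
  obtain ⟨n, rfl⟩ := h
  induction n generalizing l with
  | zero => rw [List.rotate_zero]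
  | succ n ih =>
    cases l with
    | nil => simp
    | cons a l =>
      rw [List.rotate_cons_succ]
      refine List.IsRotated.trans ?_ ih
      simpa using List.isRotated_append

/-- Composition is composition of maps, with the lexicographic order on the fibres. -/
instance : Category CyclicCat where
  Hom := Hom
  id n := ⟨fun v => [v], by rw [List.flatMap_singleton']⟩
  comp f g := ⟨fun w => (g.fib w).flatMap f.fib, by
    rw [← List.flatMap_assoc]
    exact (isRotated_flatMap g.cyclic _).trans f.cyclic⟩
  id_comp f := by ext1; funext w; simp
  comp_id f := by ext1; funext w; simp
  assoc f g h := by ext1; funext w; simp [List.flatMap_assoc]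

theorem hom_ext {m n : CyclicCat} {f g : m ⟶ n} (h : f.fib = g.fib) : f = g := Hom.ext h

/-- The object `[1]`. -/
def one : CyclicCat := ⟨1, Nat.one_pos⟩

theorem nodup {m n : CyclicCat} (f : m ⟶ n) : ((List.finRange n.card).flatMap f.fib).Nodup :=
  f.cyclic.nodup_iff.2 (List.nodup_finRange _)

theorem nodup_fib {m n : CyclicCat} (f : m ⟶ n) (w : n.V) : (f.fib w).Nodup :=
  (List.nodup_flatMap.1 (nodup f)).1 w (List.mem_finRange w)

theorem exists_mem_fib {m n : CyclicCat} (f : m ⟶ n) (v : m.V) : ∃ w, v ∈ f.fib w := by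
  have : v ∈ (List.finRange n.card).flatMap f.fib :=
    (f.cyclic.perm.mem_iff).2 (List.mem_finRange v)
  obtain ⟨w, -, hw⟩ := List.mem_flatMap.1 this
  exact ⟨w, hw⟩

theorem eq_of_mem_fib {m n : CyclicCat} (f : m ⟶ n) {v : m.V} {w w' : n.V}
    (h : v ∈ f.fib w) (h' : v ∈ f.fib w') : w = w' := by
  by_contra hne
  have hd := (List.nodup_flatMap.1 (nodup f)).2
  have : Std.Symm (Function.onFun List.Disjoint f.fib) := ⟨fun _ _ h => List.Disjoint.symm h⟩
  exact (hd.forall (List.mem_finRange w) (List.mem_finRange w') hne) h h'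

end CyclicCat

section Tensor

variable {C : Type u} [Category.{u} C] [MonoidalCategory C] {I J K : Type}

/-- The tensor product `X l₁ ⊗ (X l₂ ⊗ (⋯ ⊗ 𝟙))` along a list. -/
def tens (X : I → C) : List I → C
  | [] => 𝟙_ C
  | i :: l => X i ⊗ tens X l

/-- Functoriality of `tens`. -/
def tensMap {X Y : I → C} (g : ∀ i, X i ⟶ Y i) : ∀ l : List I, tens X l ⟶ tens Y l
  | [] => 𝟙 _
  | i :: l => g i ⊗ₘ tensMap g l

@[simp] theorem tensMap_id (X : I → C) (l : List I) : tensMap (fun i => 𝟙 (X i)) l = 𝟙 _ := by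
  induction l with
  | nil => rfl
  | cons i l ih =>
    change 𝟙 (X i) ⊗ₘ tensMap (fun i => 𝟙 (X i)) l = 𝟙 (X i ⊗ tens X l)
    rw [ih, id_tensorHom_id]

theorem tensMap_comp {X Y Z : I → C} (g : ∀ i, X i ⟶ Y i) (h : ∀ i, Y i ⟶ Z i)
    (l : List I) : tensMap (fun i => g i ≫ h i) l = tensMap g l ≫ tensMap h l := by
  induction l with
  | nil => exact (Category.comp_id (𝟙 (𝟙_ C))).symm
  | cons i l ih =>
    change g i ≫ h i ⊗ₘ tensMap (fun i => g i ≫ h i) l =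
      (g i ⊗ₘ tensMap g l) ≫ (h i ⊗ₘ tensMap h l)
    rw [ih, tensorHom_comp_tensorHom]

/-- The associativity isomorphism for a concatenation of two lists. -/
def tensAppend (X : I → C) : ∀ a b : List I, tens X (a ++ b) ≅ tens X a ⊗ tens X b
  | [], b => (λ_ (tens X b)).symm
  | i :: a, b => whiskerLeftIso (X i) (tensAppend X a b) ≪≫ (α_ (X i) (tens X a) (tens X b)).symm

/-- The associativity isomorphism for a concatenation of a list of lists. -/
def tensFlat (X : I → C) (φ : J → List I) :
    ∀ l : List J, tens X (l.flatMap φ) ≅ tens (fun j => tens X (φ j)) l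
  | [] => Iso.refl (𝟙_ C)
  | j :: l => tensAppend X (φ j) (l.flatMap φ) ≪≫
      whiskerLeftIso (tens X (φ j)) (tensFlat X φ l)

/-- The identity map between the tensor products along two equal lists. -/
def tensCast (X : I → C) {a b : List I} (h : a = b) : tens X a ⟶ tens X b :=
  eqToHom (congrArg (tens X) h)

@[simp] theorem tensCast_rfl (X : I → C) {a : List I} (h : a = a) : tensCast X h = 𝟙 _ := rfl

@[simp] theorem tensCast_trans (X : I → C) {a b c : List I} (h : a = b)
    (h' : b = c) : tensCast X h ≫ tensCast X h' = tensCast X (h.trans h') := by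
  subst h h'; simp

theorem tensCast_map {X Y : I → C} (g : ∀ i, X i ⟶ Y i) {a b : List I} (h : a = b) :
    tensCast X h ≫ tensMap g b = tensMap g a ≫ tensCast Y h := by subst h; simp

theorem tensCast_cons (X : I → C) (i : I) {a b : List I} (h : a = b)
    (h' : i :: a = i :: b) :
    tensCast X h' = X i ◁ tensCast X h := by
  subst h
  exact (whiskerLeft_id (X i) (tens X a)).symm

theorem tensAppend_cast (X : I → C) (a : List I) {b c : List I} (h : b = c)
    (h' : a ++ b = a ++ c) :
    tensCast X h' ≫ (tensAppend X a c).hom =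
      (tensAppend X a b).hom ≫ tens X a ◁ tensCast X h := by subst h; simp

theorem tensAppend_natural {X Y : I → C} (g : ∀ i, X i ⟶ Y i) (a b : List I) :
    tensMap g (a ++ b) ≫ (tensAppend Y a b).hom =
      (tensAppend X a b).hom ≫ (tensMap g a ⊗ₘ tensMap g b) := by
  induction a with
  | nil =>
    change tensMap g b ≫ (λ_ _).inv = (λ_ _).inv ≫ (𝟙 (𝟙_ C) ⊗ₘ tensMap g b)
    simp
  | cons i a ih =>
    change (g i ⊗ₘ tensMap g (a ++ b)) ≫ (Y i ◁ (tensAppend Y a b).hom ≫ (α_ _ _ _).inv) =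
      (X i ◁ (tensAppend X a b).hom ≫ (α_ _ _ _).inv) ≫ ((g i ⊗ₘ tensMap g a) ⊗ₘ tensMap g b)
    rw [Category.assoc, ← associator_inv_naturality, ← id_tensorHom, ← id_tensorHom,
      tensorHom_comp_tensorHom_assoc, tensorHom_comp_tensorHom_assoc, ih, Category.comp_id,
      Category.id_comp]

theorem tensAppend_assoc (X : I → C) (a b c : List I) :
    (tensAppend X (a ++ b) c).hom ≫ (tensAppend X a b).hom ▷ tens X c =
      tensCast X (List.append_assoc a b c) ≫ (tensAppend X a (b ++ c)).hom ≫
        tens X a ◁ (tensAppend X b c).hom ≫ (α_ _ _ _).inv := by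
  induction a with
  | nil =>
    change (tensAppend X b c).hom ≫ (λ_ (tens X b)).inv ▷ tens X c =
      𝟙 _ ≫ (λ_ _).inv ≫ (𝟙_ C) ◁ (tensAppend X b c).hom ≫ (α_ _ _ _).inv
    simp
  | cons i a ih =>
    rw [tensCast_cons X i (List.append_assoc a b c)]
    change (X i ◁ (tensAppend X (a ++ b) c).hom ≫ (α_ _ _ _).inv) ≫
        (X i ◁ (tensAppend X a b).hom ≫ (α_ _ _ _).inv) ▷ tens X c =
      X i ◁ tensCast X (List.append_assoc a b c) ≫
        (X i ◁ (tensAppend X a (b ++ c)).hom ≫ (α_ _ _ _).inv) ≫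
        (X i ⊗ tens X a) ◁ (tensAppend X b c).hom ≫ (α_ _ _ _).inv
    have h := congrArg (fun t => X i ◁ t) ih
    simp only [whiskerLeft_comp] at h
    simp only [comp_whiskerRight, Category.assoc]
    rw [← associator_inv_naturality_middle_assoc, reassoc_of% h]
    monoidal

theorem tensFlat_natural {X Y : I → C} (g : ∀ i, X i ⟶ Y i) (φ : J → List I)
    (l : List J) :
    tensMap g (l.flatMap φ) ≫ (tensFlat Y φ l).hom =
      (tensFlat X φ l).hom ≫ tensMap (fun j => tensMap g (φ j)) l := by
  induction l with
  | nil => rfl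
  | cons j l ih =>
    change tensMap g (φ j ++ l.flatMap φ) ≫ (tensAppend Y (φ j) (l.flatMap φ)).hom ≫
        tens Y (φ j) ◁ (tensFlat Y φ l).hom =
      ((tensAppend X (φ j) (l.flatMap φ)).hom ≫ tens X (φ j) ◁ (tensFlat X φ l).hom) ≫
        (tensMap g (φ j) ⊗ₘ tensMap (fun j => tensMap g (φ j)) l)
    rw [reassoc_of% (@tensAppend_natural), Category.assoc, ← id_tensorHom, ← id_tensorHom,
      tensorHom_comp_tensorHom, tensorHom_comp_tensorHom, ih, Category.comp_id, Category.id_comp]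

theorem tensFlat_append (X : I → C) (φ : J → List I) (a b : List J) :
    (tensFlat X φ (a ++ b)).hom ≫ (tensAppend (fun j => tens X (φ j)) a b).hom =
      tensCast X List.flatMap_append ≫ (tensAppend X (a.flatMap φ) (b.flatMap φ)).hom ≫
        ((tensFlat X φ a).hom ⊗ₘ (tensFlat X φ b).hom) := by
  induction a with
  | nil =>
    change (tensFlat X φ b).hom ≫ (λ_ _).inv =
      𝟙 _ ≫ (λ_ _).inv ≫ (𝟙 (𝟙_ C) ⊗ₘ (tensFlat X φ b).hom)
    simp
  | cons j a ih =>
    have e : tensCast X (List.flatMap_append (f := φ) (xs := j :: a) (ys := b)) =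
      tensCast X (congrArg (φ j ++ ·) (List.flatMap_append (f := φ) (xs := a) (ys := b))) ≫
        tensCast X (List.append_assoc (φ j) (a.flatMap φ) (b.flatMap φ)).symm :=
      (tensCast_trans X _ _).symm
    rw [e]
    change ((tensAppend X (φ j) ((a ++ b).flatMap φ)).hom ≫
        tens X (φ j) ◁ (tensFlat X φ (a ++ b)).hom) ≫
        (tens X (φ j) ◁ (tensAppend (fun j => tens X (φ j)) a b).hom ≫ (α_ _ _ _).inv) =
      (tensCast X _ ≫ tensCast X _) ≫
        (tensAppend X (φ j ++ a.flatMap φ) (b.flatMap φ)).hom ≫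
        (((tensAppend X (φ j) (a.flatMap φ)).hom ≫ tens X (φ j) ◁ (tensFlat X φ a).hom) ⊗ₘ
          (tensFlat X φ b).hom)
    have h := congrArg (fun t => tens X (φ j) ◁ t) ih
    simp only [whiskerLeft_comp] at h
    have h2 : (tensAppend X (φ j ++ a.flatMap φ) (b.flatMap φ)).hom ≫
        (((tensAppend X (φ j) (a.flatMap φ)).hom ≫ tens X (φ j) ◁ (tensFlat X φ a).hom) ⊗ₘ
          (tensFlat X φ b).hom) =
        tensCast X (List.append_assoc (φ j) (a.flatMap φ) (b.flatMap φ)) ≫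
        (tensAppend X (φ j) (a.flatMap φ ++ b.flatMap φ)).hom ≫
        tens X (φ j) ◁ (tensAppend X (a.flatMap φ) (b.flatMap φ)).hom ≫
        tens X (φ j) ◁ ((tensFlat X φ a).hom ⊗ₘ (tensFlat X φ b).hom) ≫ (α_ _ _ _).inv := by
      have : (((tensAppend X (φ j) (a.flatMap φ)).hom ≫ tens X (φ j) ◁ (tensFlat X φ a).hom) ⊗ₘ
          (tensFlat X φ b).hom) = (tensAppend X (φ j) (a.flatMap φ)).hom ▷ _ ≫
          ((𝟙 (tens X (φ j)) ⊗ₘ (tensFlat X φ a).hom) ⊗ₘ (tensFlat X φ b).hom) := by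
        simp [MonoidalCategory.tensorHom_def]
      rw [this, reassoc_of% (@tensAppend_assoc), ← associator_inv_naturality, id_tensorHom]
    rw [h2]
    simp only [Category.assoc]
    rw [reassoc_of% h, reassoc_of% (@tensCast_trans), reassoc_of% (@tensCast_trans),
      reassoc_of% (tensAppend_cast X (φ j) (List.flatMap_append (f := φ) (xs := a) (ys := b))
        (by simp))]

theorem tensFlat_assoc (X : I → C) (φ : J → List I) (γ : K → List J) (l : List K) :
    (tensFlat X φ (l.flatMap γ)).hom ≫ (tensFlat (fun j => tens X (φ j)) γ l).hom =
      tensCast X (List.flatMap_assoc) ≫ (tensFlat X (fun i => (γ i).flatMap φ) l).hom ≫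
        tensMap (fun i => (tensFlat X φ (γ i)).hom) l := by
  induction l with
  | nil => exact (Category.id_comp _).symm
  | cons i l ih =>
    have e : tensCast X (List.flatMap_assoc (l := i :: l) (f := γ) (g := φ)) =
      tensCast X (List.flatMap_append (f := φ) (xs := γ i) (ys := l.flatMap γ)) ≫
      tensCast X (congrArg ((γ i).flatMap φ ++ ·) (List.flatMap_assoc (l := l) (f := γ) (g := φ))) :=
      (tensCast_trans X _ _).symm
    rw [e]
    change (tensFlat X φ (γ i ++ l.flatMap γ)).hom ≫
        (tensAppend (fun j => tens X (φ j)) (γ i) (l.flatMap γ)).hom ≫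
        tens (fun j => tens X (φ j)) (γ i) ◁ (tensFlat (fun j => tens X (φ j)) γ l).hom =
      (tensCast X _ ≫ tensCast X _) ≫
        ((tensAppend X ((γ i).flatMap φ) (l.flatMap (fun i => (γ i).flatMap φ))).hom ≫
          tens X ((γ i).flatMap φ) ◁ (tensFlat X (fun i => (γ i).flatMap φ) l).hom) ≫
        ((tensFlat X φ (γ i)).hom ⊗ₘ tensMap (fun i => (tensFlat X φ (γ i)).hom) l)
    rw [reassoc_of% (@tensFlat_append)]
    simp only [Category.assoc]
    rw [reassoc_of% (tensAppend_cast X _ (List.flatMap_assoc (l := l) (f := γ) (g := φ))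
      (by simp [List.flatMap_assoc]))]
    congr 2
    rw [← id_tensorHom, ← id_tensorHom, ← id_tensorHom, tensorHom_comp_tensorHom, ih,
      tensorHom_comp_tensorHom, tensorHom_comp_tensorHom]
    simp

/-- The unit isomorphism for a list with one element. -/
def tensOne (X : I → C) (i : I) : tens X [i] ≅ X i := ρ_ (X i)

theorem tensFlat_singleton (X : I → C) (l : List I) :
    (tensFlat X (fun i => [i]) l).hom ≫ tensMap (fun i => (tensOne X i).hom) l =
      tensCast X (List.flatMap_singleton' l) := by
  induction l with
  | nil => exact Category.id_comp _
  | cons i l ih =>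
    rw [tensCast_cons X i (List.flatMap_singleton' l)]
    change ((X i ◁ (λ_ _).inv ≫ (α_ _ _ _).inv) ≫ (X i ⊗ 𝟙_ C) ◁ (tensFlat X (fun i => [i]) l).hom)
      ≫ ((ρ_ (X i)).hom ⊗ₘ tensMap (fun i => (tensOne X i).hom) l) = _
    rw [← ih, whiskerLeft_comp, MonoidalCategory.tensorHom_def]
    monoidal

theorem tensFlat_one (X : I → C) (φ : J → List I) (j : J) :
    (tensFlat X φ [j]).hom ≫ (tensOne (fun j => tens X (φ j)) j).hom =
      tensCast X (List.flatMap_singleton φ j) := by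
  have h : ∀ a : List I, (tensAppend X a []).hom ≫ (ρ_ (tens X a)).hom =
      tensCast X (List.append_nil a) := by
    intro a
    induction a with
    | nil =>
      change (λ_ (𝟙_ C)).inv ≫ (ρ_ (𝟙_ C)).hom = 𝟙 _
      monoidal
    | cons i a ih =>
      rw [tensCast_cons X i (List.append_nil a), ← ih]
      have gen : ∀ {A B : C} (F : A ⟶ B ⊗ 𝟙_ C) (Z : C),
          (Z ◁ F ≫ (α_ Z B (𝟙_ C)).inv) ≫ (ρ_ (Z ⊗ B)).hom = Z ◁ (F ≫ (ρ_ B).hom) := by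
        intros; simp
      exact gen (tensAppend X a []).hom (X i)
  refine Eq.trans ?_ (h (φ j))
  change ((tensAppend X (φ j) []).hom ≫ tens X (φ j) ◁ 𝟙 (tens X [])) ≫ _ = _
  rw [whiskerLeft_id, Category.comp_id]
  rfl

theorem tensOne_naturality {X Y : I → C} (g : ∀ i, X i ⟶ Y i) (i : I) :
    tensMap g [i] ≫ (tensOne Y i).hom = (tensOne X i).hom ≫ g i := by
  change (g i ⊗ₘ 𝟙 (𝟙_ C)) ≫ (ρ_ (Y i)).hom = (ρ_ (X i)).hom ≫ g i
  simp

end Tensor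

section Push

variable {C : Type u} [Category.{u} C] [MonoidalCategory C] {m n p : CyclicCat}

/-- The functor `f_! : C^{V([m])} ⥤ C^{V([n])}` attached to `f : [m] ⟶ [n]`: the component of `f_! M`
at a vertex `w` is the tensor product of the `M v`, `v ∈ f⁻¹(w)`, in the order of the fibre (the unit
object if the fibre is empty). -/
def push (f : m ⟶ n) : (m.V → C) ⥤ (n.V → C) where
  obj M v := tens M (f.fib v)
  map g v := tensMap g (f.fib v)
  map_id M := by funext v; exact tensMap_id M _
  map_comp g h := by funext v; exact tensMap_comp g h _

/-- The isomorphism `(g ∘ f)_! M ≅ g_! (f_! M)`. -/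
def pushComp (f : m ⟶ n) (g : n ⟶ p) (M : m.V → C) :
    (push (f ≫ g)).obj M ≅ (push g).obj ((push f).obj M) :=
  Pi.isoMk fun w => tensFlat M f.fib (g.fib w)

/-- The isomorphism `id_! M ≅ M`. -/
def pushId (M : n.V → C) : (push (𝟙 n)).obj M ≅ M :=
  Pi.isoMk fun v => tensOne M v

end Push

variable (C : Type u) [Category.{u} C] [MonoidalCategory C]

/-- An object `([n], M)` of the category `C_#`, where `M ∈ C^{V([n])}`. -/
@[ext]
structure Cyc where
  base : CyclicCat
  fam : base.V → C

namespace Cyc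

variable {C}

/-- A morphism `([m], M) ⟶ ([n], N)` of `C_#`: a map `f : [m] ⟶ [n]` and a map `ι : f_! M ⟶ N`.
It is cocartesian over `Λ` if and only if `ι` is an isomorphism. -/
structure Hom (X Y : Cyc C) where
  base : X.base ⟶ Y.base
  ι : ∀ v, tens X.fam (base.fib v) ⟶ Y.fam v

theorem Hom.ext' {X Y : Cyc C} {f g : Hom X Y} (h : f.base = g.base)
    (hι : ∀ v, f.ι v = tensCast X.fam (congrArg (fun b => b.fib v) h) ≫ g.ι v) : f = g := by
  obtain ⟨f, a⟩ := f
  obtain ⟨g, b⟩ := g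
  obtain rfl : f = g := h
  congr
  funext v
  exact (hι v).trans (Category.id_comp _)

instance : Category (Cyc C) where
  Hom := Hom
  id X := ⟨𝟙 X.base, fun v => (tensOne X.fam v).hom⟩
  comp {X Y Z} f g := ⟨f.base ≫ g.base, fun w =>
    (tensFlat X.fam f.base.fib (g.base.fib w)).hom ≫ tensMap f.ι (g.base.fib w) ≫ g.ι w⟩
  id_comp {X Y} f := Hom.ext' (Category.id_comp _) fun v =>
    (reassoc_of% (tensFlat_singleton X.fam (f.base.fib v))) (f.ι v)
  comp_id {X Y} f := Hom.ext' (Category.comp_id _) fun v => by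
    have h1 := (reassoc_of% (tensFlat_one X.fam f.base.fib v)) (f.ι v)
    have h2 := tensOne_naturality f.ι v
    rw [← h2] at h1
    exact h1
  assoc {W X Y Z} f g h := Hom.ext' (Category.assoc _ _ _) fun v => by
    change (tensFlat W.fam (fun i => (g.base.fib i).flatMap f.base.fib) (h.base.fib v)).hom ≫
      tensMap (fun w => (tensFlat W.fam f.base.fib (g.base.fib w)).hom ≫
        tensMap f.ι (g.base.fib w) ≫ g.ι w) (h.base.fib v) ≫ h.ι v =
      tensCast W.fam _ ≫ (tensFlat W.fam f.base.fib ((h.base.fib v).flatMap g.base.fib)).hom ≫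
        tensMap f.ι ((h.base.fib v).flatMap g.base.fib) ≫
        (tensFlat X.fam g.base.fib (h.base.fib v)).hom ≫ tensMap g.ι (h.base.fib v) ≫ h.ι v
    rw [reassoc_of% (@tensFlat_natural), reassoc_of% (@tensFlat_assoc), reassoc_of% (@tensCast_trans), reassoc_of% (@tensMap_comp),
      reassoc_of% (@tensMap_comp), tensCast_rfl, Category.id_comp]

theorem comp_ι {X Y Z : Cyc C} (f : X ⟶ Y) (g : Y ⟶ Z) (w : Z.base.V) :
    (f ≫ g).ι w = (tensFlat X.fam f.base.fib (g.base.fib w)).hom ≫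
      tensMap f.ι (g.base.fib w) ≫ g.ι w := rfl

/-- The embedding of `C^{V([n])}` as the fibre of `C_# ⥤ Λ` over `[n]`. -/
def fiber (n : CyclicCat) : (n.V → C) ⥤ Cyc C where
  obj M := ⟨n, M⟩
  map {M N} g := ⟨𝟙 n, fun v => (tensOne M v).hom ≫ g v⟩
  map_id M := Hom.ext' rfl fun v =>
    (Category.comp_id _).trans (Category.id_comp _).symm
  map_comp {M N P} g h := Hom.ext' (Category.comp_id (𝟙 n)).symm fun (v : n.V) => by
    have h1 := (reassoc_of% (tensFlat_one M (fun v => [v]) v)) ((tensOne M v).hom ≫ g v ≫ h v)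
    have h2 := (reassoc_of% (tensOne_naturality (fun v => (tensOne M v).hom ≫ g v) v)) (h v)
    have h3 : (tensOne M v).hom ≫ g v ≫ h v = tensCast M (List.flatMap_singleton' [v]).symm ≫
      (tensFlat M (fun v => [v]) [v]).hom ≫
      tensMap (fun v => (tensOne M v).hom ≫ g v) [v] ≫ (tensOne N v).hom ≫ h v := by
      rw [h2, h1, reassoc_of% (@tensCast_trans), tensCast_rfl, Category.id_comp]
    exact h3

/-- The cocartesian lift `([m], M) ⟶ ([n], f_! M)` of `f : [m] ⟶ [n]`. -/
def lift {m n : CyclicCat} (f : m ⟶ n) (M : m.V → C) :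
    (fiber m).obj M ⟶ (fiber n).obj ((push f).obj M) := ⟨f, fun _ => 𝟙 _⟩

theorem lift_comp {m n p : CyclicCat} (f : m ⟶ n) (g : n ⟶ p) (M : m.V → C) :
    lift f M ≫ lift g ((push f).obj M) =
      lift (f ≫ g) M ≫ (fiber p).map (pushComp f g M).hom :=
  Hom.ext' (Category.comp_id (f ≫ g)).symm fun (v : p.V) => by
    have e1 : (tensFlat M f.fib (g.fib v)).hom ≫ tensMap (fun i => 𝟙 (tens M (f.fib i))) (g.fib v) ≫
        𝟙 (tens (fun i => tens M (f.fib i)) (g.fib v)) = tensCast M (List.flatMap_singleton _ v).symm ≫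
      (tensFlat M (fun v => (g.fib v).flatMap f.fib) [v]).hom ≫
        tensMap (fun v => 𝟙 (tens M ((g.fib v).flatMap f.fib))) [v] ≫
        (tensOne (fun v => tens M ((g.fib v).flatMap f.fib)) v).hom ≫
          (tensFlat M f.fib (g.fib v)).hom := by
      rw [tensMap_id, tensMap_id, Category.id_comp, Category.id_comp, reassoc_of% (@tensFlat_one),
        reassoc_of% (@tensCast_trans), tensCast_rfl, Category.id_comp, Category.comp_id]
    exact e1

theorem lift_natural {m n : CyclicCat} (f : m ⟶ n) {M N : m.V → C} (a : M ⟶ N) :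
    (fiber m).map a ≫ lift f N = lift f M ≫ (fiber n).map ((push f).map a) :=
  Hom.ext' ((Category.id_comp f).trans (Category.comp_id f).symm) fun (v : n.V) => by
    have e1 : (tensFlat M (fun v => [v]) (f.fib v)).hom ≫
        tensMap (fun v => (tensOne M v).hom ≫ a v) (f.fib v) ≫ 𝟙 (tens N (f.fib v)) =
      tensCast M ((List.flatMap_singleton' (f.fib v)).trans (List.flatMap_singleton f.fib v).symm) ≫
      (tensFlat M f.fib [v]).hom ≫ tensMap (fun i => 𝟙 (tens M (f.fib i))) [v] ≫
        (tensOne (fun i => tens M (f.fib i)) v).hom ≫ tensMap a (f.fib v) := by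
      rw [tensMap_id, tensMap_comp, Category.id_comp, Category.comp_id, reassoc_of% (@tensFlat_one),
        reassoc_of% (@tensCast_trans), reassoc_of% (@tensFlat_singleton)]
    exact e1

end Cyc

section Slot

variable {D : Type u} [Category.{u} D] {I : Type} [DecidableEq I]

/-- The functor `D ⥤ D^I` which puts an object in the slot `v` of a given family `M`. -/
def slot (M : I → D) (v : I) : D ⥤ (I → D) :=
  Functor.pi' fun w => if w = v then 𝟭 D else (Functor.const D).obj (M w)

/-- The functor `slot M v` is the identity in the slot `v`. -/
def slotSame (M : I → D) (v : I) : slot M v ⋙ Pi.eval _ v ≅ 𝟭 D :=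
  eqToIso ((Functor.pi'_eval _ v).trans (if_pos rfl))

/-- The functor `slot M v` is constant in the other slots. -/
def slotNe (M : I → D) {v w : I} (h : w ≠ v) :
    slot M v ⋙ Pi.eval _ w ≅ (Functor.const D).obj (M w) :=
  eqToIso ((Functor.pi'_eval _ w).trans (if_neg h))

end Slot

section Multi

variable {D : Type u} [Category.{u} D] [Abelian D] (k : Type u) [Field k] [Linear k D]
  {I : Type} [DecidableEq I]

/-- The functor `F` is `k`-linear and left exact. -/
structure IsLinearLex {A : Type*} [Category* A] [Preadditive A] [Linear k A] (F : D ⥤ A) : Prop where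
  additive : F.Additive
  linear : F.Linear k
  lex : PreservesFiniteLimits F

theorem IsLinearLex.of_iso {A : Type*} [Category* A] [Preadditive A] [Linear k A] {F G : D ⥤ A}
    (h : IsLinearLex k F) (e : F ≅ G) : IsLinearLex k G := by
  have := h.additive
  have := h.linear
  have := h.lex
  exact ⟨Functor.additive_of_iso e, Functor.linear_of_iso k e, preservesFiniteLimits_of_natIso e⟩

theorem IsLinearLex.comp {A : Type*} [Category* A] [Preadditive A] [Linear k A] {F : D ⥤ D}
    {G : D ⥤ A} (h : IsLinearLex k F) (h' : IsLinearLex k G) : IsLinearLex k (F ⋙ G) := by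
  have := h.additive
  have := h.linear
  have := h.lex
  have := h'.additive
  have := h'.linear
  have := h'.lex
  exact ⟨inferInstance, inferInstance, comp_preservesFiniteLimits F G⟩

/-- Polylinear functors `E : D^I ⥤ k-Vect` which are left exact in each variable. For `D = Cᵒᵖ` this
is the property of being a sheaf on `C^I`. -/
def shvProp (I : Type) [DecidableEq I] : ObjectProperty ((I → D) ⥤ ModuleCat.{u} k) :=
  fun E => ∀ (M : I → D) (v : I), IsLinearLex k (slot M v ⋙ E)

end Multi

section Op
variable {C : Type u} [Category.{u} C] (k : Type u) [Field k]

/-- The opposite of a `k`-linear category. -/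
instance [Preadditive C] [Linear k C] : Linear k Cᵒᵖ where
  homModule X Y :=
    { smul := fun c f => (c • f.unop).op
      one_smul := fun f => Quiver.Hom.unop_inj (one_smul k f.unop)
      mul_smul := fun a b f => Quiver.Hom.unop_inj (mul_smul a b f.unop)
      smul_zero := fun a => Quiver.Hom.unop_inj (smul_zero (A := unop Y ⟶ unop X) a)
      smul_add := fun a f g => Quiver.Hom.unop_inj (smul_add a f.unop g.unop)
      add_smul := fun a b f => Quiver.Hom.unop_inj (add_smul a b f.unop)
      zero_smul := fun f => Quiver.Hom.unop_inj (zero_smul k f.unop) }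
  smul_comp _ _ _ c f g := Quiver.Hom.unop_inj (Linear.comp_smul (R := k) _ _ _ g.unop c f.unop)
  comp_smul _ _ _ f c g := Quiver.Hom.unop_inj (Linear.smul_comp (R := k) _ _ _ c g.unop f.unop)

variable [MonoidalCategory C]

/-- The opposite of a preadditive monoidal category. -/
instance [Preadditive C] [MonoidalPreadditive C] : MonoidalPreadditive Cᵒᵖ where
  whiskerLeft_zero := Quiver.Hom.unop_inj MonoidalPreadditive.whiskerLeft_zero
  zero_whiskerRight := Quiver.Hom.unop_inj MonoidalPreadditive.zero_whiskerRight
  whiskerLeft_add f g := Quiver.Hom.unop_inj (MonoidalPreadditive.whiskerLeft_add f.unop g.unop)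
  add_whiskerRight f g := Quiver.Hom.unop_inj (MonoidalPreadditive.add_whiskerRight f.unop g.unop)

/-- The opposite of a `k`-linear monoidal category. -/
instance [Preadditive C] [Linear k C] [MonoidalPreadditive C] [MonoidalLinear k C] :
    MonoidalLinear k Cᵒᵖ where
  whiskerLeft_smul X _ _ r f := Quiver.Hom.unop_inj (MonoidalLinear.whiskerLeft_smul X.unop r f.unop)
  smul_whiskerRight r _ _ f X := Quiver.Hom.unop_inj (MonoidalLinear.smul_whiskerRight r f.unop X.unop)

theorem tensorLeft_op [∀ X : C, PreservesFiniteColimits (tensorLeft X)] (X : Cᵒᵖ) :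
    PreservesFiniteLimits (tensorLeft X) :=
  preservesFiniteLimits_op (tensorLeft X.unop)

theorem tensorRight_op [∀ X : C, PreservesFiniteColimits (tensorRight X)] (X : Cᵒᵖ) :
    PreservesFiniteLimits (tensorRight X) :=
  preservesFiniteLimits_op (tensorRight X.unop)

end Op

section Pull

variable {D : Type u} [Category.{u} D] [Abelian D] (k : Type u) [Field k] [Linear k D]
  [MonoidalCategory D] [MonoidalPreadditive D] [MonoidalLinear k D]
   {I : Type} [DecidableEq I]

/-- The functor `M ↦ M_{l₁} ⊗ M_{l₂} ⊗ …`. -/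
def tensFunctor {J : Type} (l : List J) : (J → D) ⥤ D where
  obj M := tens M l
  map g := tensMap g l
  map_id M := tensMap_id M l
  map_comp g h := tensMap_comp g h l

/-- The functor `tensFunctor` for a list with a first element. -/
def tensFunctorCons {A : Type*} [Category* A] {J : Type} (P : A ⥤ (J → D)) (i : J) (l : List J) :
    P ⋙ tensFunctor (i :: l) ≅ (P ⋙ Pi.eval _ i) ⊗ (P ⋙ tensFunctor l) :=
  NatIso.ofComponents (fun _ => Iso.refl _) (fun _ => (Category.comp_id _).trans
    (Category.id_comp _).symm)

/-- Tensor products which do not involve the slot `v` are constant in this slot. -/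
def slotTensNot (M : I → D) (v : I) : ∀ (l : List I), v ∉ l →
    (slot M v ⋙ tensFunctor l ≅ (Functor.const D).obj (tens M l))
  | [], _ => NatIso.ofComponents (fun _ => Iso.refl _) (fun _ => rfl)
  | i :: l, h => tensFunctorCons _ i l ≪≫
      (slotNe M (w := i) (v := v) (by grind) ⊗ᵢ slotTensNot M v l (by grind)) ≪≫
      NatIso.ofComponents (fun _ => Iso.refl _) (fun _ => (Category.comp_id _).trans
        ((id_tensorHom_id _ _).trans (Category.id_comp _).symm))

theorem isLinearLex_tens
    [∀ X : D, PreservesFiniteLimits (tensorLeft X)]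
    [∀ X : D, PreservesFiniteLimits (tensorRight X)] (M : I → D) (v : I) :
    ∀ (l : List I), l.Nodup → v ∈ l → IsLinearLex k (slot M v ⋙ tensFunctor l)
  | [], _, h => by simp at h
  | i :: l, hl, h => by
      by_cases hv : i = v
      · subst hv
        have e : slot M i ⋙ tensFunctor (i :: l) ≅ tensorRight (tens M l) :=
          tensFunctorCons _ i l ≪≫ (slotSame M i ⊗ᵢ slotTensNot M i l (by grind)) ≪≫
            NatIso.ofComponents (fun _ => Iso.refl _) (fun f => (Category.comp_id _).trans
              ((tensorHom_id f _).trans (Category.id_comp _).symm))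
        exact IsLinearLex.of_iso k ⟨inferInstance, inferInstance, inferInstance⟩ e.symm
      · have e : slot M v ⋙ tensFunctor (i :: l) ≅ (slot M v ⋙ tensFunctor l) ⋙ tensorLeft (M i) :=
          tensFunctorCons _ i l ≪≫ (slotNe M hv ⊗ᵢ Iso.refl _) ≪≫
            NatIso.ofComponents (fun _ => Iso.refl _) (fun f => (Category.comp_id _).trans
              ((id_tensorHom _ _).trans (Category.id_comp _).symm))
        exact IsLinearLex.of_iso k (IsLinearLex.comp k (isLinearLex_tens M v l (by grind) (by grind))
          ⟨inferInstance, inferInstance, inferInstance⟩) e.symm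

/-- In each slot, `f_!` is a tensor product functor with values in one slot. -/
def slotPush {m n : CyclicCat} (f : m ⟶ n) (M : m.V → D) (v : m.V) (w : n.V) (hw : v ∈ f.fib w) :
    slot M v ⋙ push f ≅ (slot M v ⋙ tensFunctor (f.fib w)) ⋙ slot ((push f).obj M) w :=
  NatIso.pi' fun w' => if h : w' = w then by
      subst h
      exact (Functor.isoWhiskerLeft (slot M v ⋙ tensFunctor (f.fib w')) (slotSame _ w')).symm
    else slotTensNot M v (f.fib w') (fun h' => h (CyclicCat.eq_of_mem_fib f h' hw)) ≪≫
      (Functor.isoWhiskerLeft (slot M v ⋙ tensFunctor (f.fib w))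
        (slotNe ((push f).obj M) h)).symm

theorem shvProp_push [∀ X : D, PreservesFiniteLimits (tensorLeft X)]
    [∀ X : D, PreservesFiniteLimits (tensorRight X)] {m n : CyclicCat} (f : m ⟶ n)
    {E : (n.V → D) ⥤ ModuleCat.{u} k} (hE : shvProp k n.V E) : shvProp k m.V (push f ⋙ E) := by
  intro M v
  obtain ⟨w, hw⟩ := CyclicCat.exists_mem_fib f v
  exact IsLinearLex.of_iso k (IsLinearLex.comp k (isLinearLex_tens k M v _ (CyclicCat.nodup_fib f w) hw)
    (hE ((push f).obj M) w)) (Functor.isoWhiskerRight (slotPush f M v w hw) E).symm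

end Pull

section Free

variable {J : Type u} [SmallCategory J] (k : Type u) [Field k]

/-- The free functor `y ↦ k[Hom(x, y)]`. -/
noncomputable def freeOn (x : J) : J ⥤ ModuleCat.{u} k := coyoneda.obj (op x) ⋙ ModuleCat.free k

/-- Functoriality of `freeOn`. -/
noncomputable def freeMap {x y : J} (a : x ⟶ y) : freeOn k y ⟶ freeOn k x :=
  Functor.whiskerRight (coyoneda.map a.op) (ModuleCat.free k)

variable {k}

/-- The bijection `Hom(k[Hom(x, -)], E) ≃ E(x)`. -/
noncomputable def evalFree {x : J} {E : J ⥤ ModuleCat.{u} k} (φ : freeOn k x ⟶ E) : E.obj x :=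
  (φ.app x).hom (ModuleCat.freeMk (𝟙 x))

theorem evalFree_add {x : J} {E : J ⥤ ModuleCat.{u} k} (φ ψ : freeOn k x ⟶ E) :
    evalFree (φ + ψ) = evalFree φ + evalFree ψ := rfl

theorem app_freeMk {x y : J} {E : J ⥤ ModuleCat.{u} k} (φ : freeOn k x ⟶ E) (a : x ⟶ y) :
    (φ.app y).hom (ModuleCat.freeMk a) = (E.map a).hom (evalFree φ) := by
  have h := congrArg (fun t => t.hom (ModuleCat.freeMk (𝟙 x))) (φ.naturality a)
  have h2 : ((freeOn k x).map a).hom (ModuleCat.freeMk (𝟙 x)) = ModuleCat.freeMk a :=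
    (ModuleCat.free_map_apply _ _).trans (congrArg _ (Category.id_comp a))
  exact (congrArg (φ.app y).hom h2.symm).trans h

theorem evalFree_freeMap {x y : J} {E : J ⥤ ModuleCat.{u} k} (a : x ⟶ y) (φ : freeOn k x ⟶ E) :
    evalFree (freeMap k a ≫ φ) = (E.map a).hom (evalFree φ) := by
  rw [← app_freeMk]
  have h2 : ((freeMap k a).app y).hom (ModuleCat.freeMk (𝟙 y)) = ModuleCat.freeMk a :=
    (ModuleCat.free_map_apply _ _).trans (congrArg _ (Category.comp_id a))
  exact congrArg (φ.app y).hom h2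

theorem evalFree_bijective (x : J) (E : J ⥤ ModuleCat.{u} k) :
    Function.Bijective (evalFree : (freeOn k x ⟶ E) → E.obj x) := by
  constructor
  · intro φ ψ h
    ext y : 2
    refine ModuleCat.free_hom_ext fun a => ?_
    exact (app_freeMk φ a).trans ((congrArg _ h).trans (app_freeMk ψ a).symm)
  · intro e
    refine ⟨{ app := fun y => ModuleCat.freeDesc (↾fun a => (E.map a).hom e), naturality := ?_ }, ?_⟩
    · intro y z b
      refine ModuleCat.free_hom_ext fun a => ?_
      have h2 : ((freeOn k x).map b).hom (ModuleCat.freeMk a) = ModuleCat.freeMk (a ≫ b) :=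
        ModuleCat.free_map_apply _ _
      refine (congrArg _ h2).trans ((ModuleCat.freeDesc_apply _ _).trans ?_)
      refine Eq.trans ?_ (congrArg (E.map b).hom (ModuleCat.freeDesc_apply _ _).symm)
      exact congrArg (fun t => t.hom e) (E.map_comp a b)
    · refine (ModuleCat.freeDesc_apply _ _).trans ?_
      exact congrArg (fun t => t.hom e) (E.map_id x)

attribute [local instance] Cardinal.fact_isRegular_aleph0

instance isCardinalPresentable_freeOn (x : J) :
    IsCardinalPresentable (freeOn k x) (Cardinal.aleph0.{u}) := by
  let e : (evaluation J (ModuleCat.{u} k)).obj x ⋙ forget (ModuleCat.{u} k) ≅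
      coyoneda.obj (op (freeOn k x)) :=
    (NatIso.ofComponents (fun E => (Equiv.ofBijective _ (evalFree_bijective x E)).toIso)
      (fun _ => rfl)).symm
  refine ⟨fun K _ hK => ?_⟩
  have : IsFiltered K := isFiltered_of_isCardinalFiltered K Cardinal.aleph0.{u}
  exact preservesColimitsOfShape_of_natIso e

instance isCardinalPresentable_cokernel {X Y : J ⥤ ModuleCat.{u} k} (f : X ⟶ Y)
    [IsCardinalPresentable X Cardinal.aleph0.{u}] [IsCardinalPresentable Y Cardinal.aleph0.{u}] :
    IsCardinalPresentable (cokernel f) Cardinal.aleph0.{u} := by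
  have (i : WalkingParallelPair) :
      IsCardinalPresentable ((parallelPair f 0).obj i) Cardinal.aleph0.{u} := by
    cases i <;> assumption
  refine isCardinalPresentable_of_isColimit _ (cokernelIsCokernel f) _ ?_
  rw [hasCardinalLT_aleph0_iff]
  infer_instance

end Free

section Reflect

variable {D : Type u} [SmallCategory D] [Abelian D] (k : Type u) [Field k] [Linear k D]
  {J : Type u} [SmallCategory J] {ι : Type u} (S : ι → D ⥤ J)

/-- Functors on `J` which are `k`-linear and left exact along each functor `S i : D ⥤ J`. -/
def lexAlong : ObjectProperty (J ⥤ ModuleCat.{u} k) := fun E => ∀ i, IsLinearLex k (S i ⋙ E)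

theorem bijective_cokernel {A B E : J ⥤ ModuleCat.{u} k} (r : A ⟶ B) :
    Function.Bijective (fun φ : cokernel r ⟶ E => cokernel.π r ≫ φ) ↔
      ∀ φ : B ⟶ E, r ≫ φ = 0 := by
  constructor
  · intro h φ
    obtain ⟨ψ, rfl⟩ := h.2 φ
    simp
  · intro h
    exact ⟨fun a b hab => (cancel_epi (cokernel.π r)).1 hab,
      fun φ => ⟨cokernel.desc r φ (h φ), cokernel.π_desc r φ (h φ)⟩⟩

theorem freeMap_comp {x y z : J} (a : x ⟶ y) (b : y ⟶ z) :
    freeMap k (a ≫ b) = freeMap k b ≫ freeMap k a := by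
  unfold freeMap
  rw [op_comp, Functor.map_comp]
  exact Functor.whiskerRight_comp _ _ _

/-- The map which expresses exactness of `0 ⟶ E(x) ⟶ E(y) ⟶ E(z)`. -/
noncomputable def kerMap {x y z : J} (a : x ⟶ y) (b : y ⟶ z) :
    cokernel (freeMap k b) ⟶ cokernel (freeMap k (a ≫ b)) :=
  cokernel.map _ _ (𝟙 _) (freeMap k a) (by rw [Category.id_comp, freeMap_comp])

theorem evalFree_surj {x : J} {E : J ⥤ ModuleCat.{u} k} (e : E.obj x) :
    ∃ φ : freeOn k x ⟶ E, evalFree φ = e := (evalFree_bijective x E).2 e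

theorem evalFree_eq_zero {x : J} {E : J ⥤ ModuleCat.{u} k} (φ : freeOn k x ⟶ E) :
    φ = 0 ↔ evalFree φ = 0 :=
  ⟨fun h => by rw [h]; rfl, fun h => (evalFree_bijective x E).1 (h.trans rfl)⟩

theorem bijective_kerMap {x y z : J} (a : x ⟶ y) (b : y ⟶ z) (E : J ⥤ ModuleCat.{u} k)
    (hab : E.map (a ≫ b) = 0) :
    Function.Bijective (fun φ : cokernel (freeMap k (a ≫ b)) ⟶ E => kerMap k a b ≫ φ) ↔
      (∀ e, (E.map b).hom e = 0 → ∃ d, (E.map a).hom d = e) ∧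
        Function.Injective (E.map a).hom := by
  have hz : ∀ φ : freeOn k x ⟶ E, freeMap k (a ≫ b) ≫ φ = 0 :=
    fun φ => by rw [evalFree_eq_zero, evalFree_freeMap, hab]; rfl
  have hπ : ∀ ψ : cokernel (freeMap k (a ≫ b)) ⟶ E, cokernel.π (freeMap k b) ≫ kerMap k a b ≫ ψ =
      freeMap k a ≫ cokernel.π (freeMap k (a ≫ b)) ≫ ψ := fun ψ =>
    (cokernel.π_desc_assoc _ _ _ ψ).trans (Category.assoc _ _ _)
  constructor
  · intro h
    constructor
    · intro e he
      obtain ⟨φ, rfl⟩ := evalFree_surj k e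
      have h0 : freeMap k b ≫ φ = 0 := by
        rw [evalFree_eq_zero, evalFree_freeMap, he]
      obtain ⟨ψ, hψ⟩ := h.2 (cokernel.desc _ φ h0)
      refine ⟨evalFree (cokernel.π _ ≫ ψ), ?_⟩
      have h1 : kerMap k a b ≫ ψ = cokernel.desc _ φ h0 := hψ
      rw [← evalFree_freeMap, ← hπ, h1, cokernel.π_desc]
    · intro d d' hd
      obtain ⟨φ, rfl⟩ := evalFree_surj k d
      obtain ⟨φ', rfl⟩ := evalFree_surj k d'
      have h2 : kerMap k a b ≫ cokernel.desc _ φ (hz φ) =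
          kerMap k a b ≫ cokernel.desc _ φ' (hz φ') := by
        rw [← cancel_epi (cokernel.π _), hπ, hπ, cokernel.π_desc, cokernel.π_desc]
        apply (evalFree_bijective _ _).1
        rw [evalFree_freeMap, evalFree_freeMap, hd]
      have h3 := h.1 h2
      rw [← cokernel.π_desc _ φ (hz φ), h3, cokernel.π_desc]
  · rintro ⟨hex, hinj⟩
    constructor
    · intro ψ ψ' hψ
      rw [← cancel_epi (cokernel.π _)]
      apply (evalFree_bijective _ _).1
      apply hinj
      have h1 : kerMap k a b ≫ ψ = kerMap k a b ≫ ψ' := hψ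
      rw [← evalFree_freeMap, ← evalFree_freeMap, ← hπ, ← hπ, h1]
    · intro ψ
      have h0 : (E.map b).hom (evalFree (cokernel.π (freeMap k b) ≫ ψ)) = 0 := by
        rw [← evalFree_freeMap, cokernel.condition_assoc, zero_comp]; rfl
      obtain ⟨y, hy⟩ := hex _ h0
      obtain ⟨φ, rfl⟩ := evalFree_surj k y
      refine ⟨cokernel.desc _ φ (hz φ), ?_⟩
      change kerMap k a b ≫ cokernel.desc _ φ (hz φ) = ψ
      rw [← cancel_epi (cokernel.π _), hπ, cokernel.π_desc]
      apply (evalFree_bijective _ _).1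
      rw [evalFree_freeMap, hy]

/-- Indices for the maps with respect to which the functors in `lexAlong` are the local objects. -/
inductive RelIdx : Type u
  | add (i : ι) (X Y : D) (f g : X ⟶ Y)
  | smul (i : ι) (X Y : D) (c : k) (f : X ⟶ Y)
  | ker (i : ι) (T : ShortComplex D) (h : T.Exact ∧ Mono T.f)

variable {k}

/-- The maps with respect to which the functors in `lexAlong` are the local objects. -/
noncomputable def relArrow : RelIdx (D := D) k (ι := ι) → Arrow (J ⥤ ModuleCat.{u} k)
  | .add i _ _ f g => Arrow.mk (cokernel.π
      (freeMap k ((S i).map (f + g)) - (freeMap k ((S i).map f) + freeMap k ((S i).map g))))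
  | .smul i _ _ c f => Arrow.mk (cokernel.π
      (freeMap k ((S i).map (c • f)) - c • freeMap k ((S i).map f)))
  | .ker i T _ => Arrow.mk (kerMap k ((S i).map T.f) ((S i).map T.g))

/-- The class of the maps `relArrow`. -/
noncomputable def relW : MorphismProperty (J ⥤ ModuleCat.{u} k) :=
  MorphismProperty.ofHoms (fun t : RelIdx (D := D) k (ι := ι) => (relArrow S t).hom)

theorem isLocal_relW_iff (E : J ⥤ ModuleCat.{u} k) :
    (relW (k := k) S).isLocal E ↔ lexAlong k S E := by
  have key : (relW (k := k) S).isLocal E ↔ ∀ t, Function.Bijective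
      (fun φ : (relArrow S t).right ⟶ E => (relArrow (k := k) S t).hom ≫ φ) :=
    ⟨fun h t => h _ ⟨t⟩, fun h _ _ _ ⟨t⟩ => h t⟩
  have hadd : ∀ i X Y f g, Function.Bijective (fun φ : (relArrow S (.add i X Y f g)).right ⟶ E =>
      (relArrow (k := k) S (.add i X Y f g)).hom ≫ φ) ↔
      E.map ((S i).map (f + g)) = E.map ((S i).map f) + E.map ((S i).map g) := by
    intro i X Y f g
    refine (bijective_cokernel k _).trans ⟨fun h => ?_, fun h φ => ?_⟩
    · ext e
      obtain ⟨φ, rfl⟩ := evalFree_surj k e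
      have h2 := (evalFree_eq_zero k _).1 (h φ)
      rw [Preadditive.sub_comp, Preadditive.add_comp] at h2
      have h3 : evalFree (freeMap k ((S i).map (f + g)) ≫ φ) -
        (evalFree (freeMap k ((S i).map f) ≫ φ) + evalFree (freeMap k ((S i).map g) ≫ φ)) = 0 := h2
      rw [evalFree_freeMap, evalFree_freeMap, evalFree_freeMap] at h3
      exact sub_eq_zero.1 h3
    · rw [evalFree_eq_zero, Preadditive.sub_comp, Preadditive.add_comp]
      have h3 : evalFree (freeMap k ((S i).map (f + g)) ≫ φ) -
        (evalFree (freeMap k ((S i).map f) ≫ φ) + evalFree (freeMap k ((S i).map g) ≫ φ)) = 0 := by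
        rw [evalFree_freeMap, evalFree_freeMap, evalFree_freeMap, h]
        exact sub_self _
      exact h3
  have hsmul : ∀ i X Y c f, Function.Bijective (fun φ : (relArrow S (.smul i X Y c f)).right ⟶ E =>
      (relArrow (k := k) S (.smul i X Y c f)).hom ≫ φ) ↔
      E.map ((S i).map (c • f)) = c • E.map ((S i).map f) := by
    intro i X Y c f
    refine (bijective_cokernel k _).trans ⟨fun h => ?_, fun h φ => ?_⟩
    · ext e
      obtain ⟨φ, rfl⟩ := evalFree_surj k e
      have h2 := (evalFree_eq_zero k _).1 (h φ)
      rw [Preadditive.sub_comp, Linear.smul_comp] at h2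
      have h3 : evalFree (freeMap k ((S i).map (c • f)) ≫ φ) -
        (c • evalFree (freeMap k ((S i).map f) ≫ φ)) = 0 := h2
      rw [evalFree_freeMap, evalFree_freeMap] at h3
      exact sub_eq_zero.1 h3
    · rw [evalFree_eq_zero, Preadditive.sub_comp, Linear.smul_comp]
      have h3 : evalFree (freeMap k ((S i).map (c • f)) ≫ φ) -
        (c • evalFree (freeMap k ((S i).map f) ≫ φ)) = 0 := by
        rw [evalFree_freeMap, evalFree_freeMap, h]
        exact sub_self _
      exact h3
  have hker : ∀ i, ∀ _ : (S i ⋙ E).Additive, ∀ (T : ShortComplex D) (hT : T.Exact ∧ Mono T.f),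
      Function.Bijective (fun φ : (relArrow S (.ker i T hT)).right ⟶ E =>
      (relArrow (k := k) S (.ker i T hT)).hom ≫ φ) ↔
      ((T.map (S i ⋙ E)).Exact ∧ Mono ((S i ⋙ E).map T.f)) := by
    intro i hi T hT
    have hz : E.map ((S i).map T.f ≫ (S i).map T.g) = 0 := by
      rw [← Functor.map_comp, T.zero]
      exact (S i ⋙ E).map_zero _ _
    rw [ShortComplex.moduleCat_exact_iff, ModuleCat.mono_iff_injective]
    exact bijective_kerMap k _ _ E hz
  rw [key]
  constructor
  · intro h i
    have ha : (S i ⋙ E).Additive := ⟨(hadd i _ _ _ _).1 (h (.add i _ _ _ _))⟩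
    refine ⟨ha, ⟨fun f c => (hsmul i _ _ _ _).1 (h (.smul i _ _ _ _))⟩, ?_⟩
    exact (Functor.preservesFiniteLimits_tfae (S i ⋙ E)|>.out 1 3 rfl rfl).1
      fun T hT => (hker i ha T hT).1 (h (.ker i T hT))
  · intro h t
    cases t with
    | add i X Y f g => exact (hadd i X Y f g).2 ((h i).additive.map_add)
    | smul i X Y c f => exact (hsmul i X Y c f).2 ((h i).linear.map_smul f c)
    | ker i T hT =>
      have := (h i).additive
      exact (hker i (h i).additive T hT).2
        ((Functor.preservesFiniteLimits_tfae (S i ⋙ E)|>.out 1 3 rfl rfl).2 (h i).lex T hT)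

attribute [local instance] Cardinal.fact_isRegular_aleph0

theorem lexAlong_isRightAdjoint_ι : (lexAlong k S).ι.IsRightAdjoint := by
  have h : lexAlong k S = (relW (k := k) S).isLocal := by
    ext E; exact (isLocal_relW_iff S E).symm
  rw [h]
  have : MorphismProperty.IsSmall.{u} (relW (k := k) S) := by
    unfold relW; infer_instance
  refine MorphismProperty.isRightAdjoint_ι_isLocal _ Cardinal.aleph0.{u} ?_
  rintro _ _ _ ⟨t⟩
  cases t <;> dsimp [relArrow] <;> exact ⟨inferInstance, inferInstance⟩

end Reflect

section Coten

variable {k : Type u} [Field k] {J J' J'' : Type u} [SmallCategory J] [SmallCategory J']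
  [SmallCategory J'']

/-- The bifunctor `(X, Y) ↦ A(X) ⊗ E(Y)`. -/
def cotenDiag (A : Jᵒᵖ ⥤ ModuleCat.{u} k) (E : J ⥤ ModuleCat.{u} k) :
    Jᵒᵖ ⥤ J ⥤ ModuleCat.{u} k :=
  A ⋙ curriedTensor (ModuleCat.{u} k) ⋙ (Functor.whiskeringLeft J _ _).obj E

/-- The tensor product `A ⊗_J E` of functors, that is, the coend of `A(X) ⊗ E(X)`. -/
noncomputable def coten (A : Jᵒᵖ ⥤ ModuleCat.{u} k) (E : J ⥤ ModuleCat.{u} k) : ModuleCat.{u} k :=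
  coend (cotenDiag A E)

namespace coten

/-- The map from `A(X) ⊗ E(X)` to the coend. -/
noncomputable def ι (A : Jᵒᵖ ⥤ ModuleCat.{u} k) (E : J ⥤ ModuleCat.{u} k) (X : J) :
    A.obj (op X) ⊗ E.obj X ⟶ coten A E := coend.ι (cotenDiag A E) X

theorem condition (A : Jᵒᵖ ⥤ ModuleCat.{u} k) (E : J ⥤ ModuleCat.{u} k) {X Y : J} (f : X ⟶ Y) :
    A.map f.op ▷ E.obj X ≫ ι A E X = A.obj (op Y) ◁ E.map f ≫ ι A E Y :=
  coend.condition (cotenDiag A E) f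

theorem hom_ext {A : Jᵒᵖ ⥤ ModuleCat.{u} k} {E : J ⥤ ModuleCat.{u} k} {V : ModuleCat.{u} k}
    {a b : coten A E ⟶ V} (h : ∀ X, ι A E X ≫ a = ι A E X ≫ b) : a = b := coend.hom_ext h

theorem condition' (A : Jᵒᵖ ⥤ ModuleCat.{u} k) (E : J ⥤ ModuleCat.{u} k) {X Y : J} (f : X ⟶ Y)
    {V W : ModuleCat.{u} k} (t : V ⟶ A.obj (op Y)) (s : W ⟶ E.obj X) :
    (t ≫ A.map f.op ⊗ₘ s) ≫ ι A E X = (t ⊗ₘ s ≫ E.map f) ≫ ι A E Y := by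
  have h1 : (t ≫ A.map f.op ⊗ₘ s) = (t ⊗ₘ s) ≫ A.map f.op ▷ E.obj X := by
    rw [← tensorHom_id, tensorHom_comp_tensorHom, Category.comp_id]
  have h2 : (t ⊗ₘ s ≫ E.map f) = (t ⊗ₘ s) ≫ A.obj (op Y) ◁ E.map f := by
    rw [← id_tensorHom, tensorHom_comp_tensorHom, Category.comp_id]
  rw [h1, h2, Category.assoc, Category.assoc, condition]

theorem ι_iso (A : Jᵒᵖ ⥤ ModuleCat.{u} k) (E : J ⥤ ModuleCat.{u} k) {X Y : J} (θ : X ≅ Y) :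
    (A.map θ.inv.op ⊗ₘ E.map θ.hom) ≫ ι A E Y = ι A E X := by
  have h := condition' A E θ.hom (A.map θ.inv.op) (𝟙 (E.obj X))
  rw [← Functor.map_comp, ← op_comp, θ.hom_inv_id, op_id, CategoryTheory.Functor.map_id, Category.id_comp,
    id_tensorHom_id, Category.id_comp] at h
  exact h.symm

/-- The map of coends induced by a functor `P : J ⥤ J'` and maps `a`, `e`. -/
noncomputable def map {A : Jᵒᵖ ⥤ ModuleCat.{u} k} {E : J ⥤ ModuleCat.{u} k}
    {A' : J'ᵒᵖ ⥤ ModuleCat.{u} k} {E' : J' ⥤ ModuleCat.{u} k} (P : J ⥤ J')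
    (a : A ⟶ P.op ⋙ A') (e : E ⟶ P ⋙ E') : coten A E ⟶ coten A' E' :=
  coend.desc (fun X => (a.app (op X) ⊗ₘ e.app X) ≫ ι A' E' (P.obj X)) (by
    intro X Y f
    change (A.map f.op ▷ E.obj X) ≫ (a.app (op X) ⊗ₘ e.app X) ≫ ι A' E' (P.obj X) =
      (A.obj (op Y) ◁ E.map f) ≫ (a.app (op Y) ⊗ₘ e.app Y) ≫ ι A' E' (P.obj Y)
    have h1 : A.map f.op ≫ a.app (op X) = a.app (op Y) ≫ A'.map (P.map f).op := a.naturality f.op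
    have h2 : E.map f ≫ e.app Y = e.app X ≫ E'.map (P.map f) := e.naturality f
    rw [← tensorHom_id, ← id_tensorHom, tensorHom_comp_tensorHom_assoc,
      tensorHom_comp_tensorHom_assoc, h1, h2, Category.id_comp, Category.id_comp]
    exact condition' A' E' (P.map f) (a.app (op Y)) (e.app X))

theorem ι_map {A : Jᵒᵖ ⥤ ModuleCat.{u} k} {E : J ⥤ ModuleCat.{u} k}
    {A' : J'ᵒᵖ ⥤ ModuleCat.{u} k} {E' : J' ⥤ ModuleCat.{u} k} (P : J ⥤ J')
    (a : A ⟶ P.op ⋙ A') (e : E ⟶ P ⋙ E') (X : J) :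
    ι A E X ≫ map P a e = (a.app (op X) ⊗ₘ e.app X) ≫ ι A' E' (P.obj X) := coend.ι_desc _ _ _

theorem map_eq_id {A : Jᵒᵖ ⥤ ModuleCat.{u} k} {E : J ⥤ ModuleCat.{u} k} (P : J ⥤ J)
    (a : A ⟶ P.op ⋙ A) (e : E ⟶ P ⋙ E) (θ : ∀ X, X ≅ P.obj X)
    (ha : ∀ X, a.app (op X) = A.map (θ X).inv.op) (he : ∀ X, e.app X = E.map (θ X).hom) :
    map P a e = 𝟙 (coten A E) := by
  refine hom_ext fun X => ?_
  rw [ι_map, ha, he, Category.comp_id]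
  exact ι_iso A E (θ X)

theorem map_eq_comp {A : Jᵒᵖ ⥤ ModuleCat.{u} k} {E : J ⥤ ModuleCat.{u} k}
    {A' : J'ᵒᵖ ⥤ ModuleCat.{u} k} {E' : J' ⥤ ModuleCat.{u} k}
    {A'' : J''ᵒᵖ ⥤ ModuleCat.{u} k} {E'' : J'' ⥤ ModuleCat.{u} k}
    (P : J ⥤ J') (a : A ⟶ P.op ⋙ A') (e : E ⟶ P ⋙ E')
    (Q : J' ⥤ J'') (b : A' ⟶ Q.op ⋙ A'') (g : E' ⟶ Q ⋙ E'')
    (R : J ⥤ J'') (c : A ⟶ R.op ⋙ A'') (h : E ⟶ R ⋙ E'')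
    (θ : ∀ X, R.obj X ≅ Q.obj (P.obj X))
    (ha : ∀ X, a.app (op X) ≫ b.app (op (P.obj X)) = c.app (op X) ≫ A''.map (θ X).inv.op)
    (he : ∀ X, e.app X ≫ g.app (P.obj X) = h.app X ≫ E''.map (θ X).hom) :
    map R c h = map P a e ≫ map Q b g := by
  refine hom_ext fun X => ?_
  have h1 := reassoc_of% (ι_map P a e X)
  rw [h1, ι_map, ι_map, tensorHom_comp_tensorHom_assoc, ha, he, ← tensorHom_comp_tensorHom,
    Category.assoc]
  exact congrArg _ (ι_iso A'' E'' (θ X)).symm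

/-- The map of coends induced by a map of the second argument. -/
noncomputable def mapRight (A : Jᵒᵖ ⥤ ModuleCat.{u} k) {E E' : J ⥤ ModuleCat.{u} k} (e : E ⟶ E') :
    coten A E ⟶ coten A E' :=
  coend.desc (fun X => A.obj (op X) ◁ e.app X ≫ ι A E' X) (by
    intro X Y f
    change A.map f.op ▷ E.obj X ≫ A.obj (op X) ◁ e.app X ≫ ι A E' X =
      A.obj (op Y) ◁ E.map f ≫ A.obj (op Y) ◁ e.app Y ≫ ι A E' Y
    rw [← whisker_exchange_assoc, condition, ← MonoidalCategory.whiskerLeft_comp_assoc,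
      ← MonoidalCategory.whiskerLeft_comp_assoc, e.naturality])

theorem ι_mapRight (A : Jᵒᵖ ⥤ ModuleCat.{u} k) {E E' : J ⥤ ModuleCat.{u} k} (e : E ⟶ E')
    (X : J) : ι A E X ≫ mapRight A e = A.obj (op X) ◁ e.app X ≫ ι A E' X :=
  coend.ι_desc _ _ X

/-- The coend as a functor of its second argument. -/
noncomputable def functor (A : Jᵒᵖ ⥤ ModuleCat.{u} k) :
    (J ⥤ ModuleCat.{u} k) ⥤ ModuleCat.{u} k where
  obj E := coten A E
  map e := mapRight A e
  map_id E := hom_ext fun X => by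
    rw [ι_mapRight, NatTrans.id_app, MonoidalCategory.whiskerLeft_id, Category.id_comp,
      Category.comp_id]
  map_comp a b := hom_ext fun X => by
    have h := reassoc_of% (ι_mapRight A a X)
    rw [h, ι_mapRight, ι_mapRight, NatTrans.comp_app, MonoidalCategory.whiskerLeft_comp_assoc]

instance (A : Jᵒᵖ ⥤ ModuleCat.{u} k) : (functor A).PreservesZeroMorphisms where
  map_zero E E' := hom_ext fun X => by
    refine (ι_mapRight A (0 : E ⟶ E') X).trans ?_
    have h : (0 : E ⟶ E').app X = 0 := rfl
    rw [h, MonoidalPreadditive.whiskerLeft_zero, zero_comp]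
    exact comp_zero.symm

theorem map_naturality {A : Jᵒᵖ ⥤ ModuleCat.{u} k} {E F : J ⥤ ModuleCat.{u} k}
    {A' : J'ᵒᵖ ⥤ ModuleCat.{u} k} {E' F' : J' ⥤ ModuleCat.{u} k} (P : J ⥤ J')
    (a : A ⟶ P.op ⋙ A') (e : E ⟶ P ⋙ E') (e' : F ⟶ P ⋙ F') (g : E ⟶ F) (g' : E' ⟶ F')
    (h : ∀ X, e.app X ≫ g'.app (P.obj X) = g.app X ≫ e'.app X) :
    map P a e ≫ mapRight A' g' = mapRight A g ≫ map P a e' := by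
  refine hom_ext fun X => ?_
  have h1 := reassoc_of% (ι_map P a e X)
  have h2 := reassoc_of% (ι_mapRight A g X)
  rw [h1, h2, ι_map, ι_mapRight, ← id_tensorHom, ← id_tensorHom,
    tensorHom_comp_tensorHom_assoc, tensorHom_comp_tensorHom_assoc]
  have h3 : (a.app (op X) ≫ 𝟙 (A'.obj (op (P.obj X))) ⊗ₘ e.app X ≫ g'.app (P.obj X)) ≫
      ι A' F' (P.obj X) = (𝟙 _ ≫ a.app (op X) ⊗ₘ g.app X ≫ e'.app X) ≫ ι A' F' (P.obj X) := by
    rw [h, Category.comp_id, Category.id_comp]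
  exact h3

end coten

end Coten

section Unop

variable {C : Type u} [Category.{u} C] [MonoidalCategory C] {I J : Type}

/-- The tensor product in `Cᵒᵖ` is the opposite of the tensor product in `C`. -/
def tensUnop (N : I → Cᵒᵖ) : ∀ l : List I, tens (fun i => (N i).unop) l ≅ (tens N l).unop
  | [] => Iso.refl (𝟙_ C)
  | i :: l => whiskerLeftIso (N i).unop (tensUnop N l)

theorem tensUnop_natural {N N' : I → Cᵒᵖ} (g : ∀ i, N i ⟶ N' i) (l : List I) :
    tensMap (fun i => (g i).unop) l ≫ (tensUnop N l).hom =
      (tensUnop N' l).hom ≫ (tensMap g l).unop := by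
  induction l with
  | nil => rfl
  | cons i l ih =>
    change ((g i).unop ⊗ₘ tensMap (fun i => (g i).unop) l) ≫ (N i).unop ◁ (tensUnop N l).hom =
      (N' i).unop ◁ (tensUnop N' l).hom ≫ ((g i).unop ⊗ₘ (tensMap g l).unop)
    rw [← id_tensorHom, ← id_tensorHom, tensorHom_comp_tensorHom, tensorHom_comp_tensorHom, ih,
      Category.comp_id, Category.id_comp]

theorem tensUnop_append (N : I → Cᵒᵖ) (a b : List I) :
    (tensAppend (fun i => (N i).unop) a b).hom ≫ ((tensUnop N a).hom ⊗ₘ (tensUnop N b).hom) =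
      (tensUnop N (a ++ b)).hom ≫ (tensAppend N a b).inv.unop := by
  induction a with
  | nil =>
    change (λ_ _).inv ≫ (𝟙 (𝟙_ C) ⊗ₘ (tensUnop N b).hom) = (tensUnop N b).hom ≫ (λ_ _).inv
    simp
  | cons i a ih =>
    change ((N i).unop ◁ (tensAppend (fun i => (N i).unop) a b).hom ≫ (α_ _ _ _).inv) ≫
        (((N i).unop ◁ (tensUnop N a).hom) ⊗ₘ (tensUnop N b).hom) =
      ((N i).unop ◁ (tensUnop N (a ++ b)).hom) ≫ ((N i).unop ◁ (tensAppend N a b).inv.unop) ≫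
        (α_ _ _ _).inv
    rw [← MonoidalCategory.whiskerLeft_comp_assoc, ← ih, ← id_tensorHom (N i).unop (tensUnop N a).hom,
      Category.assoc, ← associator_inv_naturality, id_tensorHom,
      MonoidalCategory.whiskerLeft_comp_assoc]

theorem tensUnop_flat (N : I → Cᵒᵖ) (φ : J → List I) (l : List J) :
    (tensFlat (fun i => (N i).unop) φ l).hom ≫ tensMap (fun j => (tensUnop N (φ j)).hom) l ≫
        (tensUnop (fun j => tens N (φ j)) l).hom =
      (tensUnop N (l.flatMap φ)).hom ≫ (tensFlat N φ l).inv.unop := by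
  induction l with
  | nil => exact congrArg (𝟙 (𝟙_ C) ≫ ·) (Category.comp_id (𝟙 (𝟙_ C)))
  | cons j l ih =>
    change ((tensAppend _ (φ j) (l.flatMap φ)).hom ≫ _ ◁ (tensFlat _ φ l).hom) ≫
        ((tensUnop N (φ j)).hom ⊗ₘ tensMap (fun j => (tensUnop N (φ j)).hom) l) ≫
        (tens N (φ j)).unop ◁ (tensUnop (fun j => tens N (φ j)) l).hom =
      (tensUnop N (φ j ++ l.flatMap φ)).hom ≫ (tensAppend N (φ j) (l.flatMap φ)).inv.unop ≫
        (tens N (φ j)).unop ◁ (tensFlat N φ l).inv.unop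
    have h := reassoc_of% (tensUnop_append N (φ j) (l.flatMap φ))
    rw [← h, Category.assoc, ← id_tensorHom, ← id_tensorHom, ← id_tensorHom,
      tensorHom_comp_tensorHom, tensorHom_comp_tensorHom, tensorHom_comp_tensorHom, ih]
    simp

theorem tensUnop_one (N : I → Cᵒᵖ) (i : I) :
    (tensUnop N [i]).hom ≫ (tensOne N i).inv.unop = (tensOne (fun i => (N i).unop) i).hom := by
  change ((N i).unop ◁ 𝟙 (𝟙_ C)) ≫ (ρ_ (N i).unop).hom = (ρ_ (N i).unop).hom
  simp

end Unop

section Trace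

variable (C : Type u) [SmallCategory C] [MonoidalCategory C] (k : Type u) [Field k]

/-- The identification `C ≅ C^{V([1])}`. -/
def single : C ⥤ (CyclicCat.one.V → C) := Functor.pi' fun _ => 𝟭 C

/-- A right exact `k`-linear trace functor `tr : C ⥤ k-Vect`: a functor on `C_#` which inverts the
cocartesian maps and whose restriction `tr` to `C = C^{V([1])} ⊂ C_#` is `k`-linear and right exact. -/
structure TraceFunctor [Abelian C] [Linear k C] where
  /-- The extension to `C_#`. -/
  toFunctor : Cyc C ⥤ ModuleCat.{u} k
  isIso_map : ∀ {X Y : Cyc C} (f : X ⟶ Y), (∀ v, IsIso (f.ι v)) → IsIso (toFunctor.map f)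
  additive : (single C ⋙ Cyc.fiber CyclicCat.one ⋙ toFunctor).Additive
  linear : (single C ⋙ Cyc.fiber CyclicCat.one ⋙ toFunctor).Linear k
  rightExact : PreservesFiniteColimits (single C ⋙ Cyc.fiber CyclicCat.one ⋙ toFunctor)

variable {C}

/-- The identification of the opposite of `(Cᵒᵖ)^{V([n])}` with `C^{V([n])}`. -/
def unopFam (n : CyclicCat) : (n.V → Cᵒᵖ)ᵒᵖ ⥤ (n.V → C) where
  obj N := fun v => (N.unop v).unop
  map g := fun v => (g.unop v).unop

/-- The functors `f_!` for `C` and for `Cᵒᵖ` agree. -/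
def unopPush {m n : CyclicCat} (f : m ⟶ n) (N : (m.V → Cᵒᵖ)ᵒᵖ) :
    (push f).obj ((unopFam m).obj N) ⟶ (unopFam n).obj ((push f).op.obj N) :=
  fun v => (tensUnop N.unop (f.fib v)).hom

/-- The cocartesian maps `([m], N) ⟶ ([n], f_! N)` of `C_#`, for families `N` of objects of `Cᵒᵖ`. -/
def unopTrans {m n : CyclicCat} (f : m ⟶ n) :
    unopFam (C := C) m ⋙ Cyc.fiber m ⟶ (push f).op ⋙ unopFam n ⋙ Cyc.fiber n where
  app N := Cyc.lift f ((unopFam m).obj N) ≫ (Cyc.fiber n).map (unopPush f N)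
  naturality N N' g := by
    have h1 := reassoc_of% (Cyc.lift_natural f ((unopFam m).map g))
    change (Cyc.fiber m).map _ ≫ Cyc.lift f ((unopFam m).obj N') ≫ (Cyc.fiber n).map (unopPush f N') =
      (Cyc.lift f ((unopFam m).obj N) ≫ (Cyc.fiber n).map (unopPush f N)) ≫
        (Cyc.fiber n).map ((unopFam n).map ((push f).op.map g))
    rw [h1, Category.assoc, ← Functor.map_comp, ← Functor.map_comp]
    exact congrArg (fun t => Cyc.lift f ((unopFam m).obj N) ≫ (Cyc.fiber n).map t)
      (funext fun v => tensUnop_natural g.unop (f.fib v))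

theorem Cyc.lift_id {D : Type u} [SmallCategory D] [MonoidalCategory D] {n : CyclicCat}
    (M : n.V → D) : Cyc.lift (𝟙 n) M = (Cyc.fiber n).map (pushId M).inv :=
  Cyc.Hom.ext' rfl fun (v : n.V) => (tensOne M v).hom_inv_id.symm.trans
    (Category.id_comp _).symm

theorem unopTrans_id {n : CyclicCat} (N : n.V → Cᵒᵖ) :
    (unopTrans (𝟙 n)).app (op N) = (Cyc.fiber n).map ((unopFam n).map (pushId N).hom.op) := by
  change Cyc.lift (𝟙 n) ((unopFam n).obj (op N)) ≫ (Cyc.fiber n).map (unopPush (𝟙 n) (op N)) = _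
  rw [Cyc.lift_id, ← Functor.map_comp]
  refine congrArg (fun t => (Cyc.fiber n).map t) (funext fun v => ?_)
  change (tensOne (fun i => (N i).unop) v).inv ≫ (tensUnop N [v]).hom = (tensOne N v).hom.unop
  rw [Iso.inv_comp_eq, ← tensUnop_one, Category.assoc, ← unop_comp, Iso.hom_inv_id, unop_id,
    Category.comp_id]

theorem unopTrans_comp {m n p : CyclicCat} (f : m ⟶ n) (g : n ⟶ p) (N : m.V → Cᵒᵖ) :
    (unopTrans f).app (op N) ≫ (unopTrans g).app (op ((push f).obj N)) =
      (unopTrans (f ≫ g)).app (op N) ≫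
        (Cyc.fiber p).map ((unopFam p).map (pushComp f g N).inv.op) := by
  change (Cyc.lift f ((unopFam m).obj (op N)) ≫ (Cyc.fiber n).map (unopPush f (op N))) ≫
    Cyc.lift g ((unopFam n).obj ((push f).op.obj (op N))) ≫
      (Cyc.fiber p).map (unopPush g ((push f).op.obj (op N))) =
    (Cyc.lift (f ≫ g) ((unopFam m).obj (op N)) ≫ (Cyc.fiber p).map (unopPush (f ≫ g) (op N))) ≫ _
  have h1 := reassoc_of% (Cyc.lift_natural g (unopPush f (op N)))
  have h2 := reassoc_of% (Cyc.lift_comp f g ((unopFam m).obj (op N)))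
  have h3 : (pushComp f g ((unopFam m).obj (op N))).hom ≫ (push g).map (unopPush f (op N)) ≫
      unopPush g ((push f).op.obj (op N)) =
    unopPush (f ≫ g) (op N) ≫ (unopFam p).map (pushComp f g N).inv.op :=
    funext fun v => tensUnop_flat N f.fib (g.fib v)
  rw [Category.assoc, h1, h2, Category.assoc, ← Functor.map_comp, ← Functor.map_comp, h3]
  exact congrArg (_ ≫ ·) (Functor.map_comp _ _ _)

end Trace

section Sheaves

variable (C : Type u) [SmallCategory C] [Abelian C] (k : Type u) [Field k] [Linear k C]

/-- The category `Shv(C^n)` of polylinear functors `(Cᵒᵖ)^n ⥤ k-Vect` which are left exact in each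
variable. -/
abbrev Shv (n : CyclicCat) : Type (u + 1) := (shvProp (D := Cᵒᵖ) k n.V).FullSubcategory

theorem shvProp_isRightAdjoint_ι (n : CyclicCat) :
    (shvProp (D := Cᵒᵖ) k n.V).ι.IsRightAdjoint := by
  have h : shvProp (D := Cᵒᵖ) k n.V =
      lexAlong k (fun p : (n.V → Cᵒᵖ) × n.V => slot p.1 p.2) := by
    ext E
    exact ⟨fun h p => h p.1 p.2, fun h M v => h (M, v)⟩
  rw [h]
  exact lexAlong_isRightAdjoint_ι _

variable [MonoidalCategory C] [MonoidalPreadditive C] [MonoidalLinear k C]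
  [∀ X : C, PreservesFiniteColimits (tensorLeft X)]
  [∀ X : C, PreservesFiniteColimits (tensorRight X)]

variable {C} in
/-- The restriction functor `E ↦ E ∘ f_!` from `Shv(C^n)` to `Shv(C^m)`, for `f : [m] ⟶ [n]`. -/
def restr {m n : CyclicCat} (f : m ⟶ n) : Shv C k n ⥤ Shv C k m :=
  ObjectProperty.lift _ ((shvProp k n.V).ι ⋙ (Functor.whiskeringLeft _ _ _).obj (push f))
    fun E => by
      have := tensorLeft_op (C := C)
      have := tensorRight_op (C := C)
      exact shvProp_push k f E.property

variable {C} in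
/-- The restriction functor has a left adjoint. -/
instance restr_isRightAdjoint {m n : CyclicCat} (f : m ⟶ n) :
    (restr (C := C) k f).IsRightAdjoint := by
  have := shvProp_isRightAdjoint_ι C k n
  have adj := ((push (C := Cᵒᵖ) f).lanAdjunction (ModuleCat.{u} k)).comp
    (Adjunction.ofIsRightAdjoint (shvProp (D := Cᵒᵖ) k n.V).ι)
  exact (adj.restrictFullyFaithful (iC := (shvProp (D := Cᵒᵖ) k m.V).ι) (iD := 𝟭 _)
    (ObjectProperty.fullyFaithfulι _) (Functor.FullyFaithful.id _)
    (comm1 := (Functor.rightUnitor ((shvProp (D := Cᵒᵖ) k m.V).ι ⋙ (push f).lan ⋙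
      (shvProp (D := Cᵒᵖ) k n.V).ι.leftAdjoint)).symm)
    (comm2 := Iso.refl _) : _ ⊣ restr (C := C) k f).isRightAdjoint

variable {C} in
/-- The functor `(f_!)_! : Shv(C^m) ⥤ Shv(C^n)`, left adjoint to the restriction functor. -/
noncomputable def directImage {m n : CyclicCat} (f : m ⟶ n) : Shv C k m ⥤ Shv C k n :=
  (restr (C := C) k f).leftAdjoint

/-- The functors `(Cᵒᵖ)_# ⥤ k-Vect` whose restriction to `(Cᵒᵖ)^n` is in `Shv(C^n)` for all
`n`. -/
def sharpShv : ObjectProperty (Cyc Cᵒᵖ ⥤ ModuleCat.{u} k) :=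
  fun E => ∀ n, shvProp k n.V (Cyc.fiber n ⋙ E)

/-- The category `Shv(C_#)`. -/
abbrev ShvSharp : Type (u + 1) := (sharpShv C k).FullSubcategory

variable {C k}

/-- The functor `E ↦ E([n])` from `Shv(C_#)` to `Shv(C^n)`. -/
def component (n : CyclicCat) : ShvSharp C k ⥤ Shv C k n :=
  ObjectProperty.lift _ ((sharpShv C k).ι ⋙ (Functor.whiskeringLeft _ _ _).obj (Cyc.fiber n))
    fun E => E.property n

/-- The maps `E(M) ⟶ E(f_! M)`. -/
def liftTrans (E : Cyc Cᵒᵖ ⥤ ModuleCat.{u} k) {m n : CyclicCat} (f : m ⟶ n) :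
    Cyc.fiber m ⋙ E ⟶ push f ⋙ Cyc.fiber n ⋙ E where
  app M := E.map (Cyc.lift f M)
  naturality M N g := by
    have h := congrArg E.map (Cyc.lift_natural f g)
    rw [Functor.map_comp, Functor.map_comp] at h
    exact h

/-- The transition map `E([m]) ⟶ f_!^* E([n])`. -/
def transition (E : ShvSharp C k) {m n : CyclicCat} (f : m ⟶ n) :
    (component m).obj E ⟶ (restr k f).obj ((component n).obj E) :=
  ObjectProperty.homMk (liftTrans E.obj f)

/-- The transition map in its adjoint form `(f_!)_! E([m]) ⟶ E([n])`. -/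
noncomputable def transitionAdj (E : ShvSharp C k) {m n : CyclicCat} (f : m ⟶ n) :
    (directImage k f).obj ((component m).obj E) ⟶ (component n).obj E :=
  ((Adjunction.ofIsRightAdjoint (restr k f)).homEquiv _ _).symm (transition E f)

/-- The objects of `Shv_cart(C_#)`: all transition maps `(f_!)_! E([m]) ⟶ E([n])` are isomorphisms,
and `E([1])` is the functor `Hom(-, X)` for an object `X` of `C`. -/
structure ShvCart (E : ShvSharp C k) : Prop where
  cocartesian : ∀ {m n : CyclicCat} (f : m ⟶ n), IsIso (transitionAdj E f)
  representable : ∃ X : C, Nonempty (((component CyclicCat.one).obj E).obj ≅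
    Pi.eval _ ⟨0, Nat.one_pos⟩ ⋙ (linearYoneda k C).obj X)

namespace TraceFunctor

variable (T : TraceFunctor C k)

/-- The colimit-preserving extension of the trace functor from `C^{V([n])}`, that is, the coend
of `tr([n], M) ⊗ E(M)` over `M`. -/
noncomputable def trFun (n : CyclicCat) : ((n.V → Cᵒᵖ) ⥤ ModuleCat.{u} k) ⥤ ModuleCat.{u} k :=
  coten.functor (unopFam n ⋙ Cyc.fiber n ⋙ T.toFunctor)

/-- The trace functor `tr : Shv(C^n) ⥤ k-Vect`. -/
noncomputable def tr (n : CyclicCat) : Shv C k n ⥤ ModuleCat.{u} k :=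
  (shvProp k n.V).ι ⋙ T.trFun n

/-- The functor `[n] ↦ tr(E([n]))` on `Λ`. The map for `f : [m] ⟶ [n]` is induced by the maps
`tr([m], M) ⟶ tr([n], f_! M)` and `E(M) ⟶ E(f_! M)`. -/
noncomputable def trSharpObj (E : Cyc Cᵒᵖ ⥤ ModuleCat.{u} k) : CyclicCat ⥤ ModuleCat.{u} k where
  obj n := (T.trFun n).obj (Cyc.fiber n ⋙ E)
  map {m n} f := coten.map (push f) (Functor.whiskerRight (unopTrans f) T.toFunctor)
    (liftTrans E f)
  map_id n := coten.map_eq_id _ _ _ (fun N => (pushId N).symm)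
    (fun N => congrArg T.toFunctor.map (unopTrans_id N))
    (fun N => congrArg E.map (Cyc.lift_id N))
  map_comp f g := coten.map_eq_comp _ _ _ _ _ _ _ _ _ (fun N => pushComp f g N)
    (fun N => by
      have h := congrArg T.toFunctor.map (unopTrans_comp f g N)
      rw [Functor.map_comp, Functor.map_comp] at h
      exact h)
    (fun N => by
      have h := congrArg E.map (Cyc.lift_comp f g N)
      rw [Functor.map_comp, Functor.map_comp] at h
      exact h)

theorem trSharp_naturality {E E' : Cyc Cᵒᵖ ⥤ ModuleCat.{u} k} (e : E ⟶ E') {m n : CyclicCat}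
    (f : m ⟶ n) :
    (T.trSharpObj E).map f ≫ (T.trFun n).map (Functor.whiskerLeft (Cyc.fiber n) e) =
      (T.trFun m).map (Functor.whiskerLeft (Cyc.fiber m) e) ≫ (T.trSharpObj E').map f :=
  coten.map_naturality _ _ _ _ _ _ fun M => e.naturality (Cyc.lift f M)

/-- The functor `tr_# : Shv(C_#) ⥤ Fun(Λ, k)`. -/
noncomputable def trSharp : ShvSharp C k ⥤ (CyclicCat ⥤ ModuleCat.{u} k) where
  obj E := T.trSharpObj E.obj
  map e :=
    { app := fun n => (T.trFun n).map (Functor.whiskerLeft (Cyc.fiber n) e.hom)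
      naturality := fun _ _ f => T.trSharp_naturality e.hom f }
  map_id E := NatTrans.ext (funext fun n => (T.trFun n).map_id (Cyc.fiber n ⋙ E.obj))
  map_comp a b := NatTrans.ext (funext fun n =>
    (T.trFun n).map_comp (Functor.whiskerLeft (Cyc.fiber n) a.hom)
      (Functor.whiskerLeft (Cyc.fiber n) b.hom))

instance (n : CyclicCat) : (T.trFun n).PreservesZeroMorphisms :=
  inferInstanceAs (coten.functor _).PreservesZeroMorphisms

instance (n : CyclicCat) : (T.tr n).PreservesZeroMorphisms where
  map_zero E E' := (T.trFun n).map_zero E.obj E'.obj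

instance : T.trSharp.PreservesZeroMorphisms where
  map_zero E E' := NatTrans.ext (funext fun n =>
    (T.trFun n).map_zero (Cyc.fiber n ⋙ E.obj) (Cyc.fiber n ⋙ E'.obj))

end TraceFunctor

end Sheaves

section Resolutions

variable {A B : Type*} [Category* A] [Category* B] [HasZeroMorphisms A] [HasZeroMorphisms B]

/-- The augmented complex `⋯ ⟶ X₁ ⟶ X₀ ⟶ E ⟶ 0` is exact. -/
structure IsResolution (X : ChainComplex A ℕ) {E : A} (ε : X.X 0 ⟶ E) : Prop where
  zero : X.d 1 0 ≫ ε = 0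
  exact_zero : (ShortComplex.mk (X.d 1 0) ε zero).Exact
  epi : Epi ε
  exact_succ : ∀ i, X.ExactAt (i + 1)

/-- The object `E` is acyclic for the (right exact) functor `F`, that is, the left derived functors of
`F` are defined at `E`, and vanish in positive degrees: every resolution of `E` is dominated by a
resolution whose image under `F` is a resolution of `F(E)`. -/
def IsLeftAcyclic (F : A ⥤ B) [F.PreservesZeroMorphisms] (E : A) : Prop :=
  ∀ (X : ChainComplex A ℕ) (ε : X.X 0 ⟶ E), IsResolution X ε →
    ∃ (Q : ChainComplex A ℕ) (t : Q ⟶ X), IsResolution Q (t.f 0 ≫ ε) ∧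
      IsResolution (E := F.obj E) ((F.mapHomologicalComplex _).obj Q) (F.map (t.f 0 ≫ ε))

variable (A) in
/-- The quasi-isomorphisms of complexes in `A`: the maps which induce isomorphisms on homology. The
category `A` is not assumed to be known to be abelian, so that existence of the homology objects is
a part of the condition; see `qis_eq`. -/
def qis : MorphismProperty (CochainComplex A ℤ) := fun K L f =>
  ∀ i, ∃ (_ : K.HasHomology i) (_ : L.HasHomology i), QuasiIsoAt f i

end Resolutions

theorem qis_eq {A : Type*} [Category* A] [HasZeroMorphisms A] [CategoryWithHomology A] :
    qis A = HomologicalComplex.quasiIso A (.up ℤ) := by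
  ext K L f
  rw [HomologicalComplex.mem_quasiIso_iff]
  exact ⟨fun h => ⟨fun i => (h i).choose_spec.choose_spec⟩, fun h i => ⟨inferInstance, inferInstance, h.1 i⟩⟩

section Main

variable {C : Type u} [SmallCategory C] [Abelian C] {k : Type u} [Field k] [Linear k C]
  [MonoidalCategory C] [MonoidalPreadditive C] [MonoidalLinear k C]
  [∀ X : C, PreservesFiniteColimits (tensorLeft X)]
  [∀ X : C, PreservesFiniteColimits (tensorRight X)]

/-- `(f_!)_!` is a left adjoint. -/
instance {m n : CyclicCat} (f : m ⟶ n) : (directImage (C := C) k f).IsLeftAdjoint :=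
  inferInstanceAs (restr (C := C) k f).leftAdjoint.IsLeftAdjoint

instance {m n : CyclicCat} (f : m ⟶ n) : (directImage (C := C) k f).PreservesZeroMorphisms :=
  inferInstance

instance (n : CyclicCat) : (component (C := C) (k := k) n).PreservesZeroMorphisms where
  map_zero _ _ := rfl

/-- The pair `⟨C, tr⟩` is homologically clean: each `Shv(C^n)` has enough objects `E` such that
`E` is acyclic for all `(f_!)_!` and for `tr`, and all `(f_!)_! E` are acyclic for `tr`. -/
def TraceFunctor.HomologicallyClean (T : TraceFunctor C k) : Prop :=
  ∀ (n : CyclicCat) (F : Shv C k n), ∃ (E : Shv C k n) (p : E ⟶ F), Epi p ∧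
    (∀ (n' : CyclicCat) (f : n ⟶ n'), IsLeftAcyclic (directImage k f) E) ∧
    IsLeftAcyclic (T.tr n) E ∧
    ∀ (n' : CyclicCat) (f : n ⟶ n'), IsLeftAcyclic (T.tr n') ((directImage k f).obj E)

variable (C k) in
/-- The objects of `DΛ(C)`: complexes in `Shv(C_#)` with homology in `Shv_cart(C_#)`. -/
def dLambda : ObjectProperty (CochainComplex (ShvSharp C k) ℤ) := fun K =>
  ∀ i, ∃ _ : K.HasHomology i, ShvCart (K.homology i)

/-- The category of objects `[n]` of `Λ` with a map `[1] ⟶ [n]`, that is, with a vertex; it is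
equivalent to `Δᵒᵖ`. -/
abbrev DeltaOp := Under CyclicCat.one

variable (k) in
/-- The functor `j^* : Fun(Λ, k) ⥤ Fun(Δᵒᵖ, k)`. -/
noncomputable abbrev simplicialRestr :
    (CyclicCat ⥤ ModuleCat.{u} k) ⥤ (DeltaOp ⥤ ModuleCat.{u} k) :=
  (Functor.whiskeringLeft _ _ _).obj (Under.forget _)

/-- The functor `tr` from complexes in `Shv(C)` to the derived category of vector spaces. -/
noncomputable def TraceFunctor.trQ [HasDerivedCategory.{w₁} (ModuleCat.{u} k)] (T : TraceFunctor C k) :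
    CochainComplex (Shv C k CyclicCat.one) ℤ ⥤ DerivedCategory (ModuleCat.{u} k) :=
  (T.tr CyclicCat.one).mapHomologicalComplex _ ⋙ DerivedCategory.Q

/-- The functor `tr_#` from complexes in `Shv(C_#)` to the derived category of `Fun(Λ, k)`. -/
noncomputable def TraceFunctor.trSharpQ [HasDerivedCategory.{w₂} (CyclicCat ⥤ ModuleCat.{u} k)]
    (T : TraceFunctor C k) :
    CochainComplex (ShvSharp C k) ℤ ⥤ DerivedCategory (CyclicCat ⥤ ModuleCat.{u} k) :=
  T.trSharp.mapHomologicalComplex _ ⋙ DerivedCategory.Q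

variable (k) in
/-- The functor `colim` from complexes in `Fun(Δᵒᵖ, k)` to the derived category of vector spaces. Its
left derived functor is homology of the category `Δᵒᵖ` with coefficients. -/
noncomputable def colimQ [HasDerivedCategory.{w₁} (ModuleCat.{u} k)] :
    CochainComplex (DeltaOp ⥤ ModuleCat.{u} k) ℤ ⥤ DerivedCategory (ModuleCat.{u} k) :=
  (colim (J := DeltaOp) (C := ModuleCat.{u} k)).mapHomologicalComplex _ ⋙ DerivedCategory.Q

end Main

end CyclicHH

open CyclicHH

universe v

namespace CyclicHH

section Resolution

open Functor

variable {C D H : Type*} [Category* C] [Category* D] [Category* H]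
  {W : MorphismProperty C} {F : C ⥤ H} {R : C ⥤ C} (p : R ⟶ 𝟭 C)
  (P : ObjectProperty C)

/-- The data `R`, `p` and `P` of functorial left resolutions adapted to the functor `F`. -/
structure IsAdapted (W : MorphismProperty C) (F : C ⥤ H) {R : C ⥤ C} (p : R ⟶ 𝟭 C)
    (P : ObjectProperty C) : Prop where
  weq : ∀ X, W (p.app X)
  prop : ∀ X, P (R.obj X)
  isIso_map : ∀ {X Y : C} (f : X ⟶ Y), W f → P X → P Y → IsIso (F.map f)

namespace IsAdapted

variable {p P} [W.HasTwoOutOfThreeProperty]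

section
variable (h : IsAdapted W F p P)
include h

theorem isInvertedBy : W.IsInvertedBy (R ⋙ F) := fun X Y f hf => by
  refine h.isIso_map (R.map f) ?_ (h.prop X) (h.prop Y)
  have h1 : W (R.map f ≫ p.app Y) := by
    have e : R.map f ≫ p.app Y = p.app X ≫ f := p.naturality f
    rw [e]
    exact W.comp_mem _ _ (h.weq X) hf
  exact W.of_postcomp _ _ (h.weq Y) h1

variable (L : C ⥤ D) [L.IsLocalization W]

/-- The left derived functor defined by functorial resolutions. -/
noncomputable def derived : D ⥤ H := Localization.lift (R ⋙ F) h.isInvertedBy L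

/-- The values of the left derived functor. -/
noncomputable def derivedIso : L ⋙ h.derived L ≅ R ⋙ F :=
  Localization.fac (R ⋙ F) h.isInvertedBy L

/-- The counit of the left derived functor. -/
noncomputable def counit : L ⋙ h.derived L ⟶ F :=
  (h.derivedIso L).hom ≫ whiskerRight p F

theorem isIso_counit_app {X : C} (hX : P X) : IsIso ((h.counit L).app X) := by
  have : IsIso (F.map (p.app X)) := h.isIso_map _ (h.weq X) (h.prop X) hX
  change IsIso ((h.derivedIso L).hom.app X ≫ F.map (p.app X))
  infer_instance

theorem isRightKanExtension : (h.derived L).IsRightKanExtension (h.counit L) := by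
  have hL := Localization.inverts L W
  have := Localization.full_whiskeringLeft L W H
  have := Localization.faithful_whiskeringLeft L W H
  have i1 : ∀ X, IsIso (L.map (p.app X)) := fun X => hL _ (h.weq X)
  have i2 : ∀ X, IsIso ((h.counit L).app (R.obj X)) := fun X => h.isIso_counit_app L (h.prop X)
  have lift : ∀ (G : D ⥤ H) (β : L ⋙ G ⟶ F), ∃ τ : G ⟶ h.derived L,
      whiskerLeft L τ ≫ h.counit L = β := by
    intro G β
    let σ : L ⋙ G ⟶ L ⋙ h.derived L :=
      { app := fun X => inv (G.map (L.map (p.app X))) ≫ β.app (R.obj X) ≫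
          (h.derivedIso L).inv.app X
        naturality := fun X Y f => by
          have e : R.map f ≫ p.app Y = p.app X ≫ f := p.naturality f
          have e1 : G.map (L.map (R.map f)) ≫ G.map (L.map (p.app Y)) =
              G.map (L.map (p.app X)) ≫ G.map (L.map f) := by
            rw [← G.map_comp, ← L.map_comp, e, L.map_comp, G.map_comp]
          have e2 : G.map (L.map f) ≫ inv (G.map (L.map (p.app Y))) =
              inv (G.map (L.map (p.app X))) ≫ G.map (L.map (R.map f)) := by
            rw [IsIso.comp_inv_eq, Category.assoc, e1, IsIso.inv_hom_id_assoc]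
          have e3 := β.naturality (R.map f)
          have e4 := (h.derivedIso L).inv.naturality f
          dsimp at e3 e4 ⊢
          rw [reassoc_of% e2, reassoc_of% e3, e4, Category.assoc, Category.assoc] }
    refine ⟨((whiskeringLeft C D H).obj L).preimage σ, ?_⟩
    have e : whiskerLeft L (((whiskeringLeft C D H).obj L).preimage σ) = σ :=
      ((whiskeringLeft C D H).obj L).map_preimage σ
    rw [e]
    ext X
    have e3 := β.naturality (p.app X)
    dsimp [σ, counit] at e3 ⊢
    rw [Category.assoc, Category.assoc, Iso.inv_hom_id_app_assoc]
    rw [IsIso.inv_comp_eq]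
    exact e3.symm
  have uniq : ∀ (G : D ⥤ H) (τ τ' : G ⟶ h.derived L),
      whiskerLeft L τ ≫ h.counit L = whiskerLeft L τ' ≫ h.counit L → τ = τ' := by
    intro G τ τ' hτ
    apply ((whiskeringLeft C D H).obj L).map_injective
    ext X
    change τ.app (L.obj X) = τ'.app (L.obj X)
    have e1 := τ.naturality (L.map (p.app X))
    have e2 := τ'.naturality (L.map (p.app X))
    have e3 := congrArg (fun t => t.app (R.obj X)) hτ
    dsimp at e3
    rw [cancel_mono] at e3
    rw [e3] at e1
    exact (cancel_epi _).1 (e1.trans e2.symm)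
  refine ⟨⟨IsTerminal.ofUniqueHom (fun E => CostructuredArrow.homMk (lift E.left E.hom).choose
    (lift E.left E.hom).choose_spec) fun E f => ?_⟩⟩
  ext1
  exact uniq _ _ _ ((CostructuredArrow.w f).trans (lift E.left E.hom).choose_spec.symm)

theorem isLeftDerivedFunctor : (h.derived L).IsLeftDerivedFunctor (h.counit L) W :=
  ⟨h.isRightKanExtension L⟩

theorem hasLeftDerivedFunctor : F.HasLeftDerivedFunctor W :=
  have := h.isLeftDerivedFunctor W.Q
  HasLeftDerivedFunctor.mk' (h.derived W.Q) (h.counit W.Q)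

theorem isIso_app {L : C ⥤ D} [L.IsLocalization W] (LF : D ⥤ H) (α : L ⋙ LF ⟶ F)
    [LF.IsLeftDerivedFunctor α W] {X : C} (hX : P X) : IsIso (α.app X) := by
  have := h.isLeftDerivedFunctor L
  let e := leftDerivedNatIso (h.derived L) LF (h.counit L) α W (Iso.refl F)
  have e1 : e.hom.app (L.obj X) ≫ α.app X = (h.counit L).app X := by
    have := leftDerivedNatTrans_app (h.derived L) LF (h.counit L) α W (𝟙 F) X
    exact this.trans (Category.comp_id _)
  have := h.isIso_counit_app L hX
  rw [← isIso_comp_left_iff (e.hom.app (L.obj X)), e1]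
  infer_instance

end

end IsAdapted

end Resolution

end CyclicHH

namespace CyclicHH

section Telescope

open Pretriangulated

variable {𝒯 : Type*} [Category* 𝒯] [HasZeroObject 𝒯] [HasShift 𝒯 ℤ] [Preadditive 𝒯]
  [∀ n : ℤ, (shiftFunctor 𝒯 n).Additive] [Pretriangulated 𝒯] (P : ObjectProperty 𝒯)
  [P.IsStableUnderShift ℤ]

theorem exists_precomp_shift {X Y : 𝒯} (φ : X ⟶ Y)
    (h : ∀ Z, P Z → ∀ g : X ⟶ Z, ∃ g' : Y ⟶ Z, φ ≫ g' = g) (Z : 𝒯) (hZ : P Z)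
    (g : X⟦(1 : ℤ)⟧ ⟶ Z) : ∃ g' : Y⟦(1 : ℤ)⟧ ⟶ Z, φ⟦(1 : ℤ)⟧' ≫ g' = g := by
  let e : Z⟦(-1 : ℤ)⟧⟦(1 : ℤ)⟧ ≅ Z := (shiftFunctorCompIsoId 𝒯 (-1 : ℤ) 1 (by simp)).app Z
  obtain ⟨k, hk⟩ := (shiftFunctor 𝒯 (1 : ℤ)).map_surjective (g ≫ e.inv)
  obtain ⟨k', rfl⟩ := h _ (P.le_shift (-1 : ℤ) _ hZ) k
  refine ⟨k'⟦(1 : ℤ)⟧' ≫ e.hom, ?_⟩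
  rw [← Category.assoc, ← Functor.map_comp, hk, Category.assoc, e.inv_hom_id, Category.comp_id]

variable {P} in
theorem leftOrthogonal_shift {X : 𝒯} (hX : P.leftOrthogonal X) :
    P.leftOrthogonal (X⟦(1 : ℤ)⟧) :=
  P.leftOrthogonal.le_shift (1 : ℤ) _ hX

theorem leftOrthogonal_of_bijective (T : Triangle 𝒯) (hT : T ∈ distTriang 𝒯)
    (h : ∀ Z, P Z → Function.Bijective (fun g : T.obj₂ ⟶ Z => T.mor₁ ≫ g)) :
    P.leftOrthogonal T.obj₃ := by
  intro Z f hZ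
  have h1 : T.mor₂ ≫ f = 0 := (h Z hZ).1 (by
    change T.mor₁ ≫ T.mor₂ ≫ f = T.mor₁ ≫ 0
    rw [comp_distTriang_mor_zero₁₂_assoc _ hT, zero_comp, comp_zero])
  obtain ⟨g, rfl⟩ := Triangle.yoneda_exact₃ T hT f h1
  obtain ⟨g', rfl⟩ := exists_precomp_shift P T.mor₁ (fun Z hZ => (h Z hZ).2) Z hZ g
  rw [comp_distTriang_mor_zero₃₁_assoc _ hT, zero_comp]

theorem bijective_of_leftOrthogonal₃ (T : Triangle 𝒯) (hT : T ∈ distTriang 𝒯)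
    (h : P.leftOrthogonal T.obj₁) (Z : 𝒯) (hZ : P Z) :
    Function.Bijective (fun g : T.obj₃ ⟶ Z => T.mor₂ ≫ g) := by
  constructor
  · intro f f' hf
    rw [← sub_eq_zero]
    have h0 : T.mor₂ ≫ (f - f') = 0 := by
      rw [Preadditive.comp_sub, sub_eq_zero]; exact hf
    obtain ⟨g, hg⟩ := Triangle.yoneda_exact₃ T hT _ h0
    rw [hg, leftOrthogonal_shift h g hZ, comp_zero]
  · intro g
    obtain ⟨g', hg'⟩ := Triangle.yoneda_exact₂ T hT g (h _ hZ)
    exact ⟨g', hg'.symm⟩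

variable {X : ℕ → 𝒯} (x : ∀ n, X n ⟶ X (n + 1)) (c : Cofan X) (hc : IsColimit c)
  (s : c.pt ⟶ c.pt) (hs : ∀ n, c.inj n ≫ s = x n ≫ c.inj (n + 1))
  {T : 𝒯} (ℓ : c.pt ⟶ T) (δ : T ⟶ c.pt⟦(1 : ℤ)⟧)
  (hT : Triangle.mk (𝟙 c.pt - s) ℓ δ ∈ distTriang 𝒯)

include hc hs hT

/-- The telescope of a sequence of maps which induce zero maps on `Hom(-, Z)`. -/
theorem leftOrthogonal_telescope (h : ∀ n Z, P Z → ∀ g : X (n + 1) ⟶ Z, x n ≫ g = 0) :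
    P.leftOrthogonal T := by
  refine leftOrthogonal_of_bijective P _ hT fun Z hZ => ?_
  have e : (fun g : c.pt ⟶ Z => (𝟙 c.pt - s) ≫ g) = id := by
    funext g
    have h0 : s ≫ g = 0 := Cofan.IsColimit.hom_ext hc _ _ fun n => by
      rw [reassoc_of% (hs n), h n Z hZ, comp_zero]
    rw [Preadditive.sub_comp, h0, Category.id_comp, sub_zero, id]
  exact e ▸ Function.bijective_id

theorem bijective_telescope
    (h : ∀ n Z, P Z → Function.Bijective (fun g : X (n + 1) ⟶ Z => x n ≫ g)) (Z : 𝒯) (hZ : P Z) :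
    Function.Bijective (fun g : T ⟶ Z => (c.inj 0 ≫ ℓ) ≫ g) := by
  have hsurj : ∀ Z, P Z → ∀ g : c.pt ⟶ Z, ∃ g' : c.pt ⟶ Z, (𝟙 c.pt - s) ≫ g' = g := by
    intro Z hZ g
    choose sol hsol using fun n => (h n Z hZ).2
    let ξ : ∀ n, X n ⟶ Z := fun n => Nat.rec (motive := fun n => X n ⟶ Z) 0
      (fun n t => sol n (t - c.inj n ≫ g)) n
    have hξ : ∀ n, x n ≫ ξ (n + 1) = ξ n - c.inj n ≫ g := fun n => hsol n (ξ n - c.inj n ≫ g)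
    refine ⟨Cofan.IsColimit.desc hc ξ, Cofan.IsColimit.hom_ext hc _ _ fun n => ?_⟩
    rw [Preadditive.sub_comp, Category.id_comp, Preadditive.comp_sub, Cofan.IsColimit.fac,
      reassoc_of% (hs n), Cofan.IsColimit.fac, hξ, sub_sub_cancel]
  have hz : (𝟙 c.pt - s) ≫ ℓ = 0 := comp_distTriang_mor_zero₁₂ _ hT
  have hstep : ∀ n, c.inj n ≫ ℓ = x n ≫ c.inj (n + 1) ≫ ℓ := by
    intro n
    rw [← reassoc_of% (hs n), ← sub_eq_zero, ← Preadditive.comp_sub]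
    have : ℓ - s ≫ ℓ = 0 := by rw [← hz, Preadditive.sub_comp, Category.id_comp]
    rw [this, comp_zero]
  constructor
  · intro f f' hf
    rw [← sub_eq_zero]
    have h0 : ∀ n, c.inj n ≫ ℓ ≫ (f - f') = 0 := by
      intro n
      induction n with
      | zero =>
        rw [← Category.assoc, Preadditive.comp_sub, sub_eq_zero]; exact hf
      | succ n ih =>
        apply (h n Z hZ).1
        change x n ≫ c.inj (n + 1) ≫ ℓ ≫ (f - f') = x n ≫ 0
        rw [comp_zero, ← ih, reassoc_of% (hstep n)]
    have h1 : ℓ ≫ (f - f') = 0 := Cofan.IsColimit.hom_ext hc _ _ fun n => by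
      rw [h0, comp_zero]
    obtain ⟨g, hg⟩ := Triangle.yoneda_exact₃ _ hT (f - f') h1
    obtain ⟨g', rfl⟩ := exists_precomp_shift P _ hsurj Z hZ g
    rw [hg]
    exact comp_distTriang_mor_zero₃₁_assoc _ hT _ |>.trans zero_comp
  · intro g
    choose sol hsol using fun n => (h n Z hZ).2
    let ξ : ∀ n, X n ⟶ Z := fun n => Nat.rec (motive := fun n => X n ⟶ Z) g
      (fun n t => sol n t) n
    have hξ : ∀ n, x n ≫ ξ (n + 1) = ξ n := fun n => hsol n (ξ n)
    have h1 : (𝟙 c.pt - s) ≫ Cofan.IsColimit.desc hc ξ = 0 :=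
      Cofan.IsColimit.hom_ext hc _ _ fun n => by
        rw [Preadditive.sub_comp, Category.id_comp, Preadditive.comp_sub, Cofan.IsColimit.fac,
          reassoc_of% (hs n), Cofan.IsColimit.fac, hξ, sub_self, comp_zero]
    obtain ⟨ψ, hψ⟩ : ∃ ψ : T ⟶ Z, Cofan.IsColimit.desc hc ξ = ℓ ≫ ψ :=
      Triangle.yoneda_exact₂ _ hT (Cofan.IsColimit.desc hc ξ) h1
    refine ⟨ψ, ?_⟩
    change (c.inj 0 ≫ ℓ) ≫ ψ = g
    rw [Category.assoc, ← hψ, Cofan.IsColimit.fac]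
    rfl

end Telescope

section Complexes

open HomologicalComplex CochainComplex CochainComplex.HomComplex

variable {A : Type*} [Category* A] [Abelian A]

/-- The complexes `X` such that all maps from `X` to complexes in the class `𝒵` are homotopic
to zero. -/
def leftPerp (𝒵 : ObjectProperty (CochainComplex A ℤ)) : ObjectProperty (CochainComplex A ℤ) :=
  fun X => ∀ ⦃Z⦄, 𝒵 Z → ∀ f : X ⟶ Z, Nonempty (Homotopy f 0)

/-- The class of objects of the homotopy category defined by a class of complexes. -/
def htpyProp (𝒵 : ObjectProperty (CochainComplex A ℤ)) :
    ObjectProperty (HomotopyCategory A (.up ℤ)) :=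
  fun Y => ∃ Z, 𝒵 Z ∧ Nonempty (Y ≅ (HomotopyCategory.quotient A (.up ℤ)).obj Z)

instance (𝒵 : ObjectProperty (CochainComplex A ℤ)) [𝒵.IsStableUnderShift ℤ] :
    (htpyProp 𝒵).IsStableUnderShift ℤ where
  isStableUnderShiftBy n := ⟨fun Y ⟨Z, hZ, ⟨e⟩⟩ => ⟨Z⟦n⟧, 𝒵.le_shift n _ hZ,
    ⟨(CategoryTheory.shiftFunctor _ n).mapIso e ≪≫
      (((HomotopyCategory.quotient A (.up ℤ)).commShiftIso n).app Z).symm⟩⟩⟩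

theorem leftPerp_iff (𝒵 : ObjectProperty (CochainComplex A ℤ)) (X : CochainComplex A ℤ) :
    leftPerp 𝒵 X ↔
      (htpyProp 𝒵).leftOrthogonal ((HomotopyCategory.quotient A (.up ℤ)).obj X) := by
  constructor
  · rintro h Y f ⟨Z, hZ, ⟨e⟩⟩
    obtain ⟨g, hg⟩ := (HomotopyCategory.quotient A (.up ℤ)).map_surjective (f ≫ e.hom)
    have h1 := (HomotopyCategory.quotient_map_eq_zero_iff g).2 (h hZ g)
    rw [← cancel_mono e.hom, ← hg, h1, zero_comp]
  · intro h Z hZ f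
    exact (HomotopyCategory.quotient_map_eq_zero_iff f).1 (h _ ⟨Z, hZ, ⟨Iso.refl _⟩⟩)

/-- The complexes concentrated in one degree, with an injective object in this degree. -/
def injSingles (A : Type*) [Category* A] [Abelian A] : ObjectProperty (CochainComplex A ℤ) :=
  fun Z => ∃ (I : A) (n : ℤ), Injective I ∧ Nonempty (Z ≅ (singleFunctor A n).obj I)

instance : (injSingles A).IsStableUnderShift ℤ where
  isStableUnderShiftBy a := ⟨fun _ ⟨I, n, hI, ⟨e⟩⟩ => ⟨I, n - a, hI, ⟨(CategoryTheory.shiftFunctor _ a).mapIso e ≪≫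
    ((singleFunctors A).shiftIso a (n - a) n (by simp)).app I⟩⟩⟩

/-- The object of a single complex in its degree. -/
noncomputable def singleX (n : ℤ) (I : A) : ((singleFunctor A n).obj I).X n ≅ I :=
  HomologicalComplex.singleObjXSelf (.up ℤ) n I

theorem singleFunctor_d (n : ℤ) (I : A) (i j : ℤ) : ((singleFunctor A n).obj I).d i j = 0 :=
  HomologicalComplex.single_obj_d (.up ℤ) n I i j

theorem singleFunctor_isZero (n : ℤ) (I : A) {i : ℤ} (hi : i ≠ n) :
    IsZero (((singleFunctor A n).obj I).X i) :=
  HomologicalComplex.isZero_single_obj_X (.up ℤ) n I i hi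

theorem singleFunctor_hom_ext {X : CochainComplex A ℤ} {I : A} {n : ℤ}
    {f g : X ⟶ (singleFunctor A n).obj I} (h : f.f n = g.f n) : f = g := by
  ext i
  by_cases hi : i = n
  · subst hi; exact h
  · exact (singleFunctor_isZero n I hi).eq_of_tgt _ _

/-- A map to a single complex, given by its component in the relevant degree. -/
noncomputable def toSingle {X : CochainComplex A ℤ} {I : A} {n : ℤ} (g : X.X n ⟶ I)
    (hg : X.d (n - 1) n ≫ g = 0) : X ⟶ (singleFunctor A n).obj I :=
  HomologicalComplex.mkHomToSingle g fun i hi => by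
    obtain rfl : i = n - 1 := by have : i + 1 = n := hi; lia
    exact hg

theorem toSingle_f {X : CochainComplex A ℤ} {I : A} {n : ℤ} (g : X.X n ⟶ I)
    (hg : X.d (n - 1) n ≫ g = 0) : (toSingle g hg).f n = g ≫ (singleX n I).inv :=
  HomologicalComplex.mkHomToSingle_f _ _

theorem homotopy_zero_of_single {X : CochainComplex A ℤ} {I : A} {n : ℤ}
    (f : X ⟶ (singleFunctor A n).obj I) (g : X.X (n + 1) ⟶ ((singleFunctor A n).obj I).X n)
    (hg : X.d n (n + 1) ≫ g = f.f n) : Nonempty (Homotopy f 0) := by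
  have e : f = Homotopy.nullHomotopicMap' (fun i j (hij : (ComplexShape.up ℤ).Rel j i) =>
      if hj : j = n then eqToHom (by have : j + 1 = i := hij; rw [← this, hj]) ≫ g ≫ eqToHom (by rw [hj]) else 0) := by
    apply singleFunctor_hom_ext
    rw [Homotopy.nullHomotopicMap'_f (k₀ := n + 1) (k₂ := n - 1) (by simp) (by simp),
      singleFunctor_d, comp_zero, add_zero, ← hg]
    simp
  rw [e]
  exact ⟨Homotopy.nullHomotopy' _⟩

theorem homotopy_zero_single_iff {X : CochainComplex A ℤ} {I : A} [Injective I] {n : ℤ}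
    (f : X ⟶ (singleFunctor A n).obj I) :
    Nonempty (Homotopy f 0) ↔ X.iCycles n ≫ f.f n = 0 := by
  constructor
  · rintro ⟨h⟩
    have h1 := h.comm n
    rw [dNext_eq h.hom (i' := n + 1) (by simp), prevD_eq h.hom (j' := n - 1) (by simp),
      singleFunctor_d, comp_zero, add_zero, zero_f, add_zero] at h1
    rw [h1, HomologicalComplex.iCycles_d_assoc, zero_comp]
  · intro h
    have hex : (ShortComplex.mk (X.iCycles n) (X.d n (n + 1)) (by simp)).Exact :=
      ShortComplex.exact_of_f_is_kernel _ (X.cyclesIsKernel n (n + 1) (by simp))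
    have : Injective (((singleFunctor A n).obj I).X n) :=
      Injective.of_iso (singleX n I).symm inferInstance
    exact homotopy_zero_of_single f (hex.descToInjective (f.f n) h) (hex.comp_descToInjective _ _)

theorem acyclic_iff_leftPerp [EnoughInjectives A] (X : CochainComplex A ℤ) :
    X.Acyclic ↔ leftPerp (injSingles A) X := by
  constructor
  · rintro hX Z ⟨I, n, hI, ⟨e⟩⟩ f
    have h1 : Nonempty (Homotopy (f ≫ e.hom) 0) := by
      have hex := (X.exactAt_iff' (n - 1) n (n + 1) (by simp) (by simp)).1 (hX n)
      have : Injective (((singleFunctor A n).obj I).X n) :=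
        Injective.of_iso (singleX n I).symm inferInstance
      have h0 : X.d (n - 1) n ≫ (f ≫ e.hom).f n = 0 := by
        rw [← HomologicalComplex.Hom.comm, singleFunctor_d, comp_zero]
      exact homotopy_zero_of_single _ (hex.descToInjective _ h0) (hex.comp_descToInjective _ _)
    rw [← HomotopyCategory.quotient_map_eq_zero_iff] at h1 ⊢
    rw [Functor.map_comp] at h1
    rw [← cancel_mono ((HomotopyCategory.quotient A (.up ℤ)).map e.hom), h1, zero_comp]
  · intro h n
    let g : X.opcycles n ⟶ Injective.under (X.opcycles n) := Injective.ι _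
    have h1 := h (Z := (singleFunctor A n).obj _) ⟨_, n, inferInstance, ⟨Iso.refl _⟩⟩
      (toSingle (X.pOpcycles n ≫ g) (by simp))
    rw [homotopy_zero_single_iff, toSingle_f, ← Category.assoc, Preadditive.IsIso.comp_right_eq_zero] at h1
    rw [X.exactAt_iff_isZero_homology n, IsZero.iff_id_eq_zero]
    rw [← cancel_epi (X.homologyπ n), ← cancel_mono (X.homologyι n), ← cancel_mono g]
    simpa using h1

end Complexes

end CyclicHH

namespace CyclicHH

section Cones

open HomologicalComplex CochainComplex

variable {A : Type*} [Category* A] [Abelian A] {𝒟 : Type*} [Category* 𝒟]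
  {F G : 𝒟 ⥤ CochainComplex A ℤ} (φ : F ⟶ G)

/-- The functorial mapping cone of a natural transformation. -/
noncomputable def coneOf : 𝒟 ⥤ CochainComplex A ℤ where
  obj X := mappingCone (φ.app X)
  map f := mappingCone.map _ _ (F.map f) (G.map f) (φ.naturality f).symm
  map_id X := (by congr 1 <;> simp : _ = mappingCone.map _ _ (𝟙 _) (𝟙 _) (by simp)).trans
    (mappingCone.map_id _)
  map_comp f g := (by congr 1 <;> simp : _ = mappingCone.map _ _ (F.map f ≫ F.map g)
    (G.map f ≫ G.map g) (by simp)).trans (mappingCone.map_comp _ _ _ _ _ _ _ _ _)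

/-- The inclusion of the target in the functorial mapping cone. -/
noncomputable def coneInr : G ⟶ coneOf φ where
  app X := mappingCone.inr (φ.app X)
  naturality _ _ f := (mappingCone.triangleMap _ _ (F.map f) (G.map f)
    (φ.naturality f).symm).comm₂.symm

/-- The projection of the functorial mapping cone to the shifted source. -/
noncomputable def coneFst : coneOf φ ⟶ F ⋙ CategoryTheory.shiftFunctor _ (1 : ℤ) where
  app X := (mappingCone.triangle (φ.app X)).mor₃
  naturality _ _ f := (mappingCone.triangleMap _ _ (F.map f) (G.map f)
    (φ.naturality f).symm).comm₃.symm

/-- The functorial mapping cocone of a natural transformation. -/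
noncomputable def coconeOf : 𝒟 ⥤ CochainComplex A ℤ :=
  coneOf φ ⋙ CategoryTheory.shiftFunctor _ (-1 : ℤ)

/-- The projection of the functorial mapping cocone to the source. -/
noncomputable def coconeFst : coconeOf φ ⟶ F :=
  Functor.whiskerRight (coneFst φ) (CategoryTheory.shiftFunctor _ (-1 : ℤ)) ≫
    Functor.whiskerLeft F (shiftFunctorCompIsoId _ (1 : ℤ) (-1) (by simp)).hom

theorem quotient_cone_distinguished (X : 𝒟) :
    Pretriangulated.Triangle.mk ((HomotopyCategory.quotient A (.up ℤ)).map (φ.app X))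
      ((HomotopyCategory.quotient A (.up ℤ)).map ((coneInr φ).app X))
      ((HomotopyCategory.quotient A (.up ℤ)).map ((coneFst φ).app X) ≫
        ((HomotopyCategory.quotient A (.up ℤ)).commShiftIso (1 : ℤ)).hom.app _) ∈
      Pretriangulated.distinguishedTriangles :=
  HomotopyCategory.mappingCone_triangleh_distinguished (φ.app X)

theorem quasiIso_coneFst (X : 𝒟) (h : (G.obj X).Acyclic) :
    QuasiIso ((coneFst φ).app X) := by
  rw [← HomologicalComplex.mem_quasiIso_iff, ← HomotopyCategory.quotient_map_mem_quasiIso_iff,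
    HomotopyCategory.quasiIso_eq_trW_subcategoryAcyclic]
  have h1 := Pretriangulated.rot_of_distTriang _
    (Pretriangulated.rot_of_distTriang _ (quotient_cone_distinguished φ X))
  have h2 : (HomotopyCategory.subcategoryAcyclic A).trW
      ((HomotopyCategory.quotient A (.up ℤ)).map ((coneFst φ).app X) ≫
        ((HomotopyCategory.quotient A (.up ℤ)).commShiftIso (1 : ℤ)).hom.app _) :=
    ObjectProperty.trW.mk _ h1 ((HomotopyCategory.subcategoryAcyclic A).le_shift (1 : ℤ) _
      ((HomotopyCategory.quotient_obj_mem_subcategoryAcyclic_iff_acyclic _).2 h))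
  exact ((HomotopyCategory.subcategoryAcyclic A).trW.cancel_right_of_respectsIso _ _).1 h2

theorem quasiIso_coconeFst (X : 𝒟) (h : (G.obj X).Acyclic) :
    QuasiIso ((coconeFst φ).app X) := by
  have := quasiIso_coneFst φ X h
  have h1 : QuasiIso (((coneFst φ).app X)⟦(-1 : ℤ)⟧') := inferInstance
  have h2 : QuasiIso ((shiftFunctorCompIsoId (CochainComplex A ℤ) (1 : ℤ) (-1) (by simp)).hom.app
    (F.obj X)) := inferInstance
  exact @quasiIso_comp _ _ _ _ _ _ _ _ (((coneFst φ).app X)⟦(-1 : ℤ)⟧')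
    ((shiftFunctorCompIsoId (CochainComplex A ℤ) (1 : ℤ) (-1) (by simp)).hom.app (F.obj X))
    _ _ _ h1 h2

theorem leftPerp_shift {𝒵 : ObjectProperty (CochainComplex A ℤ)} [𝒵.IsStableUnderShift ℤ]
    {X : CochainComplex A ℤ} (h : leftPerp 𝒵 X) (n : ℤ) : leftPerp 𝒵 (X⟦n⟧) := by
  rw [leftPerp_iff] at h ⊢
  exact ((htpyProp 𝒵).leftOrthogonal.prop_iff_of_iso
    (((HomotopyCategory.quotient A (.up ℤ)).commShiftIso n).app X)).2
      ((htpyProp 𝒵).leftOrthogonal.le_shift n _ h)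

end Cones

section Coproducts

open HomologicalComplex

variable {A : Type*} [Category* A] [Preadditive A] {ι κ : Type*} {c : ComplexShape κ}
  {X : ι → HomologicalComplex A c}

/-- A map from a coproduct is homotopic to zero if its components are. -/
theorem homotopy_zero_of_cofan {t : Cofan X} (ht : IsColimit t)
    [∀ i, PreservesColimit (Discrete.functor X) (HomologicalComplex.eval A c i)]
    {Y : HomologicalComplex A c} (f : t.pt ⟶ Y)
    (h : ∀ i, Nonempty (Homotopy (t.inj i ≫ f) 0)) : Nonempty (Homotopy f 0) := by
  have e (q : κ) := isColimitCofanMkObjOfIsColimit (HomologicalComplex.eval A c q) X t.inj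
    (ht.ofIsoColimit (Cofan.ext (Iso.refl _)))
  have hdesc (q : κ) (W : A) (g : ∀ a, (X a).X q ⟶ W) :
      ∃ d : t.pt.X q ⟶ W, ∀ a, (t.inj a).f q ≫ d = g a :=
    ⟨Cofan.IsColimit.desc (e q) g, fun a => Cofan.IsColimit.fac (e q) g a⟩
  have hext (q : κ) (W : A) (f g : t.pt.X q ⟶ W)
      (h : ∀ a, (t.inj a).f q ≫ f = (t.inj a).f q ≫ g) : f = g :=
    Cofan.IsColimit.hom_ext (e q) f g h
  let H i := (h i).some
  choose d hd using fun i j => hdesc i _ fun a => (H a).hom i j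
  refine ⟨⟨d, ?_, ?_⟩⟩
  · intro i j hij
    refine hext _ _ _ _ fun a => ?_
    rw [hd, (H a).zero i j hij, comp_zero]
  · intro i
    refine hext _ _ _ _ fun a => ?_
    have h1 := (H a).comm i
    have h2 : (H a).hom = fun p q => (t.inj a).f p ≫ d p q := by
      funext p q
      exact (hd p q a).symm
    rw [h2, dNext_comp_left, prevD_comp_left, zero_f, add_zero] at h1
    rw [zero_f, add_zero, Preadditive.comp_add]
    exact h1

theorem exists_isColimit_quotient {t : Cofan X} (ht : IsColimit t)
    [∀ i, PreservesColimit (Discrete.functor X) (HomologicalComplex.eval A c i)] :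
    Nonempty (IsColimit (Cofan.mk (f := fun i => (HomotopyCategory.quotient A c).obj (X i))
      ((HomotopyCategory.quotient A c).obj t.pt)
      fun i => (HomotopyCategory.quotient A c).map (t.inj i))) := by
  have key (Y : HomotopyCategory A c) (g : ∀ i, (HomotopyCategory.quotient A c).obj (X i) ⟶ Y) :
      ∃ m : (HomotopyCategory.quotient A c).obj t.pt ⟶ Y,
        (∀ i, (HomotopyCategory.quotient A c).map (t.inj i) ≫ m = g i) ∧
        ∀ m', (∀ i, (HomotopyCategory.quotient A c).map (t.inj i) ≫ m' = g i) → m' = m := by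
    obtain ⟨Z, rfl⟩ : ∃ Z, (HomotopyCategory.quotient A c).obj Z = Y := ⟨Y.as, rfl⟩
    choose g' hg' using fun i => (HomotopyCategory.quotient A c).map_surjective (g i)
    refine ⟨(HomotopyCategory.quotient A c).map (Cofan.IsColimit.desc ht g'), fun i => ?_,
      fun m hm => ?_⟩
    · rw [← Functor.map_comp, Cofan.IsColimit.fac, hg']
    · obtain ⟨f, rfl⟩ := (HomotopyCategory.quotient A c).map_surjective m
      rw [← sub_eq_zero, ← Functor.map_sub]
      refine (HomotopyCategory.quotient_map_eq_zero_iff _).2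
        (homotopy_zero_of_cofan ht _ fun i => ?_)
      rw [← HomotopyCategory.quotient_map_eq_zero_iff, Preadditive.comp_sub, Functor.map_sub,
        sub_eq_zero, Cofan.IsColimit.fac, Functor.map_comp, hm, hg']
  choose m hm hm' using key
  exact ⟨Cofan.IsColimit.mk _ (fun s => m _ s.inj) (fun s => hm _ s.inj)
    (fun s m' h => hm' _ s.inj m' h)⟩

end Coproducts

end CyclicHH

namespace CyclicHH

section Resolution

open HomologicalComplex CochainComplex

variable {A : Type*} [Category.{v} A] [Abelian A] [HasCoproducts.{v} A] {ι : Type v} (E : ι → A)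

/-- The coproduct of the objects of a family, indexed by all maps to a given object. -/
noncomputable def coverObj (X : A) : A := ∐ fun p : (Σ i, (E i ⟶ X)) => E p.1

variable {E} in
/-- The inclusions in `coverObj`. -/
noncomputable def coverIncl {X : A} {i : ι} (t : E i ⟶ X) : E i ⟶ coverObj E X :=
  Sigma.ι (fun p : (Σ i, (E i ⟶ X)) => E p.1) ⟨i, t⟩

/-- A map from `coverObj`, given by its components. -/
noncomputable def coverDesc {X Y : A} (g : ∀ i, (E i ⟶ X) → (E i ⟶ Y)) : coverObj E X ⟶ Y :=
  Sigma.desc fun p => g p.1 p.2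

@[simp]
theorem coverIncl_desc {X Y : A} (g : ∀ i, (E i ⟶ X) → (E i ⟶ Y)) {i : ι} (t : E i ⟶ X) :
    coverIncl t ≫ coverDesc E g = g i t :=
  Sigma.ι_desc _ _

@[simp]
theorem coverIncl_desc_assoc {X Y Z : A} (g : ∀ i, (E i ⟶ X) → (E i ⟶ Y)) {i : ι} (t : E i ⟶ X)
    (f : Y ⟶ Z) : coverIncl t ≫ coverDesc E g ≫ f = g i t ≫ f := by
  rw [← Category.assoc, coverIncl_desc]

variable {E} in
theorem cover_hom_ext {X Y : A} {f g : coverObj E X ⟶ Y}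
    (h : ∀ i (t : E i ⟶ X), coverIncl t ≫ f = coverIncl t ≫ g) : f = g :=
  Sigma.hom_ext _ _ fun p => h p.1 p.2

/-- The functoriality of `coverObj`. -/
noncomputable def coverFunctor : A ⥤ A where
  obj X := coverObj E X
  map f := coverDesc E fun _ t => coverIncl (t ≫ f)
  map_id X := cover_hom_ext fun i t => by simp
  map_comp f g := cover_hom_ext fun i t => by simp

/-- The canonical map from the coproduct. -/
noncomputable def coverMap (X : A) : coverObj E X ⟶ X := coverDesc E fun _ t => t

theorem coverMap_naturality {X Y : A} (f : X ⟶ Y) :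
    (coverFunctor E).map f ≫ coverMap E Y = coverMap E X ≫ f :=
  cover_hom_ext fun i t => by simp [coverFunctor, coverMap]

theorem epi_coverMap (hE : ∀ X : A, ∀ {Y : A} (f g : X ⟶ Y), (∀ i (h : E i ⟶ X), h ≫ f = h ≫ g) → f = g)
    (X : A) : Epi (coverMap E X) where
  left_cancellation f g h := hE _ f g fun i t => by
    simpa [coverMap] using coverIncl t ≫= h

/-- The complex with zero differential formed by coverings of the cycles of a complex. -/
noncomputable def coverComplex : CochainComplex A ℤ ⥤ CochainComplex A ℤ where
  obj K :=
    { X := fun q => (coverFunctor E).obj (K.cycles q)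
      d := fun _ _ => 0 }
  map f := { f := fun q => (coverFunctor E).map (cyclesMap f q) }
  map_id K := by
    ext q
    exact ((coverFunctor E).congr_map (cyclesMap_id K q)).trans ((coverFunctor E).map_id _)
  map_comp f g := by
    ext q
    exact ((coverFunctor E).congr_map (cyclesMap_comp f g q)).trans (Functor.map_comp _ _ _)

/-- The map from `coverComplex` to the complex. -/
noncomputable def coverComplexMap : coverComplex E ⟶ 𝟭 _ where
  app K :=
    { f := fun q => coverMap E (K.cycles q) ≫ K.iCycles q
      comm' := fun i j _ => by
        refine Eq.trans ?_ zero_comp.symm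
        exact (Category.assoc _ _ _).trans ((coverMap E _ ≫= K.iCycles_d _ _).trans comp_zero) }
  naturality K L f := by
    ext q
    change (coverFunctor E).map (cyclesMap f q) ≫ coverMap E (L.cycles q) ≫ L.iCycles q =
      (coverMap E (K.cycles q) ≫ K.iCycles q) ≫ f.f q
    exact (Category.assoc _ _ _).symm.trans ((coverMap_naturality E (cyclesMap f q) =≫ _).trans
      ((Category.assoc _ _ _).trans ((_ ≫= cyclesMap_i f q).trans (Category.assoc _ _ _).symm)))

/-- An object `E` such that maps from `E` to cycles of complexes in the class lift along the
differential. -/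
def IsExactFor (𝒵 : ObjectProperty (CochainComplex A ℤ)) (E : A) : Prop :=
  ∀ ⦃Z⦄, 𝒵 Z → ∀ (q : ℤ) (φ : E ⟶ Z.X q), φ ≫ Z.d q (q + 1) = 0 →
    ∃ h : E ⟶ Z.X (q - 1), h ≫ Z.d (q - 1) q = φ

variable {E}

theorem leftPerp_coverComplex {𝒵 : ObjectProperty (CochainComplex A ℤ)}
    (hE : ∀ i, IsExactFor 𝒵 (E i)) (K : CochainComplex A ℤ) :
    leftPerp 𝒵 ((coverComplex E).obj K) := by
  intro Z hZ f
  have key (q : ℤ) : ∃ h : coverObj E (K.cycles q) ⟶ Z.X (q - 1), h ≫ Z.d (q - 1) q = f.f q := by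
    have h0 : f.f q ≫ Z.d q (q + 1) = 0 := by
      rw [f.comm]
      exact zero_comp
    choose h hh using fun i (t : E i ⟶ K.cycles q) =>
      hE i hZ q (coverIncl t ≫ f.f q) ((Category.assoc _ _ _).trans ((_ ≫= h0).trans comp_zero))
    refine ⟨coverDesc E h, cover_hom_ext fun i t => ?_⟩
    rw [coverIncl_desc_assoc, hh]
  choose h hh using key
  have e : f = Homotopy.nullHomotopicMap' (fun i j (hij : (ComplexShape.up ℤ).Rel j i) =>
      h i ≫ eqToHom (by have : j + 1 = i := hij; rw [← this, add_sub_cancel_right])) := by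
    ext q
    rw [Homotopy.nullHomotopicMap'_f (k₀ := q + 1) (k₂ := q - 1) (by simp) (by simp)]
    have : ((coverComplex E).obj K).d q (q + 1) = 0 := rfl
    rw [this, zero_comp, zero_add, ← hh q]
    exact (Category.comp_id (h q)).symm =≫ _
  rw [e]
  exact ⟨Homotopy.nullHomotopy' _⟩

variable (E)

/-- The cone of `coverComplexMap`. -/
noncomputable def coverCone : CochainComplex A ℤ ⥤ CochainComplex A ℤ :=
  coneOf (coverComplexMap E)

/-- The inclusion of a complex in the cone of `coverComplexMap`. -/
noncomputable def coverConeInr : 𝟭 (CochainComplex A ℤ) ⟶ coverCone E :=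
  coneInr (coverComplexMap E)

theorem coverConeInr_comp_eq_zero
    (hE : ∀ X : A, ∀ {Y : A} (f g : X ⟶ Y), (∀ i (h : E i ⟶ X), h ≫ f = h ≫ g) → f = g)
    (K : CochainComplex A ℤ) (Z : HomotopyCategory A (.up ℤ)) (hZ : htpyProp (injSingles A) Z)
    (g : (HomotopyCategory.quotient A (.up ℤ)).obj ((coverCone E).obj K) ⟶ Z) :
    (HomotopyCategory.quotient A (.up ℤ)).map ((coverConeInr E).app K) ≫ g = 0 := by
  obtain ⟨Z', ⟨I, n, hI, ⟨e'⟩⟩, ⟨e⟩⟩ := hZ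
  let e₁ := e ≪≫ (HomotopyCategory.quotient A (.up ℤ)).mapIso e'
  rw [← cancel_mono e₁.hom, Category.assoc, zero_comp]
  obtain ⟨g', hg'⟩ := (HomotopyCategory.quotient A (.up ℤ)).map_surjective (g ≫ e₁.hom)
  rw [← hg', ← Functor.map_comp]
  rw [HomotopyCategory.quotient_map_eq_zero_iff, homotopy_zero_single_iff]
  have h1 : Nonempty (Homotopy ((coverComplexMap E).app K ≫ (coverConeInr E).app K ≫ g') 0) := by
    rw [← HomotopyCategory.quotient_map_eq_zero_iff, ← Category.assoc, Functor.map_comp,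
      Functor.map_comp]
    have h2 := Pretriangulated.comp_distTriang_mor_zero₁₂ _
      (quotient_cone_distinguished (coverComplexMap E) K)
    change (HomotopyCategory.quotient A (.up ℤ)).map ((coverComplexMap E).app K) ≫
      (HomotopyCategory.quotient A (.up ℤ)).map ((coverConeInr E).app K) = 0 at h2
    rw [h2, zero_comp]
  have := epi_coverMap E hE (K.cycles n)
  generalize (coverConeInr E).app K ≫ g' = t at h1
  obtain ⟨h⟩ := h1
  have h3 := h.comm n
  have hd : ((coverComplex E).obj K).d n (n + 1) = 0 := rfl
  rw [dNext_eq h.hom (i' := n + 1) (by simp), prevD_eq h.hom (j' := n - 1) (by simp),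
      singleFunctor_d, comp_zero, add_zero, zero_f, add_zero, hd, zero_comp] at h3
  have h4 : coverMap E (K.cycles n) ≫ K.iCycles n ≫ t.f n = 0 := by
    rw [← Category.assoc]; exact h3
  exact (cancel_epi _).1 (h4.trans comp_zero.symm)

theorem coverConeInr_bijective {𝒵 : ObjectProperty (CochainComplex A ℤ)} [𝒵.IsStableUnderShift ℤ]
    (hE : ∀ i, IsExactFor 𝒵 (E i)) (K : CochainComplex A ℤ)
    (Z : HomotopyCategory A (.up ℤ)) (hZ : htpyProp 𝒵 Z) :
    Function.Bijective (fun g : (HomotopyCategory.quotient A (.up ℤ)).obj ((coverCone E).obj K) ⟶ Z =>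
      (HomotopyCategory.quotient A (.up ℤ)).map ((coverConeInr E).app K) ≫ g) :=
  bijective_of_leftOrthogonal₃ (htpyProp 𝒵) _ (quotient_cone_distinguished (coverComplexMap E) K)
    ((leftPerp_iff _ _).1 (leftPerp_coverComplex hE K)) Z hZ

/-- The iterates of `coverCone`. -/
noncomputable def coverIter : ℕ → (CochainComplex A ℤ ⥤ CochainComplex A ℤ)
  | 0 => 𝟭 _
  | n + 1 => coverIter n ⋙ coverCone E

/-- The transition maps of the sequence of iterates. -/
noncomputable def coverIterMap (n : ℕ) : coverIter E n ⟶ coverIter E (n + 1) :=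
  Functor.whiskerLeft (coverIter E n) (coverConeInr E)

variable (A) in
/-- The pointwise coproduct of a sequence of functors. -/
noncomputable def sumOf [HasCoproducts.{0} A] (F : ℕ → (CochainComplex A ℤ ⥤ CochainComplex A ℤ)) :
    CochainComplex A ℤ ⥤ CochainComplex A ℤ where
  obj K := ∐ fun n => (F n).obj K
  map f := Limits.Sigma.map fun n => (F n).map f
  map_id K := Sigma.hom_ext _ _ fun n => by simp
  map_comp f g := Sigma.hom_ext _ _ fun n => by simp

variable [HasCoproducts.{0} A]

/-- The inclusions in `sumOf`. -/
noncomputable def sumIncl (F : ℕ → (CochainComplex A ℤ ⥤ CochainComplex A ℤ)) (n : ℕ) :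
    F n ⟶ sumOf A F where
  app K := Sigma.ι (fun n => (F n).obj K) n
  naturality K L f := by simp [sumOf]

/-- The map from `sumOf` given by its components. -/
noncomputable def sumDesc {F : ℕ → (CochainComplex A ℤ ⥤ CochainComplex A ℤ)}
    {G : CochainComplex A ℤ ⥤ CochainComplex A ℤ} (φ : ∀ n, F n ⟶ G) : sumOf A F ⟶ G where
  app K := Limits.Sigma.desc fun n => (φ n).app K
  naturality K L f := Sigma.hom_ext _ _ fun n => by simp [sumOf]

theorem sumIncl_desc {F : ℕ → (CochainComplex A ℤ ⥤ CochainComplex A ℤ)}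
    {G : CochainComplex A ℤ ⥤ CochainComplex A ℤ} (φ : ∀ n, F n ⟶ G) (n : ℕ) :
    sumIncl F n ≫ sumDesc φ = φ n := by
  ext1
  funext K
  exact Sigma.ι_desc _ _

/-- The shift on the coproduct of the iterates. -/
noncomputable def iterShift : sumOf A (coverIter E) ⟶ sumOf A (coverIter E) :=
  sumDesc fun n => coverIterMap E n ≫ sumIncl _ (n + 1)

/-- The homotopy colimit of the iterates. -/
noncomputable def telescope : CochainComplex A ℤ ⥤ CochainComplex A ℤ :=
  coneOf (𝟙 _ - iterShift E)

/-- The inclusion of a complex in the homotopy colimit. -/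
noncomputable def toTelescope : 𝟭 (CochainComplex A ℤ) ⟶ telescope E :=
  sumIncl (coverIter E) 0 ≫ coneInr (𝟙 _ - iterShift E)

theorem exists_sum_isColimit (F : ℕ → (CochainComplex A ℤ ⥤ CochainComplex A ℤ))
    (K : CochainComplex A ℤ) :
    Nonempty (IsColimit (Cofan.mk (f := fun i => (HomotopyCategory.quotient A (.up ℤ)).obj ((F i).obj K))
      ((HomotopyCategory.quotient A (.up ℤ)).obj ((sumOf A F).obj K))
      fun i => (HomotopyCategory.quotient A (.up ℤ)).map ((sumIncl F i).app K))) :=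
  exists_isColimit_quotient (t := Cofan.mk _ (Sigma.ι fun n => (F n).obj K)) (coproductIsCoproduct fun n => (F n).obj K)

theorem telescope_distinguished (K : CochainComplex A ℤ) :
    ∃ δ, Pretriangulated.Triangle.mk
      (𝟙 ((HomotopyCategory.quotient A (.up ℤ)).obj ((sumOf A (coverIter E)).obj K)) -
        (HomotopyCategory.quotient A (.up ℤ)).map ((iterShift E).app K))
      ((HomotopyCategory.quotient A (.up ℤ)).map ((coneInr (𝟙 _ - iterShift E)).app K)) δ ∈
      Pretriangulated.distinguishedTriangles := by
  have h := quotient_cone_distinguished (𝟙 _ - iterShift E) K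
  have e : (HomotopyCategory.quotient A (.up ℤ)).map ((𝟙 _ - iterShift E).app K) =
      𝟙 ((HomotopyCategory.quotient A (.up ℤ)).obj ((sumOf A (coverIter E)).obj K)) -
        (HomotopyCategory.quotient A (.up ℤ)).map ((iterShift E).app K) := by
    rw [NatTrans.app_sub, Functor.map_sub, NatTrans.id_app, CategoryTheory.Functor.map_id]
  rw [e] at h
  exact ⟨_, h⟩

theorem quotient_incl_shift (K : CochainComplex A ℤ) (n : ℕ) :
    (HomotopyCategory.quotient A (.up ℤ)).map ((sumIncl (coverIter E) n).app K) ≫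
      (HomotopyCategory.quotient A (.up ℤ)).map ((iterShift E).app K) =
    (HomotopyCategory.quotient A (.up ℤ)).map ((coverIterMap E n).app K) ≫
      (HomotopyCategory.quotient A (.up ℤ)).map ((sumIncl (coverIter E) (n + 1)).app K) := by
  rw [← Functor.map_comp, ← Functor.map_comp, ← NatTrans.comp_app, ← NatTrans.comp_app, iterShift,
    sumIncl_desc]

theorem acyclic_telescope [EnoughInjectives A]
    (hE : ∀ X : A, ∀ {Y : A} (f g : X ⟶ Y), (∀ i (h : E i ⟶ X), h ≫ f = h ≫ g) → f = g)
    (K : CochainComplex A ℤ) : ((telescope E).obj K).Acyclic := by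
  rw [acyclic_iff_leftPerp, leftPerp_iff]
  obtain ⟨δ, hδ⟩ := telescope_distinguished E K
  exact leftOrthogonal_telescope _ _ _ (exists_sum_isColimit (coverIter E) K).some _
    (quotient_incl_shift E K) _ _ hδ
    fun n Z hZ g => coverConeInr_comp_eq_zero E hE ((coverIter E n).obj K) Z hZ g

/-- The resolution functor. -/
noncomputable def resolution : CochainComplex A ℤ ⥤ CochainComplex A ℤ := coconeOf (toTelescope E)

/-- The map from the resolution of a complex to the complex. -/
noncomputable def resolutionMap : resolution E ⟶ 𝟭 _ := coconeFst (toTelescope E)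

theorem leftPerp_resolution {𝒵 : ObjectProperty (CochainComplex A ℤ)} [𝒵.IsStableUnderShift ℤ]
    (hE : ∀ i, IsExactFor 𝒵 (E i)) (K : CochainComplex A ℤ) :
    leftPerp 𝒵 ((resolution E).obj K) := by
  refine leftPerp_shift ?_ (-1)
  obtain ⟨δ, hδ⟩ := telescope_distinguished E K
  rw [leftPerp_iff]
  refine leftOrthogonal_of_bijective _ _ (quotient_cone_distinguished (toTelescope E) K) fun Z hZ => ?_
  have := bijective_telescope _ _ _ (exists_sum_isColimit (coverIter E) K).some _
    (quotient_incl_shift E K) _ _ hδ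
    (fun n Z hZ => coverConeInr_bijective E hE ((coverIter E n).obj K) Z hZ) Z hZ
  have e : (HomotopyCategory.quotient A (.up ℤ)).map ((toTelescope E).app K) =
      (HomotopyCategory.quotient A (.up ℤ)).map ((sumIncl (coverIter E) 0).app K) ≫
      (HomotopyCategory.quotient A (.up ℤ)).map ((coneInr (𝟙 _ - iterShift E)).app K) :=
    Functor.map_comp _ _ _
  change Function.Bijective fun g : (HomotopyCategory.quotient A (.up ℤ)).obj ((telescope E).obj K) ⟶ Z =>
    (HomotopyCategory.quotient A (.up ℤ)).map ((toTelescope E).app K) ≫ g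
  rw [e]
  exact this

theorem quasiIso_resolutionMap [EnoughInjectives A]
    (hE : ∀ X : A, ∀ {Y : A} (f g : X ⟶ Y), (∀ i (h : E i ⟶ X), h ≫ f = h ≫ g) → f = g)
    (K : CochainComplex A ℤ) : QuasiIso ((resolutionMap E).app K) :=
  quasiIso_coconeFst (toTelescope E) K (acyclic_telescope E hE K)

end Resolution

end CyclicHH

namespace CyclicHH

section Goodness

open HomologicalComplex CochainComplex

variable {A B : Type*} [Category* A] [Abelian A] [Category* B] [Abelian B]

/-- The acyclic complexes `0 ⟶ G I ⟶ J⁰ ⟶ J¹ ⟶ ⋯` with `I` and all `Jⁱ` injective. -/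
def coresolutions (G : B ⥤ A) : ObjectProperty (CochainComplex A ℤ) := fun Z =>
  Z.Acyclic ∧ ∃ (m : ℤ) (I : B), Injective I ∧ Nonempty (Z.X m ≅ G.obj I) ∧
    (∀ q < m, IsZero (Z.X q)) ∧ ∀ q > m, Injective (Z.X q)

theorem acyclic_shift {Z : CochainComplex A ℤ} (h : Z.Acyclic) (n : ℤ) : (Z⟦n⟧).Acyclic := by
  rw [← HomotopyCategory.quotient_obj_mem_subcategoryAcyclic_iff_acyclic] at h ⊢
  exact ((HomotopyCategory.subcategoryAcyclic A).prop_iff_of_iso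
    (((HomotopyCategory.quotient A (.up ℤ)).commShiftIso n).app Z)).2
      ((HomotopyCategory.subcategoryAcyclic A).le_shift n _ h)

instance (G : B ⥤ A) : (coresolutions G).IsStableUnderShift ℤ where
  isStableUnderShiftBy a := ⟨fun Z ⟨h, m, I, hI, ⟨e⟩, h0, hJ⟩ => ⟨acyclic_shift h a, m - a, I, hI,
    ⟨eqToIso (by simp) ≪≫ e⟩, fun q hq => h0 (q + a) (by lia), fun q hq => hJ (q + a) (by lia)⟩⟩

section Pulling

variable (Z : CochainComplex A ℤ) {e : ℕ → ℤ} (he : ∀ j, e (j + 1) + 1 = e j)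

include he in
theorem eq_sub_of_step (j : ℕ) : e j = e 0 - j := by
  induction j with
  | zero => simp
  | succ j ih => have := he j; push_cast; lia

/-- The part of a complex in the degrees `e 0`, `e 1 = e 0 - 1`, … -/
def descend : ChainComplex A ℕ where
  X j := Z.X (e j)
  d i j := Z.d (e i) (e j)
  shape i j hij := Z.shape _ _ fun h => hij (by
    have h : e i + 1 = e j := h
    rw [eq_sub_of_step he i, eq_sub_of_step he j] at h
    change j + 1 = i
    lia)

include he in
theorem exact_descend (hZ : Z.Acyclic) (j : ℕ) :
    (ShortComplex.mk (Z.d (e (j + 2)) (e (j + 1))) (Z.d (e (j + 1)) (e j)) (by simp)).Exact := by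
  have h := he j
  have h' := he (j + 1)
  exact (Z.exactAt_iff' (e (j + 2)) (e (j + 1)) (e j)
    (by simp; lia) (by simp; lia)).1 (hZ _)

variable {Z} in
/-- The last differential of `pulledBack`. -/
noncomputable def pulledDiff {E : A} (φ : E ⟶ Z.X (e 0)) :
    Z.X (e 2) ⟶ pullback (Z.d (e 1) (e 0)) φ :=
  pullback.lift (Z.d (e 2) (e 1)) 0 ((Z.d_comp_d _ _ _).trans zero_comp.symm)

theorem d_pulledDiff {E : A} (φ : E ⟶ Z.X (e 0)) : Z.d (e 3) (e 2) ≫ pulledDiff φ = 0 := by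
  apply pullback.hom_ext
  · rw [Category.assoc, pulledDiff, pullback.lift_fst, zero_comp, Z.d_comp_d]
  · rw [Category.assoc, pulledDiff, pullback.lift_snd, zero_comp, comp_zero]

variable {Z} in
/-- The pull back of the part `⋯ ⟶ Z (e 2) ⟶ Z (e 1)` of a complex along a map to `Z (e 0)`. -/
noncomputable def pulledBack {E : A} (φ : E ⟶ Z.X (e 0)) : ChainComplex A ℕ :=
  ChainComplex.augment (ChainComplex.truncate.obj (ChainComplex.truncate.obj (descend Z he)))
    (X := pullback (Z.d (e 1) (e 0)) φ) (pulledDiff φ) (d_pulledDiff Z φ)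

variable {Z} in
/-- The projection of the pull back to the complex. -/
noncomputable def pulledBackFst {E : A} (φ : E ⟶ Z.X (e 0)) :
    (pulledBack he φ).X 0 ⟶ Z.X (e 1) := pullback.fst _ _

variable {Z} in
/-- The augmentation of the pull back. -/
noncomputable def pulledBackSnd {E : A} (φ : E ⟶ Z.X (e 0)) :
    (pulledBack he φ).X 0 ⟶ E := pullback.snd _ _

theorem pulledBack_condition {E : A} (φ : E ⟶ Z.X (e 0)) :
    pulledBackFst he φ ≫ Z.d (e 1) (e 0) = pulledBackSnd he φ ≫ φ := pullback.condition

theorem pulledBack_d_fst {E : A} (φ : E ⟶ Z.X (e 0)) :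
    (pulledBack he φ).d 1 0 ≫ pulledBackFst he φ = Z.d (e 2) (e 1) := pullback.lift_fst _ _ _

theorem pulledBack_d_snd {E : A} (φ : E ⟶ Z.X (e 0)) :
    (pulledBack he φ).d 1 0 ≫ pulledBackSnd he φ = 0 := pullback.lift_snd _ _ _

variable {Z} in
theorem pulledBack_hom_ext {E : A} {φ : E ⟶ Z.X (e 0)} {T : A} {f g : T ⟶ (pulledBack he φ).X 0}
    (h : f ≫ pulledBackFst he φ = g ≫ pulledBackFst he φ)
    (h' : f ≫ pulledBackSnd he φ = g ≫ pulledBackSnd he φ) : f = g :=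
  pullback.hom_ext h h'

theorem isResolution_pulledBack (hZ : Z.Acyclic) {E : A} (φ : E ⟶ Z.X (e 0))
    (hφ : φ ≫ Z.d (e 0) (e 0 + 1) = 0) :
    IsResolution (pulledBack he φ) (pulledBackSnd he φ) where
  zero := pulledBack_d_snd Z he φ
  exact_zero := by
    rw [ShortComplex.exact_iff_exact_up_to_refinements]
    intro T x hx
    change T ⟶ (pulledBack he φ).X 0 at x
    change x ≫ pulledBackSnd he φ = 0 at hx
    obtain ⟨T', π, hπ, y, hy⟩ := (exact_descend Z he hZ 0).exact_up_to_refinements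
      (x ≫ pulledBackFst he φ) (by
        change (x ≫ pulledBackFst he φ) ≫ Z.d (e 1) (e 0) = 0
        rw [Category.assoc, pulledBack_condition, reassoc_of% hx, zero_comp])
    refine ⟨T', π, hπ, y, ?_⟩
    change π ≫ x = y ≫ (pulledBack he φ).d 1 0
    apply pulledBack_hom_ext
    · rw [Category.assoc, hy]
      exact y ≫= (pulledBack_d_fst Z he φ).symm |>.trans (Category.assoc _ _ _).symm
    · rw [Category.assoc, hx, comp_zero]
      exact (y ≫= (pulledBack_d_snd Z he φ)).trans comp_zero |>.symm.trans (Category.assoc _ _ _).symm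
  epi := by
    rw [epi_iff_surjective_up_to_refinements (pulledBackSnd he φ)]
    intro T y
    have hex : (ShortComplex.mk (Z.d (e 1) (e 0)) (Z.d (e 0) (e 0 + 1)) (by simp)).Exact :=
      (Z.exactAt_iff' (e 1) (e 0) (e 0 + 1) (by have := he 0; simp; lia) (by simp)).1 (hZ _)
    obtain ⟨T', π, hπ, z, hz⟩ := hex.exact_up_to_refinements (y ≫ φ) (by
      change (y ≫ φ) ≫ Z.d (e 0) (e 0 + 1) = 0
      rw [Category.assoc, hφ, comp_zero])
    exact ⟨T', π, hπ, pullback.lift z (π ≫ y) (by rw [Category.assoc]; exact hz.symm),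
      (pullback.lift_snd _ _ _).symm⟩
  exact_succ i := by
    rw [HomologicalComplex.exactAt_iff' _ (i + 2) (i + 1) i (by simp) (by simp)]
    cases i with
    | zero =>
      rw [ShortComplex.exact_iff_exact_up_to_refinements]
      intro T x hx
      change T ⟶ (pulledBack he φ).X 1 at x
      change x ≫ (pulledBack he φ).d 1 0 = 0 at hx
      have hx' := hx =≫ pulledBackFst he φ
      rw [Category.assoc, pulledBack_d_fst, zero_comp] at hx'
      obtain ⟨T', π, hπ, y, hy⟩ := (exact_descend Z he hZ 1).exact_up_to_refinements x hx'
      exact ⟨T', π, hπ, y, hy⟩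
    | succ i => exact exact_descend Z he hZ (i + 2)

end Pulling

/-- Maps from a resolution to an acyclic complex which ends with injective objects are homotopic to
zero. -/
theorem exists_lift_of_exact {F : A ⥤ B} {G : B ⥤ A} (adj : F ⊣ G) [F.PreservesZeroMorphisms]
    {Z : CochainComplex A ℤ}
    (hZ : coresolutions G Z) {e : ℕ → ℤ} (he : ∀ j, e (j + 1) + 1 = e j)
    (P : ChainComplex A ℕ) (hP0 : Epi (P.d 1 0))
    (hP : ∀ j, (ShortComplex.mk (P.d (j + 2) (j + 1)) (P.d (j + 1) j) (by simp)).Exact)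
    (hFP : ∀ j, (ShortComplex.mk (F.map (P.d (j + 2) (j + 1))) (F.map (P.d (j + 1) j))
      (by rw [← F.map_comp, P.d_comp_d, F.map_zero])).Exact)
    (f : ∀ j, P.X j ⟶ Z.X (e j))
    (hf : ∀ j, P.d (j + 1) j ≫ f j = f (j + 1) ≫ Z.d (e (j + 1)) (e j)) :
    ∃ h : P.X 0 ⟶ Z.X (e 1), h ≫ Z.d (e 1) (e 0) = f 0 := by
  obtain ⟨hac, m, I, hI, ⟨i⟩, h0, hJ⟩ := hZ
  by_cases hm : e 0 < m
  · exact ⟨0, (h0 _ hm).eq_of_tgt _ _⟩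
  obtain ⟨r, hr⟩ : ∃ r : ℕ, e r = m := ⟨(e 0 - m).toNat, by rw [eq_sub_of_step he]; lia⟩
  have key : ∀ (t j : ℕ), j + t = r → ∃ s : P.X j ⟶ Z.X (e (j + 1)),
      P.d (j + 1) j ≫ (f j - s ≫ Z.d (e (j + 1)) (e j)) = 0 := by
    intro t
    induction t with
    | zero =>
      rintro j rfl
      refine ⟨0, ?_⟩
      rw [zero_comp, sub_zero, hf]
      have : IsZero (Z.X (e (j + 1))) := h0 _ (by have := he j; lia)
      rw [this.eq_of_tgt (f (j + 1)) 0, zero_comp]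
    | succ t ih =>
      intro j hj
      obtain ⟨s, hs⟩ := ih (j + 1) (by lia)
      obtain ⟨s', hs'⟩ : ∃ s' : P.X j ⟶ Z.X (e (j + 1)),
          P.d (j + 1) j ≫ s' = f (j + 1) - s ≫ Z.d (e (j + 2)) (e (j + 1)) := by
        generalize f (j + 1) - s ≫ Z.d (e (j + 2)) (e (j + 1)) = g at hs
        change P.X (j + 1) ⟶ Z.X (e (j + 1)) at g
        obtain rfl | ht := Nat.eq_zero_or_pos t
        · obtain rfl : j + 1 = r := by lia
          obtain rfl : e (j + 1) = m := hr
          have h1 : F.map (P.d (j + 2) (j + 1)) ≫ (adj.homEquiv _ _).symm (g ≫ i.hom) = 0 := by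
            rw [← adj.homEquiv_naturality_left_symm, reassoc_of% hs, zero_comp,
              adj.homEquiv_counit, F.map_zero, zero_comp]
          refine ⟨adj.homEquiv _ _ ((hFP j).descToInjective _ h1) ≫ i.inv, ?_⟩
          rw [← Category.assoc, ← adj.homEquiv_naturality_left, (hFP j).comp_descToInjective,
            Equiv.apply_symm_apply, Category.assoc, i.hom_inv_id, Category.comp_id]
        · have : Injective (Z.X (e (j + 1))) := hJ _ (by
            rw [eq_sub_of_step he] at hr ⊢
            push_cast
            lia)
          exact ⟨(hP j).descToInjective g hs, (hP j).comp_descToInjective g hs⟩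
      refine ⟨s', ?_⟩
      rw [Preadditive.comp_sub, hf, ← Category.assoc, hs', Preadditive.sub_comp, Category.assoc,
        Z.d_comp_d, comp_zero, sub_zero, sub_self]
  obtain ⟨s, hs⟩ := key r 0 (by lia)
  refine ⟨s, ?_⟩
  have := (cancel_epi (P.d 1 0)).1 (hs.trans comp_zero.symm)
  exact (sub_eq_zero.1 this).symm

/-- The augmented complex of a resolution is exact. -/
theorem IsResolution.exact {A : Type*} [Category* A] [HasZeroMorphisms A] {X : ChainComplex A ℕ}
    {E : A} {ε : X.X 0 ⟶ E}
    (h : IsResolution X ε) (j : ℕ) :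
    (ShortComplex.mk ((ChainComplex.augment X ε h.zero).d (j + 2) (j + 1))
      ((ChainComplex.augment X ε h.zero).d (j + 1) j) (HomologicalComplex.d_comp_d _ _ _ _)).Exact := by
  cases j with
  | zero => exact h.exact_zero
  | succ j => exact (X.exactAt_iff' (j + 2) (j + 1) j (by simp) (by simp)).1 (h.exact_succ j)

theorem isExactFor_of_isLeftAcyclic {F : A ⥤ B} {G : B ⥤ A} (adj : F ⊣ G)
    [F.PreservesZeroMorphisms] {E : A} (hE : IsLeftAcyclic F E) :
    IsExactFor (coresolutions G) E := by
  intro Z hZ q φ hφ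
  let e : ℕ → ℤ := fun | 0 => q | 1 => q - 1 | j + 2 => q - 2 - j
  have he : ∀ j, e (j + 1) + 1 = e j := by
    rintro (_ | _ | j)
    · exact sub_add_cancel q 1
    · change q - 2 - (0 : ℕ) + 1 = q - 1; push_cast; lia
    · change q - 2 - (j + 1 : ℕ) + 1 = q - 2 - j; push_cast; lia
  obtain ⟨Q, t, hQ, hFQ⟩ := hE _ _ (isResolution_pulledBack Z he hZ.1 φ hφ)
  let f : ∀ j, (ChainComplex.augment Q _ hQ.zero).X j ⟶ Z.X (e j) :=
    fun | 0 => φ | 1 => t.f 0 ≫ pulledBackFst he φ | j + 2 => t.f (j + 1)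
  refine exists_lift_of_exact adj hZ he _ hQ.epi hQ.exact (fun j => ?_) f ?_
  · cases j with
    | zero => exact hFQ.exact_zero
    | succ j =>
      exact (HomologicalComplex.exactAt_iff' _ (j + 2) (j + 1) j (by simp) (by simp)).1
        (hFQ.exact_succ j)
  · rintro (_ | _ | j)
    · have h1 := t.f 0 ≫= pulledBack_condition Z he φ
      rw [← Category.assoc, ← Category.assoc] at h1
      exact h1.symm
    · have h1 := t.comm 1 0 =≫ pulledBackFst he φ
      rw [Category.assoc, Category.assoc, pulledBack_d_fst] at h1
      exact h1.symm
    · exact (t.comm (j + 2) (j + 1)).symm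

end Goodness

end CyclicHH

namespace CyclicHH

section Goodness

open HomologicalComplex CochainComplex

variable {A B : Type*} [Category* A] [Abelian A] [Category* B] [Abelian B]

theorem quasiIso_iff_acyclic_cone {X Y : CochainComplex A ℤ} (f : X ⟶ Y) :
    QuasiIso f ↔ (mappingCone f).Acyclic := by
  rw [← HomologicalComplex.mem_quasiIso_iff, ← HomotopyCategory.quotient_map_mem_quasiIso_iff,
    HomotopyCategory.quasiIso_eq_trW_subcategoryAcyclic,
    ← HomotopyCategory.quotient_obj_mem_subcategoryAcyclic_iff_acyclic]
  exact ObjectProperty.trW_iff_of_distinguished _ _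
    (HomotopyCategory.mappingCone_triangleh_distinguished f)

theorem leftPerp_mappingCone {𝒵 : ObjectProperty (CochainComplex A ℤ)} [𝒵.IsStableUnderShift ℤ]
    {X Y : CochainComplex A ℤ} (f : X ⟶ Y) (hX : leftPerp 𝒵 X) (hY : leftPerp 𝒵 Y) :
    leftPerp 𝒵 (mappingCone f) := by
  rw [leftPerp_iff] at hX hY ⊢
  exact (htpyProp 𝒵).leftOrthogonal.ext_of_isTriangulatedClosed₃ _
    (HomotopyCategory.mappingCone_triangleh_distinguished f) hX hY

/-- Every object of the form `G I` with `I` injective has an injective resolution, in a given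
degree. -/
theorem exists_coresolution [EnoughInjectives A] (G : B ⥤ A) (I : B) [Injective I] (n : ℤ) :
    ∃ (J : CochainComplex A ℤ) (_ : J.IsKInjective) (ι : (singleFunctor A n).obj (G.obj I) ⟶ J),
      coresolutions G (mappingCone ι) := by
  let R := InjectiveResolution.of (G.obj I)
  let J : CochainComplex A ℤ := R.cochainComplex⟦-n⟧
  have hJ0 (q : ℤ) (hq : q < n) : IsZero (J.X q) :=
    CochainComplex.isZero_of_isStrictlyGE R.cochainComplex 0 (q + -n) (by lia)
  have hJ (q : ℤ) : Injective (J.X q) :=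
    inferInstanceAs (Injective (R.cochainComplex.X (q + -n)))
  let ι : (singleFunctor A n).obj (G.obj I) ⟶ J :=
    ((singleFunctors A).shiftIso (-n) n 0 (by simp)).inv.app (G.obj I) ≫ R.ι'⟦-n⟧'
  refine ⟨J, inferInstanceAs (R.cochainComplex⟦-n⟧).IsKInjective, ι, ?_, n - 1, I, inferInstance,
    ⟨?_⟩, fun q hq => ?_, fun q hq => ?_⟩
  · rw [← quasiIso_iff_acyclic_cone]
    have h1 : QuasiIso (R.ι'⟦-n⟧') := inferInstance
    have h2 : QuasiIso (((singleFunctors A).shiftIso (-n) n 0 (by simp)).inv.app (G.obj I)) :=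
      inferInstance
    exact quasiIso_comp _ _
  · refine Iso.trans ⟨(mappingCone.fst ι).1.v (n - 1) n (by simp), (mappingCone.inl ι).v n (n - 1) (by lia), ?_, ?_⟩
      (singleX n (G.obj I))
    · rw [← mappingCone.id_X ι (n - 1) n (by simp), (hJ0 (n - 1) (by simp)).eq_of_tgt
        ((mappingCone.snd ι).v (n - 1) (n - 1) (add_zero _)) 0, zero_comp, add_zero]
    · exact mappingCone.inl_v_fst_v _ _ _ _
  · rw [IsZero.iff_id_eq_zero, ← mappingCone.id_X ι q (q + 1) rfl,
      (hJ0 q (by lia)).eq_of_tgt ((mappingCone.snd ι).v q q (add_zero _)) 0, zero_comp, add_zero,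
      (singleFunctor_isZero n (G.obj I) (i := q + 1) (by lia)).eq_of_tgt
        ((mappingCone.fst ι).1.v q (q + 1) rfl) 0, zero_comp]
  · have ret : Retract ((mappingCone ι).X q) (J.X q) :=
      { i := (mappingCone.snd ι).v q q (add_zero _)
        r := (mappingCone.inr ι).f q
        retract := by
          rw [← mappingCone.id_X ι q (q + 1) rfl,
            (singleFunctor_isZero n (G.obj I) (i := q + 1) (by lia)).eq_of_tgt
              ((mappingCone.fst ι).1.v q (q + 1) rfl) 0, zero_comp, zero_add] }
    have := hJ q
    exact ret.injective

/-- Maps from acyclic complexes in `leftPerp (coresolutions G)` to `G I`, for `I` injective, extend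
along the differential. -/
theorem exists_extension [EnoughInjectives A] (G : B ⥤ A) {X : CochainComplex A ℤ}
    (hX : leftPerp (coresolutions G) X) (hX' : X.Acyclic) (I : B) [Injective I] (n : ℤ)
    (g : X.X n ⟶ G.obj I) (hg : X.d (n - 1) n ≫ g = 0) :
    ∃ h : X.X (n + 1) ⟶ G.obj I, X.d n (n + 1) ≫ h = g := by
  obtain ⟨J, _, ι, hι⟩ := exists_coresolution G I n
  have h1 : (HomotopyCategory.quotient A (.up ℤ)).map (toSingle g hg) = 0 := by
    have hT := Pretriangulated.inv_rot_of_distTriang _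
      (HomotopyCategory.mappingCone_triangleh_distinguished ι)
    obtain ⟨f', hf'⟩ := Pretriangulated.Triangle.coyoneda_exact₂ _ hT
      ((HomotopyCategory.quotient A (.up ℤ)).map (toSingle g hg)) (by
        change (HomotopyCategory.quotient A (.up ℤ)).map (toSingle g hg) ≫
          (HomotopyCategory.quotient A (.up ℤ)).map ι = 0
        rw [← Functor.map_comp, HomotopyCategory.quotient_map_eq_zero_iff]
        exact ⟨IsKInjective.homotopyZero _ hX'⟩)
    have h0 : f' = 0 := (leftPerp_iff _ _).1 hX _
      ((htpyProp (coresolutions G)).le_shift (-1 : ℤ) _ ⟨_, hι, ⟨Iso.refl _⟩⟩)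
    exact hf'.trans ((h0 =≫ _).trans zero_comp)
  obtain ⟨h⟩ := (HomotopyCategory.quotient_map_eq_zero_iff _).1 h1
  have h3 := h.comm n
  rw [dNext_eq h.hom (i' := n + 1) (by simp), prevD_eq h.hom (j' := n - 1) (by simp),
      singleFunctor_d, comp_zero, add_zero, zero_f, add_zero, toSingle_f] at h3
  exact ⟨h.hom (n + 1) n ≫ (singleX n (G.obj I)).hom, by
    rw [← Category.assoc, ← h3, Category.assoc, Iso.inv_hom_id, Category.comp_id]⟩

theorem acyclic_map [EnoughInjectives A] [EnoughInjectives B] {F : A ⥤ B} {G : B ⥤ A}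
    (adj : F ⊣ G) [F.PreservesZeroMorphisms]
    {X : CochainComplex A ℤ} (hX : leftPerp (coresolutions G) X) (hX' : X.Acyclic) :
    ((F.mapHomologicalComplex (.up ℤ)).obj X).Acyclic := by
  rw [acyclic_iff_leftPerp]
  rintro Z ⟨I, n, hI, ⟨e⟩⟩ f
  let t : F.obj (X.X n) ⟶ I := (f ≫ e.hom).f n ≫ (singleX n I).hom
  have ht : F.map (X.d (n - 1) n) ≫ t = 0 := by
    have h1 : F.map (X.d (n - 1) n) ≫ (f ≫ e.hom).f n = 0 := by
      have := (f ≫ e.hom).comm (n - 1) n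
      rw [singleFunctor_d, comp_zero] at this
      exact this.symm
    exact (Category.assoc _ _ _).symm.trans ((h1 =≫ _).trans zero_comp)
  have hz : (adj.homEquiv (X.X (n - 1)) I) 0 = 0 := by
    apply (adj.homEquiv _ _).symm.injective
    rw [Equiv.symm_apply_apply, adj.homEquiv_counit, F.map_zero, zero_comp]
  obtain ⟨h, hh⟩ := exists_extension G hX hX' I n (adj.homEquiv _ _ t) (by
    rw [← adj.homEquiv_naturality_left, ht, hz])
  have h1 : Nonempty (Homotopy (f ≫ e.hom) 0) := by
    refine homotopy_zero_of_single _ ((adj.homEquiv _ _).symm h ≫ (singleX n I).inv) ?_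
    have h2 : F.map (X.d n (n + 1)) ≫ (adj.homEquiv _ _).symm h = t := by
      rw [← adj.homEquiv_naturality_left_symm, hh, Equiv.symm_apply_apply]
    refine (Category.assoc _ _ _).symm.trans ((h2 =≫ _).trans ?_)
    exact (Category.assoc _ _ _).trans ((_ ≫= (singleX n I).hom_inv_id).trans (Category.comp_id _))
  rw [← HomotopyCategory.quotient_map_eq_zero_iff] at h1 ⊢
  rw [Functor.map_comp] at h1
  rw [← cancel_mono ((HomotopyCategory.quotient B (.up ℤ)).map e.hom), h1, zero_comp]

theorem quasiIso_map [EnoughInjectives A] [EnoughInjectives B] {F : A ⥤ B} {G : B ⥤ A}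
    (adj : F ⊣ G) [F.Additive] {X Y : CochainComplex A ℤ} (f : X ⟶ Y) (hf : QuasiIso f)
    (hX : leftPerp (coresolutions G) X) (hY : leftPerp (coresolutions G) Y) :
    QuasiIso ((F.mapHomologicalComplex (.up ℤ)).map f) := by
  rw [quasiIso_iff_acyclic_cone] at hf ⊢
  have h1 := acyclic_map adj (leftPerp_mappingCone f hX hY) hf
  rw [← HomotopyCategory.quotient_obj_mem_subcategoryAcyclic_iff_acyclic] at h1 ⊢
  exact ((HomotopyCategory.subcategoryAcyclic B).prop_iff_of_iso
    ((HomotopyCategory.quotient B (.up ℤ)).mapIso (mappingCone.mapHomologicalComplexIso f F))).1 h1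

/-- The adjunction on complexes induced by an adjunction. -/
def complexAdj {F : A ⥤ B} {G : B ⥤ A} (adj : F ⊣ G) [F.Additive] [G.Additive] :
    F.mapHomologicalComplex (.up ℤ) ⊣ G.mapHomologicalComplex (.up ℤ) where
  unit :=
    { app := fun X => { f := fun q => adj.unit.app (X.X q)
                        comm' := fun i j _ => (adj.unit.naturality (X.d i j)).symm }
      naturality := fun X Y f => by
        ext q
        exact adj.unit.naturality (f.f q) }
  counit :=
    { app := fun X => { f := fun q => adj.counit.app (X.X q)
                        comm' := fun i j _ => (adj.counit.naturality (X.d i j)).symm }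
      naturality := fun X Y f => by
        ext q
        exact adj.counit.naturality (f.f q) }
  left_triangle_components X := by
    ext q
    exact adj.left_triangle_components (X.X q)
  right_triangle_components X := by
    ext q
    exact adj.right_triangle_components (X.X q)

/-- The image of a class of complexes under a functor. -/
abbrev mapClass (G : B ⥤ A) [G.Additive] (𝒵 : ObjectProperty (CochainComplex B ℤ)) :
    ObjectProperty (CochainComplex A ℤ) :=
  fun Y => ∃ Z, 𝒵 Z ∧ Nonempty (Y ≅ (G.mapHomologicalComplex (.up ℤ)).obj Z)

instance (G : B ⥤ A) [G.Additive] (𝒵 : ObjectProperty (CochainComplex B ℤ))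
    [𝒵.IsStableUnderShift ℤ] : (mapClass G 𝒵).IsStableUnderShift ℤ where
  isStableUnderShiftBy n := ⟨fun Y ⟨Z, hZ, ⟨e⟩⟩ => ⟨Z⟦n⟧, 𝒵.le_shift n _ hZ,
    ⟨(CategoryTheory.shiftFunctor _ n).mapIso e ≪≫
      (((G.mapHomologicalComplex (.up ℤ)).commShiftIso n).app Z).symm⟩⟩⟩

theorem homotopy_zero_iff_of_iso {X Y Z : CochainComplex A ℤ} (f : X ⟶ Y) (e : Y ≅ Z) :
    Nonempty (Homotopy (f ≫ e.hom) 0) ↔ Nonempty (Homotopy f 0) := by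
  rw [← HomotopyCategory.quotient_map_eq_zero_iff, ← HomotopyCategory.quotient_map_eq_zero_iff,
    Functor.map_comp, Preadditive.IsIso.comp_right_eq_zero]

theorem leftPerp_mapClass_iff {F : A ⥤ B} {G : B ⥤ A} (adj : F ⊣ G) [F.Additive] [G.Additive]
    (𝒵 : ObjectProperty (CochainComplex B ℤ)) (X : CochainComplex A ℤ) :
    leftPerp (mapClass G 𝒵) X ↔ leftPerp 𝒵 ((F.mapHomologicalComplex (.up ℤ)).obj X) := by
  constructor
  · intro h Z hZ f
    obtain ⟨t⟩ := h ⟨Z, hZ, ⟨Iso.refl _⟩⟩ ((complexAdj adj).homEquiv _ _ f)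
    have e : f = (F.mapHomologicalComplex (.up ℤ)).map ((complexAdj adj).homEquiv _ _ f) ≫
        (complexAdj adj).counit.app Z :=
      (((complexAdj adj).homEquiv _ _).symm_apply_apply f).symm.trans
        ((complexAdj adj).homEquiv_counit _ _ _)
    rw [e]
    exact ⟨((F.mapHomotopy t).compRight _).trans (Homotopy.ofEq (by simp))⟩
  · rintro h Y ⟨Z, hZ, ⟨i⟩⟩ f
    rw [← homotopy_zero_iff_of_iso f i]
    obtain ⟨t⟩ := h hZ (((complexAdj adj).homEquiv _ _).symm (f ≫ i.hom))
    have e : f ≫ i.hom = (complexAdj adj).unit.app X ≫ (G.mapHomologicalComplex (.up ℤ)).map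
        (((complexAdj adj).homEquiv _ _).symm (f ≫ i.hom)) :=
      (((complexAdj adj).homEquiv _ _).apply_symm_apply _).symm.trans
        ((complexAdj adj).homEquiv_unit _ _ _)
    rw [e]
    exact ⟨((G.mapHomotopy t).compLeft _).trans (Homotopy.ofEq (by simp))⟩

theorem isExactFor_mapClass {F : A ⥤ B} {G : B ⥤ A} (adj : F ⊣ G) [F.Additive] [G.Additive]
    {𝒵 : ObjectProperty (CochainComplex B ℤ)} {E : A} (hE : IsExactFor 𝒵 (F.obj E)) :
    IsExactFor (mapClass G 𝒵) E := by
  rintro Y ⟨Z, hZ, ⟨i⟩⟩ q φ hφ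
  obtain ⟨φ', h0⟩ : ∃ φ' : E ⟶ G.obj (Z.X q), φ' = φ ≫ i.hom.f q := ⟨_, rfl⟩
  have hφ' : φ' ≫ G.map (Z.d q (q + 1)) = 0 := by
    rw [h0]
    refine (Category.assoc _ _ _).trans ((φ ≫= i.hom.comm q (q + 1)).trans ?_)
    rw [reassoc_of% hφ, zero_comp]
    rfl
  obtain ⟨h, hh⟩ := hE hZ q ((adj.homEquiv _ _).symm φ') (by
    rw [← adj.homEquiv_naturality_right_symm, hφ', adj.homEquiv_counit, F.map_zero]
    exact zero_comp)
  refine ⟨adj.homEquiv _ _ h ≫ i.inv.f (q - 1), ?_⟩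
  have h1 : adj.homEquiv _ _ h ≫ G.map (Z.d (q - 1) q) = φ ≫ i.hom.f q := by
    rw [← adj.homEquiv_naturality_right, hh, ← h0]
    exact Equiv.apply_symm_apply _ _
  refine (Category.assoc _ _ _).trans ((_ ≫= i.inv.comm (q - 1) q).trans ?_)
  refine (Category.assoc _ _ _).symm.trans ((h1 =≫ _).trans ((Category.assoc _ _ _).trans ?_))
  have h2 : i.hom.f q ≫ i.inv.f q = 𝟙 _ := by rw [← comp_f, i.hom_inv_id, id_f]
  exact (φ ≫= h2).trans (Category.comp_id φ)

end Goodness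

end CyclicHH

namespace CyclicHH

section LexSite

variable {D : Type u} [SmallCategory D] [Abelian D] {k : Type u} [Field k] [Linear k D]
  {J : Type u} [SmallCategory J] {ι : Type u}

/-- Conditions on a class `W` of maps which ensure that the functors in `lexAlong k S` are the
sheaves, for the topology whose coverings are the maps in `W`, which are `k`-linear along the functors
`S i`. -/
structure IsLexSite (k : Type u) [Field k] [Linear k D] (S : ι → D ⥤ J) (W : MorphismProperty J) :
    Prop where
  mult : W.IsMultiplicative
  ore : ∀ {x x' y : J} (c : x ⟶ x') (g : x ⟶ y), W c →
    ∃ (y' : J) (c' : y ⟶ y') (g' : x' ⟶ y'), W c' ∧ c ≫ g' = g ≫ c'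
  map_mem : ∀ (i : ι) {X Y : D} (a : X ⟶ Y), Mono a → W ((S i).map a)
  le_of_map_mem : ∀ Q : MorphismProperty J, Q.IsStableUnderComposition →
    (∀ {x y : J} (f : x ⟶ y), IsIso f → W f → Q f) →
    (∀ (i : ι) {X Y : D} (a : X ⟶ Y), Mono a → Q ((S i).map a)) → W ≤ Q
  lift : ∀ (i : ι) {X Y : D} {x : J} (c : (S i).obj X ⟶ x) (f g : X ⟶ Y), W c →
    ∃ (j : ι) (X' Y' : D) (a : X ⟶ X') (b : Y ⟶ Y') (t : x ⟶ (S j).obj X')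
      (s : (S i).obj Y ⟶ (S j).obj Y') (f' g' : X' ⟶ Y'), W s ∧ f ≫ b = a ≫ f' ∧ g ≫ b = a ≫ g' ∧
      ∀ (h : X ⟶ Y) (h' : X' ⟶ Y'), h ≫ b = a ≫ h' →
        c ≫ t ≫ (S j).map h' = (S i).map h ≫ s
  pair : ∀ (Q : J ⥤ ModuleCat.{u} k), (∀ i, (S i ⋙ Q).Additive) →
    (∀ {x y : J} (c : x ⟶ y), W c → Function.Injective (Q.map c).hom) →
    ∀ (i : ι) {X Y Z : D} (a : X ⟶ Y) (b : Y ⟶ Z) (w : a ≫ b = 0), (ShortComplex.mk a b w).Exact →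
      Mono a → ∀ (e : Q.obj ((S i).obj Y)), (Q.map ((S i).map b)).hom e = 0 →
      ∀ {x : J} (p q : (S i).obj Y ⟶ x), (S i).map a ≫ p = (S i).map a ≫ q →
        (Q.map p).hom e = (Q.map q).hom e

namespace IsLexSite

theorem map_comp_apply (E : J ⥤ ModuleCat.{u} k) {x y z : J} (f : x ⟶ y) (g : y ⟶ z)
    (e : E.obj x) : (E.map (f ≫ g)).hom e = (E.map g).hom ((E.map f).hom e) :=
  congrArg (fun t => t.hom e) (E.map_comp f g)

theorem map_id_apply (E : J ⥤ ModuleCat.{u} k) (x : J)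
    (e : E.obj x) : (E.map (𝟙 x)).hom e = e :=
  congrArg (fun t => t.hom e) (E.map_id x)

variable {S : ι → D ⥤ J} {W : MorphismProperty J} (h : IsLexSite k S W)

include h

/-- The topology on `Jᵒᵖ` whose coverings are the maps in `W`. -/
def topology : GrothendieckTopology Jᵒᵖ where
  sieves X := {R | ∃ (y : J) (c : X.unop ⟶ y), W c ∧ R c.op}
  top_mem' X := ⟨X.unop, 𝟙 _, h.mult.id_mem _, trivial⟩
  pullback_stable' X Y R f := by
    rintro ⟨y, c, hc, hR⟩
    obtain ⟨y', c', g', hc', e⟩ := h.ore c f.unop hc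
    refine ⟨y', c', hc', ?_⟩
    have e' : c'.op ≫ f = g'.op ≫ c.op := Quiver.Hom.unop_inj e.symm
    change R (c'.op ≫ f)
    rw [e']
    exact R.downward_closed hR _
  transitive' X R := by
    rintro ⟨y, c, hc, hR⟩ R' hR'
    obtain ⟨z, c', hc', h'⟩ := hR' hR
    have := h.mult
    exact ⟨z, c ≫ c', W.comp_mem _ _ hc hc', h'⟩

omit h in
theorem injective_comp (E : J ⥤ ModuleCat.{u} k) {x y z : J} {f : x ⟶ y} {g : y ⟶ z}
    (hf : Function.Injective (E.map f).hom) (hg : Function.Injective (E.map g).hom) :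
    Function.Injective (E.map (f ≫ g)).hom := by
  intro a b hab
  rw [map_comp_apply, map_comp_apply] at hab
  exact hf (hg hab)

omit h in
theorem injective_of_isIso (E : J ⥤ ModuleCat.{u} k) {x y : J} (f : x ⟶ y) [IsIso f] :
    Function.Injective (E.map f).hom := by
  intro a b hab
  have := congrArg (E.map (inv f)).hom hab
  rwa [← map_comp_apply, ← map_comp_apply, IsIso.hom_inv_id, map_id_apply, map_id_apply] at this

theorem injective_map {E : J ⥤ ModuleCat.{u} k} (hE : lexAlong k S E) {x y : J} (c : x ⟶ y)
    (hc : W c) : Function.Injective (E.map c).hom := by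
  let Q : MorphismProperty J := fun x y c => Function.Injective (E.map c).hom
  refine h.le_of_map_mem Q ⟨fun f g hf hg => injective_comp E hf hg⟩
    (fun f _ _ => injective_of_isIso E f) ?_ _ hc
  · intro i X Y a ha
    have := (hE i).lex
    have : Mono ((S i ⋙ E).map a) := inferInstance
    exact (ModuleCat.mono_iff_injective _).1 this

/-- The sheaf condition for functors in `lexAlong k S`. -/
theorem exists_preimage {E : J ⥤ ModuleCat.{u} k} (hE : lexAlong k S E) {x y : J} (c : x ⟶ y)
    (hc : W c) (e : E.obj y) (he : ∀ {z : J} (p q : y ⟶ z), c ≫ p = c ≫ q →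
      (E.map p).hom e = (E.map q).hom e) : ∃ d, (E.map c).hom d = e := by
  let Q : MorphismProperty J := fun x y c => W c ∧ ∀ (e : E.obj y),
    (∀ (z : J) (p q : y ⟶ z), c ≫ p = c ≫ q → (E.map p).hom e = (E.map q).hom e) →
      ∃ d, (E.map c).hom d = e
  have hW : W.IsMultiplicative := h.mult
  have hcomp : Q.IsStableUnderComposition := by
    refine ⟨?_⟩
    rintro x y z f g ⟨hf, hf'⟩ ⟨hg, hg'⟩
    refine ⟨W.comp_mem _ _ hf hg, fun e he => ?_⟩
    obtain ⟨d, rfl⟩ := hg' e (fun w p q hpq => he w p q (by rw [Category.assoc, hpq, Category.assoc]))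
    obtain ⟨d', rfl⟩ := hf' d (by
      intro w p q hpq
      obtain ⟨w₁, l₁, p₁, hl₁, e₁⟩ := h.ore g p hg
      obtain ⟨w₂, l₂, q₂, hl₂, e₂⟩ := h.ore g (q ≫ l₁) hg
      apply h.injective_map hE (l₁ ≫ l₂) (W.comp_mem _ _ hl₁ hl₂)
      rw [← map_comp_apply, ← map_comp_apply]
      have e₃ : p ≫ l₁ ≫ l₂ = g ≫ p₁ ≫ l₂ := by rw [← Category.assoc, ← e₁, Category.assoc]
      have e₄ : q ≫ l₁ ≫ l₂ = g ≫ q₂ := by rw [e₂, Category.assoc]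
      rw [e₃, e₄, map_comp_apply, map_comp_apply _ g]
      refine he w₂ _ _ ?_
      rw [Category.assoc, Category.assoc, ← e₃, ← e₄]
      exact (reassoc_of% hpq) (l₁ ≫ l₂))
    exact ⟨d', map_comp_apply _ _ _ _⟩
  have hiso : ∀ {x y : J} (f : x ⟶ y), IsIso f → W f → Q f := fun f hf hW => ⟨hW, fun e _ =>
    ⟨(E.map (inv f)).hom e, by rw [← map_comp_apply, IsIso.inv_hom_id, map_id_apply]⟩⟩
  refine (h.le_of_map_mem Q hcomp hiso ?_ _ hc).2 e (fun z p q => he p q)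
  intro i X Y a ha
  refine ⟨h.map_mem i a ha, fun e he => ?_⟩
  have := (hE i).lex
  have := (hE i).additive
  let T : ShortComplex D := ShortComplex.mk a (cokernel.π a) (cokernel.condition a)
  have hT : T.Exact ∧ Mono T.f := ⟨ShortComplex.exact_cokernel a, ha⟩
  have hex := (Functor.preservesFiniteLimits_tfae (S i ⋙ E)|>.out 1 3 rfl rfl).2 (hE i).lex T hT
  have h1 := (ShortComplex.moduleCat_exact_iff _).1 hex.1
  refine h1 e ?_
  have h2 := he _ ((S i).map (cokernel.π a)) ((S i).map 0) (by
    rw [← Functor.map_comp, ← Functor.map_comp, cokernel.condition, comp_zero])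
  refine h2.trans ?_
  have h3 : (S i ⋙ E).map (0 : Y ⟶ cokernel a) = 0 := (S i ⋙ E).map_zero _ _
  exact congrArg (fun t => t.hom e) h3

theorem additive_of_isLocallySurjective {P Q : J ⥤ ModuleCat.{u} k} (φ : P ⟶ Q)
    (hφ : ∀ (x : J) (e : Q.obj x), ∃ (y : J) (c : x ⟶ y) (d : P.obj y), W c ∧
      (φ.app y).hom d = (Q.map c).hom e)
    (hP : lexAlong k S P) (hQ : ∀ {x y : J} (c : x ⟶ y), W c → Function.Injective (Q.map c).hom)
    (i : ι) : (S i ⋙ Q).Additive ∧ (S i ⋙ Q).Linear k := by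
  have key : ∀ {X Y : D} (f g : X ⟶ Y) (e : Q.obj ((S i).obj X)), ∃ (j : ι) (X' Y' : D)
      (b : Y ⟶ Y') (s : (S i).obj Y ⟶ (S j).obj Y') (f' g' : X' ⟶ Y') (a : X ⟶ X')
      (d : P.obj ((S j).obj X')), W s ∧ f ≫ b = a ≫ f' ∧ g ≫ b = a ≫ g' ∧
      ∀ (h : X ⟶ Y) (h' : X' ⟶ Y'), h ≫ b = a ≫ h' → (Q.map s).hom ((Q.map ((S i).map h)).hom e) =
        (φ.app _).hom ((P.map ((S j).map h')).hom d) := by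
    intro X Y f g e
    obtain ⟨x, c, d, hc, hd⟩ := hφ _ e
    obtain ⟨j, X', Y', a, b, t, s, f', g', hs, hf, hg, H⟩ := h.lift i c f g hc
    refine ⟨j, X', Y', b, s, f', g', a, (P.map t).hom d, hs, hf, hg, fun h h' hh => ?_⟩
    rw [← map_comp_apply, ← H h h' hh, map_comp_apply, ← hd, ← map_comp_apply P]
    exact (congrArg (fun r => r.hom d) (φ.naturality (t ≫ (S j).map h'))).symm
  constructor
  · refine ⟨fun {X Y f g} => ?_⟩
    ext e
    obtain ⟨j, X', Y', b, s, f', g', a, d, hs, hf, hg, H⟩ := key f g e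
    refine hQ s hs ?_
    have h1 := H (f + g) (f' + g') (by rw [Preadditive.add_comp, hf, hg, Preadditive.comp_add])
    have h2 : P.map ((S j).map (f' + g')) = P.map ((S j).map f') + P.map ((S j).map g') :=
      (hP j).additive.map_add
    refine h1.trans ?_
    rw [h2]
    refine Eq.trans ?_ (map_add (Q.map s).hom _ _).symm
    refine Eq.trans ?_ (congrArg₂ (· + ·) (H f f' hf) (H g g' hg)).symm
    exact map_add (φ.app _).hom _ _
  · refine ⟨fun {X Y} f r => ?_⟩
    ext e
    obtain ⟨j, X', Y', b, s, f', g', a, d, hs, hf, hg, H⟩ := key f f e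
    refine hQ s hs ?_
    have h1 := H (r • f) (r • f') (by rw [Linear.smul_comp, hf, Linear.comp_smul])
    have h2 : P.map ((S j).map (r • f')) = r • P.map ((S j).map f') :=
      (hP j).linear.map_smul f' r
    refine h1.trans ?_
    rw [h2]
    refine Eq.trans ?_ (map_smul (Q.map s).hom r _).symm
    refine Eq.trans ?_ (congrArg (r • ·) (H f f' hf)).symm
    exact map_smul (φ.app _).hom r _

/-- Sheaves which are `k`-linear along the functors `S i` are in `lexAlong k S`. -/
theorem lexAlong_of_additive {Q : J ⥤ ModuleCat.{u} k}
    (hQ : ∀ {x y : J} (c : x ⟶ y), W c → Function.Injective (Q.map c).hom)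
    (hQ' : ∀ {x y : J} (c : x ⟶ y), W c → ∀ (e : Q.obj y),
      (∀ (z : J) (p q : y ⟶ z), c ≫ p = c ≫ q → (Q.map p).hom e = (Q.map q).hom e) →
        ∃ d, (Q.map c).hom d = e)
    (hlin : ∀ i, (S i ⋙ Q).Additive ∧ (S i ⋙ Q).Linear k) : lexAlong k S Q := by
  intro i
  have := (hlin i).1
  refine ⟨(hlin i).1, (hlin i).2, (Functor.preservesFiniteLimits_tfae (S i ⋙ Q)|>.out 1 3 rfl rfl).1
    fun T hT => ⟨(ShortComplex.moduleCat_exact_iff _).2 fun e he => ?_, ?_⟩⟩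
  · exact hQ' _ (h.map_mem i T.f hT.2) e fun z p q hpq =>
      h.pair Q (fun i => (hlin i).1) hQ i T.f T.g T.zero hT.1 hT.2 e he p q hpq
  · exact (ModuleCat.mono_iff_injective _).2 (hQ _ (h.map_mem i T.f hT.2))

end IsLexSite
end LexSite
end CyclicHH

namespace CyclicHH

section LexAlong

variable {D : Type u} [SmallCategory D] [Abelian D] {k : Type u} [Field k] [Linear k D]
  {J : Type u} [SmallCategory J] {ι : Type u} (S : ι → D ⥤ J)

theorem lexAlong_eq_isLocal : lexAlong k S = (relW (k := k) S).isLocal := by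
  ext E; exact (isLocal_relW_iff S E).symm

theorem lexAlong_isClosedUnderLimitsOfShape (L : Type*) [Category* L] :
    (lexAlong k S).IsClosedUnderLimitsOfShape L := by
  rw [lexAlong_eq_isLocal]; infer_instance

attribute [local instance] Cardinal.fact_isRegular_aleph0

theorem lexAlong_isClosedUnderColimitsOfShape (L : Type u) [SmallCategory L] [IsFiltered L] :
    (lexAlong k S).IsClosedUnderColimitsOfShape L := by
  rw [lexAlong_eq_isLocal]
  have : IsCardinalFiltered L Cardinal.aleph0.{u} := (isCardinalFiltered_aleph0_iff L).2 inferInstance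
  refine MorphismProperty.isClosedUnderColimitsOfShape_isLocal _ L Cardinal.aleph0.{u} ?_
  rintro _ _ _ ⟨t⟩
  cases t <;> dsimp [relArrow] <;> exact ⟨inferInstance, inferInstance⟩

variable (k J) in
/-- Presheaves on `Jᵒᵖ` are functors on `J`. -/
def presheafToFunctor : (Jᵒᵖᵒᵖ ⥤ ModuleCat.{u} k) ⥤ (J ⥤ ModuleCat.{u} k) :=
  (Functor.whiskeringLeft _ _ _).obj (opOp J)

instance : PreservesLimitsOfSize.{w₁, w₂} (presheafToFunctor k J) :=
  inferInstanceAs (PreservesLimitsOfSize.{w₁, w₂} ((Functor.whiskeringLeft _ _ _).obj (opOp J)))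

variable (k) in
/-- Sheaves which are `k`-linear and left exact along the functors `S i`. -/
def lexSheaf (K : GrothendieckTopology Jᵒᵖ) : ObjectProperty (Sheaf K (ModuleCat.{u} k)) :=
  (lexAlong k S).inverseImage (sheafToPresheaf K _ ⋙ presheafToFunctor k J)

variable (K : GrothendieckTopology Jᵒᵖ)

instance (L : Type) [SmallCategory L] : (lexSheaf k S K).IsClosedUnderLimitsOfShape L := by
  have := lexAlong_isClosedUnderLimitsOfShape (k := k) S L
  unfold lexSheaf
  infer_instance

instance : (lexSheaf k S K).IsClosedUnderKernels where
  kernels_le := by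
    rintro _ ⟨f, c, hc, hf⟩
    have := lexAlong_isClosedUnderLimitsOfShape (k := k) S WalkingParallelPair
    refine (lexSheaf k S K).prop_of_isLimit hc ?_
    rintro (_ | _)
    · exact hf.1
    · exact hf.2

instance : (lexSheaf k S K).IsClosedUnderFiniteProducts where

instance : (lexSheaf k S K).ContainsZero where
  exists_zero := ⟨⊤_ _, (isZero_zero _).of_iso
    (terminalIsTerminal.uniqueUpToIso (isZero_zero _).isTerminal),
    (lexSheaf k S K).prop_of_isTerminal _ terminalIsTerminal⟩

/-- The category of functors which are left exact along `S` is reflective. -/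
@[reducible]
noncomputable def lexAlongReflective : Reflective (lexAlong k S).ι :=
  have := lexAlong_isRightAdjoint_ι (k := k) S
  { L := (lexAlong k S).ι.leftAdjoint
    adj := Adjunction.ofIsRightAdjoint _ }

theorem lexAlong_hasLimits : HasLimitsOfSize.{u, u} (lexAlong k S).FullSubcategory :=
  have := lexAlongReflective (k := k) S
  hasLimits_of_reflective (lexAlong k S).ι

theorem lexAlong_hasColimits : HasColimitsOfSize.{u, u} (lexAlong k S).FullSubcategory :=
  have := lexAlongReflective (k := k) S
  hasColimits_of_reflective (lexAlong k S).ι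

end LexAlong

namespace IsLexSite

variable {D : Type u} [SmallCategory D] [Abelian D] {k : Type u} [Field k] [Linear k D]
  {J : Type u} [SmallCategory J] {ι : Type u} {S : ι → D ⥤ J} {W : MorphismProperty J}
  (h : IsLexSite k S W)

include h

theorem isSheaf {E : J ⥤ ModuleCat.{u} k} (hE : lexAlong k S E) :
    Presheaf.IsSheaf h.topology (unopUnop J ⋙ E) := by
  rw [Presheaf.isSheaf_iff_isSheaf_forget _ _ (forget (ModuleCat.{u} k)),
    isSheaf_iff_isSheaf_of_type]
  rintro X R ⟨y, c, hc, hR⟩ x hx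
  obtain ⟨d, hd⟩ := h.exists_preimage hE c hc (x c.op hR) (fun {z} p q hpq =>
    hx p.op q.op hR hR (Quiver.Hom.unop_inj hpq))
  refine ⟨d, fun Y f hf => ?_, fun d' hd' => ?_⟩
  · obtain ⟨z, c', g', hc', e⟩ := h.ore c f.unop hc
    refine h.injective_map hE c' hc' ?_
    refine (map_comp_apply E f.unop c' d).symm.trans ?_
    rw [← e, map_comp_apply, hd]
    exact hx g'.op c'.op hR hf (Quiver.Hom.unop_inj e)
  · exact h.injective_map hE c hc ((hd' c.op hR).trans hd.symm)

theorem isSheafFor_of_isSheaf {F : Jᵒᵖᵒᵖ ⥤ ModuleCat.{u} k} (hF : Presheaf.IsSheaf h.topology F)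
    {x y : J} (c : x ⟶ y) (hc : W c) (e : F.obj (op (op y))) (he : ∀ (z : J) (p q : y ⟶ z),
      c ≫ p = c ≫ q → (F.map p.op.op).hom e = (F.map q.op.op).hom e) :
      ∃! d, (F.map c.op.op).hom d = e := by
  rw [Presheaf.isSheaf_iff_isSheaf_forget _ _ (forget (ModuleCat.{u} k)),
    isSheaf_iff_isSheaf_of_type] at hF
  have h1 : Sieve.generate (Presieve.singleton c.op) ∈ h.topology (op x) :=
    ⟨y, c, hc, Sieve.le_generate (Presieve.singleton c.op) _ _ (Presieve.singleton_self c.op)⟩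
  have h2 := (Presieve.isSheafFor_iff_generate _).2 (hF _ h1)
  rw [Presieve.isSheafFor_singleton] at h2
  exact h2 e fun {Z} p q hpq => he Z.unop p.unop q.unop (Quiver.Hom.op_inj hpq)

theorem isClosedUnderCokernels : (lexSheaf k S h.topology).IsClosedUnderCokernels where
  cokernels_le := by
    rintro _ ⟨f, c, hc, hf⟩
    have hepi : Epi c.π := Cofork.IsColimit.epi hc
    have hsurj := (Sheaf.isLocallySurjective_iff_epi' (ModuleCat.{u} k) c.π).2 hepi
    have hinj : ∀ {x y : J} (a : x ⟶ y), W a →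
        Function.Injective (c.pt.obj.map a.op.op).hom := by
      intro x y a ha e e' hee
      obtain ⟨d, hd, hd'⟩ := h.isSheafFor_of_isSheaf c.pt.property a ha
        ((c.pt.obj.map a.op.op).hom e) (fun z p q hpq => by
          refine (map_comp_apply (opOp J ⋙ c.pt.obj) a p e).symm.trans ?_
          rw [hpq]
          exact map_comp_apply (opOp J ⋙ c.pt.obj) a q e)
      exact (hd' e rfl).trans (hd' e' hee.symm).symm
    refine h.lexAlong_of_additive (Q := opOp J ⋙ c.pt.obj) hinj
      (fun a ha e he => (h.isSheafFor_of_isSheaf c.pt.property a ha e he).exists)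
      (h.additive_of_isLocallySurjective ((presheafToFunctor k J).map c.π.hom) ?_ hf.2 hinj)
    intro x e
    obtain ⟨y, a, ha, d, hd⟩ := hsurj.imageSieve_mem (U := op x) e
    exact ⟨y, a, d, ha, hd⟩

/-- Functors in `lexAlong k S` as sheaves. -/
def toLexSheaf : (lexAlong k S).FullSubcategory ⥤ (lexSheaf k S h.topology).FullSubcategory where
  obj E := ⟨⟨unopUnop J ⋙ E.obj, h.isSheaf E.property⟩, E.property⟩
  map f := ObjectProperty.homMk ⟨Functor.whiskerLeft (unopUnop J) f.hom⟩
  map_id _ := rfl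
  map_comp _ _ := rfl

instance : h.toLexSheaf.IsEquivalence where
  faithful := ⟨fun {E E' f g} hfg => by
    have h1 : Functor.whiskerLeft (unopUnop J) f.hom = Functor.whiskerLeft (unopUnop J) g.hom :=
      congrArg (fun t => t.hom.hom) hfg
    ext x e
    exact congrArg (fun t => (t.app (op (op x))).hom e) h1⟩
  full := ⟨fun {E E'} f => ⟨ObjectProperty.homMk (Functor.whiskerLeft (opOp J) f.hom.hom), rfl⟩⟩
  essSurj := ⟨fun F => ⟨⟨opOp J ⋙ F.obj.obj, F.property⟩, ⟨Iso.refl _⟩⟩⟩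

/-- The category `lexAlong k S` is abelian. -/
@[reducible]
noncomputable def abelian : Abelian (lexAlong k S).FullSubcategory := by
  have := h.isClosedUnderCokernels
  have := lexAlong_hasLimits (k := k) S
  have : HasLimits (lexAlong k S).FullSubcategory := this
  have : HasFiniteProducts (lexAlong k S).FullSubcategory := inferInstance
  exact abelianOfEquivalence h.toLexSheaf

omit h in
theorem hasSeparator : HasSeparator (lexAlong k S).FullSubcategory := by
  have := lexAlong_hasColimits (k := k) S
  have := lexAlong_isRightAdjoint_ι (k := k) S
  let L := (lexAlong k S).ι.leftAdjoint
  let adj : L ⊣ (lexAlong k S).ι := Adjunction.ofIsRightAdjoint _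
  have : HasCoproductsOfShape J (lexAlong k S).FullSubcategory := inferInstance
  refine ⟨∐ fun x : J => L.obj (freeOn k x), (isSeparator_sigma _).2 ?_⟩
  intro E E' f g hfg
  ext x e
  obtain ⟨φ, rfl⟩ := evalFree_surj k e
  have h1 := hfg (L.obj (freeOn k x)) ⟨x⟩ ((adj.homEquiv _ _).symm φ)
  have h2 := congrArg (adj.homEquiv _ _) h1
  rw [adj.homEquiv_naturality_right, adj.homEquiv_naturality_right, Equiv.apply_symm_apply] at h2
  exact congrArg evalFree h2

theorem isGrothendieckAbelian :
    letI := h.abelian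
    IsGrothendieckAbelian.{u} (lexAlong k S).FullSubcategory := by
  let := h.abelian
  have hl : HasLimitsOfSize.{u, u} (lexAlong k S).FullSubcategory := lexAlong_hasLimits (k := k) S
  have hc : HasColimitsOfSize.{u, u} (lexAlong k S).FullSubcategory := lexAlong_hasColimits (k := k) S
  have := lexAlong_isRightAdjoint_ι (k := k) S
  have hf : HasFilteredColimitsOfSize.{u, u} (lexAlong k S).FullSubcategory := inferInstance
  have hab : AB5OfSize.{u, u} (lexAlong k S).FullSubcategory := by
    refine ⟨fun L _ _ => ?_⟩
    have := lexAlong_isClosedUnderColimitsOfShape (k := k) S L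
    have : PreservesColimitsOfShape L (lexAlong k S).ι := inferInstance
    have : PreservesFiniteLimits (lexAlong k S).ι := inferInstance
    have : ReflectsFiniteLimits (lexAlong k S).ι := inferInstance
    have : HasExactColimitsOfShape L (J ⥤ ModuleCat.{u} k) := inferInstance
    exact HasExactColimitsOfShape.domain_of_functor L (lexAlong k S).ι
  have := hasSeparator (k := k) (S := S)
  exact {}

end IsLexSite
end CyclicHH

namespace CyclicHH

section SlotSite

variable {D : Type u} [SmallCategory D] {I : Type} [DecidableEq I]

/-- The value of `slot M v` in the slot `v`. -/
def slotSameApp (M : I → D) (v : I) (X : D) : (slot M v).obj X v ≅ X := (slotSame M v).app X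

/-- The value of `slot M v` in the other slots. -/
def slotNeApp (M : I → D) {v w : I} (h : w ≠ v) (X : D) : (slot M v).obj X w ≅ M w :=
  (slotNe M h).app X

theorem slotSameApp_natural (M : I → D) (v : I) {X Y : D} (f : X ⟶ Y) :
    (slot M v).map f v ≫ (slotSameApp M v Y).hom = (slotSameApp M v X).hom ≫ f :=
  (slotSame M v).hom.naturality f

theorem slotNeApp_natural (M : I → D) {v w : I} (h : w ≠ v) {X Y : D} (f : X ⟶ Y) :
    (slot M v).map f w ≫ (slotNeApp M h Y).hom = (slotNeApp M h X).hom :=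
  ((slotNe M h).hom.naturality f).trans (Category.comp_id _)

/-- A map out of a family with a distinguished slot. -/
def slotDesc (M : I → D) (v : I) {X : D} {L : I → D} (f : X ⟶ L v) (g : ∀ w, w ≠ v → (M w ⟶ L w)) :
    (slot M v).obj X ⟶ L := fun w =>
  if h : w = v then
    eqToHom (by rw [h]) ≫ (slotSameApp M v X).hom ≫ f ≫ eqToHom (by rw [h])
  else (slotNeApp M h X).hom ≫ g w h

theorem slotDesc_same (M : I → D) (v : I) {X : D} {L : I → D} (f : X ⟶ L v)
    (g : ∀ w, w ≠ v → (M w ⟶ L w)) : slotDesc M v f g v = (slotSameApp M v X).hom ≫ f := by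
  simp [slotDesc]

theorem slotDesc_ne (M : I → D) {v w : I} (h : w ≠ v) {X : D} {L : I → D} (f : X ⟶ L v)
    (g : ∀ w, w ≠ v → (M w ⟶ L w)) : slotDesc M v f g w = (slotNeApp M h X).hom ≫ g w h := by
  simp [slotDesc, h]

theorem slot_map_slotDesc (M : I → D) (v : I) {X Y : D} {L : I → D} (a : X ⟶ Y) (f : Y ⟶ L v)
    (g : ∀ w, w ≠ v → (M w ⟶ L w)) :
    (slot M v).map a ≫ slotDesc M v f g = slotDesc M v (a ≫ f) g := by
  funext w
  change (slot M v).map a w ≫ slotDesc M v f g w = slotDesc M v (a ≫ f) g w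
  by_cases h : w = v
  · subst h
    rw [slotDesc_same, slotDesc_same, reassoc_of% (slotSameApp_natural M w a)]
  · rw [slotDesc_ne _ h, slotDesc_ne _ h, reassoc_of% (slotNeApp_natural M h a)]

theorem eq_slotDesc (M : I → D) (v : I) {X : D} {L : I → D} (p : (slot M v).obj X ⟶ L) :
    p = slotDesc M v ((slotSameApp M v X).inv ≫ p v) (fun w h => (slotNeApp M h X).inv ≫ p w) := by
  funext w
  by_cases h : w = v
  · subst h
    rw [slotDesc_same, Iso.hom_inv_id_assoc]
  · rw [slotDesc_ne _ h, Iso.hom_inv_id_assoc]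

omit [DecidableEq I] in
theorem isIso_pi {L N : I → D} (f : L ⟶ N) (h : ∀ w, IsIso (f w)) : IsIso f :=
  ⟨fun w => inv (f w), funext fun w => IsIso.hom_inv_id (f w),
    funext fun w => IsIso.inv_hom_id (f w)⟩

/-- The family `L` from its value in the slot `v`. -/
def slotSelf (L : I → D) (v : I) : (slot L v).obj (L v) ⟶ L :=
  slotDesc L v (𝟙 _) (fun _ _ => 𝟙 _)

instance (L : I → D) (v : I) : IsIso (slotSelf L v) := isIso_pi _ fun w => by
  by_cases h : w = v
  · subst h
    unfold slotSelf
    rw [slotDesc_same]; infer_instance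
  · unfold slotSelf
    rw [slotDesc_ne _ h]; infer_instance

/-- Change of the values in the slots other than `v`. -/
def slotChange {M L : I → D} (v : I) (g : ∀ w, w ≠ v → (M w ⟶ L w)) (X : D) :
    (slot M v).obj X ⟶ (slot L v).obj X :=
  slotDesc M v (slotSameApp L v X).inv (fun w h => g w h ≫ (slotNeApp L h X).inv)

theorem slotDesc_comp {M L N : I → D} (v : I) {X : D} (f : X ⟶ L v)
    (g : ∀ w, w ≠ v → (M w ⟶ L w)) (r : L ⟶ N) :
    slotDesc M v f g ≫ r = slotDesc M v (f ≫ r v) (fun w h => g w h ≫ r w) := by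
  funext w
  change slotDesc M v f g w ≫ r w = _
  by_cases h : w = v
  · subst h
    rw [slotDesc_same, slotDesc_same, Category.assoc]
  · rw [slotDesc_ne _ h, slotDesc_ne _ h, Category.assoc]

theorem slotChange_desc {M L N : I → D} (v : I) (g : ∀ w, w ≠ v → (M w ⟶ L w)) {X : D}
    (f : X ⟶ N v) (g' : ∀ w, w ≠ v → (L w ⟶ N w)) :
    slotChange v g X ≫ slotDesc L v f g' = slotDesc M v f (fun w h => g w h ≫ g' w h) := by
  unfold slotChange
  rw [slotDesc_comp]
  congr 1
  · rw [slotDesc_same, Iso.inv_hom_id_assoc]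
  · funext w h
    rw [slotDesc_ne _ h, Category.assoc, Iso.inv_hom_id_assoc]

theorem slotDesc_eq {M L : I → D} (v : I) {X : D} (f : X ⟶ L v)
    (g : ∀ w, w ≠ v → (M w ⟶ L w)) :
    slotDesc M v f g = slotChange v g X ≫ (slot L v).map f ≫ slotSelf L v := by
  unfold slotSelf
  rw [slot_map_slotDesc, slotChange_desc]
  simp

theorem slotChange_natural {M L : I → D} (v : I) (g : ∀ w, w ≠ v → (M w ⟶ L w)) {X Y : D}
    (a : X ⟶ Y) : (slot M v).map a ≫ slotChange v g Y = slotChange v g X ≫ (slot L v).map a := by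
  rw [eq_slotDesc L v ((slot L v).map a), slotChange_desc]
  unfold slotChange
  rw [slot_map_slotDesc]
  congr 1
  · rw [Iso.eq_inv_comp, ← Category.assoc, ← slotSameApp_natural, Category.assoc, Iso.hom_inv_id,
      Category.comp_id]
  · funext w h
    congr 1
    rw [Iso.eq_inv_comp, ← slotNeApp_natural L h a, Category.assoc, Iso.hom_inv_id,
      Category.comp_id]

variable (D I) in
/-- Maps of families which are monomorphisms in each component. -/
def piMono : MorphismProperty (I → D) := fun _ _ c => ∀ w, Mono (c w)

omit [DecidableEq I] in
theorem piMono_comp {L M N : I → D} (f : L ⟶ M) (g : M ⟶ N) (hf : piMono D I f)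
    (hg : piMono D I g) : piMono D I (f ≫ g) := fun w => by
  have := hf w
  have := hg w
  exact mono_comp (f w) (g w)

omit [DecidableEq I] in
theorem piMono_of_isIso {L M : I → D} (f : L ⟶ M) [IsIso f] : piMono D I f := fun w =>
  inferInstanceAs (Mono ((Pi.eval (fun _ => D) w).map f))

theorem piMono_slotDesc (M : I → D) (v : I) {X : D} {L : I → D} (f : X ⟶ L v)
    (g : ∀ w, w ≠ v → (M w ⟶ L w)) (hf : Mono f) (hg : ∀ w h, Mono (g w h)) :
    piMono D I (slotDesc M v f g) := fun w => by
  by_cases h : w = v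
  · subst h
    rw [slotDesc_same]; infer_instance
  · rw [slotDesc_ne _ h]
    have := hg w h
    infer_instance

theorem piMono_slot (M : I → D) (v : I) {X Y : D} (a : X ⟶ Y) [Mono a] :
    piMono D I ((slot M v).map a) := by
  rw [eq_slotDesc M v ((slot M v).map a)]
  refine piMono_slotDesc _ _ _ _ ?_ (fun w h => ?_)
  · have : (slotSameApp M v X).inv ≫ (slot M v).map a v = a ≫ (slotSameApp M v Y).inv := by
      rw [Iso.inv_comp_eq, ← Category.assoc, Iso.eq_comp_inv, slotSameApp_natural]
    rw [this]; infer_instance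
  · have : (slotNeApp M h X).inv ≫ (slot M v).map a w = (slotNeApp M h Y).inv := by
      rw [Iso.inv_comp_eq, Iso.eq_comp_inv, slotNeApp_natural]
    rw [this]; infer_instance

theorem piMono_le [Finite I] (Q : MorphismProperty (I → D)) (hQ : Q.IsStableUnderComposition)
    (hiso : ∀ {x y : I → D} (f : x ⟶ y), IsIso f → Q f)
    (hs : ∀ (M : I → D) (v : I) {X Y : D} (a : X ⟶ Y), Mono a → Q ((slot M v).map a)) :
    piMono D I ≤ Q := by
  have := Fintype.ofFinite I
  have key : ∀ (s : Finset I) (M N : I → D) (c : M ⟶ N), piMono D I c →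
      (∀ w ∉ s, IsIso (c w)) → Q c := by
    intro s
    induction s using Finset.induction_on with
    | empty => exact fun M N c _ h => hiso _ (isIso_pi c fun w => h w (Finset.notMem_empty w))
    | insert v s hv ih =>
      intro M N c hc h
      have e : c = inv (slotSelf M v) ≫ (slot M v).map (c v) ≫
          slotDesc M v (𝟙 (N v)) (fun w _ => c w) := by
        rw [IsIso.eq_inv_comp, slot_map_slotDesc]
        unfold slotSelf
        rw [slotDesc_comp]
        simp
      rw [e]
      have := hc v
      refine hQ.comp_mem _ _ (hiso _ inferInstance) (hQ.comp_mem _ _ (hs M v (c v) (hc v))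
        (ih _ _ _ (piMono_slotDesc _ _ _ _ inferInstance fun w _ => hc w) fun w hw => ?_))
      by_cases hwv : w = v
      · subst hwv
        rw [slotDesc_same]; infer_instance
      · rw [slotDesc_ne _ hwv]
        have := h w (by simp [hwv, hw])
        infer_instance
  exact fun M N c hc => key Finset.univ M N c hc fun w hw => absurd (Finset.mem_univ w) hw

end SlotSite

section Site

variable {D : Type u} [SmallCategory D] [Abelian D] {k : Type u} [Field k] [Linear k D]
  {I : Type} [DecidableEq I]

omit [Linear k D] in
theorem slot_pair (Q : (I → D) ⥤ ModuleCat.{u} k)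
    (hQ : ∀ (M : I → D) (v : I), (slot M v ⋙ Q).Additive)
    (hinj : ∀ (M : I → D) (v : I) {X Y : D} (a : X ⟶ Y), Mono a →
      Function.Injective (Q.map ((slot M v).map a)).hom)
    (M : I → D) (v : I) {X Y Z : D} (a : X ⟶ Y) (b : Y ⟶ Z) (w : a ≫ b = 0)
    (hab : (ShortComplex.mk a b w).Exact) (e : Q.obj ((slot M v).obj Y))
    (he : (Q.map ((slot M v).map b)).hom e = 0) {L : I → D} (p q : (slot M v).obj Y ⟶ L)
    (hpq : (slot M v).map a ≫ p = (slot M v).map a ≫ q) : (Q.map p).hom e = (Q.map q).hom e := by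
  have h1 : ∀ w, w ≠ v → p w = q w := by
    intro w hw
    have h2 : (slot M v).map a w ≫ p w = (slot M v).map a w ≫ q w := congrFun hpq w
    have h3 : (slot M v).map a w = (slotNeApp M hw X).hom ≫ (slotNeApp M hw Y).inv := by
      rw [Iso.eq_comp_inv, slotNeApp_natural]
    rw [h3] at h2
    exact (cancel_epi _).1 h2
  have h2 : a ≫ (slotSameApp M v Y).inv ≫ p v = a ≫ (slotSameApp M v Y).inv ≫ q v := by
    have h2 : (slot M v).map a v ≫ p v = (slot M v).map a v ≫ q v := congrFun hpq v
    have h3 : (slotSameApp M v X).inv ≫ (slot M v).map a v = a ≫ (slotSameApp M v Y).inv := by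
      rw [Iso.inv_comp_eq, ← Category.assoc, Iso.eq_comp_inv, slotSameApp_natural]
    rw [← reassoc_of% h3, ← reassoc_of% h3, h2]
  let f := (slotSameApp M v Y).inv ≫ p v
  let f' := (slotSameApp M v Y).inv ≫ q v
  let g : ∀ w, w ≠ v → (M w ⟶ L w) := fun w h => (slotNeApp M h Y).inv ≫ p w
  have hp : p = slotDesc M v f g := eq_slotDesc M v p
  have hq : q = slotDesc M v f' g := (eq_slotDesc M v q).trans
    (congrArg (slotDesc M v f') (funext fun w => funext fun h => by rw [← h1 w h]))
  rw [hp, hq, slotDesc_eq, slotDesc_eq, IsLexSite.map_comp_apply, IsLexSite.map_comp_apply,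
    IsLexSite.map_comp_apply, IsLexSite.map_comp_apply]
  congr 1
  set e' := (Q.map (slotChange v g Y)).hom e with he'
  have h3 : (Q.map ((slot L v).map b)).hom e' = 0 := by
    rw [he', ← IsLexSite.map_comp_apply, ← slotChange_natural, IsLexSite.map_comp_apply, he,
      map_zero]
  have h4 : (Q.map ((slot L v).map (cokernel.π a))).hom e' = 0 := by
    have hm : Mono (cokernel.desc a b w) := hab.mono_cokernelDesc
    refine hinj L v (cokernel.desc a b w) hm ?_
    rw [← IsLexSite.map_comp_apply, ← Functor.map_comp, cokernel.π_desc, h3, map_zero]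
  have h5 : a ≫ (f - f') = 0 := by rw [Preadditive.comp_sub, h2, sub_self]
  have h6 : (Q.map ((slot L v).map (f - f'))).hom e' = 0 := by
    rw [← cokernel.π_desc a _ h5, Functor.map_comp, IsLexSite.map_comp_apply, h4, map_zero]
  have := hQ L v
  have h7 : Q.map ((slot L v).map (f - f')) = Q.map ((slot L v).map f) - Q.map ((slot L v).map f') :=
    (slot L v ⋙ Q).map_sub
  rw [h7] at h6
  exact sub_eq_zero.1 h6

variable (D k I) in
/-- The site of sheaves on a power of a category. -/
theorem isLexSite_slot [Finite I] :
    IsLexSite k (fun p : (I → D) × I => slot p.1 p.2) (piMono D I) where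
  mult := { id_mem := fun x => piMono_of_isIso _, comp_mem := piMono_comp }
  ore {x x' y} c g hc := by
    have := hc
    refine ⟨fun w => pushout (c w) (g w), fun w => pushout.inr (c w) (g w),
      fun w => pushout.inl (c w) (g w), fun w => ?_, funext fun w => pushout.condition⟩
    have := hc w
    infer_instance
  map_mem p X Y a ha := piMono_slot _ _ a
  le_of_map_mem Q hQ hiso hs := piMono_le Q hQ (fun f hf => hiso f hf (piMono_of_isIso f))
    (fun M v _ _ a ha => hs (M, v) a ha)
  lift := by
    rintro ⟨M, v⟩ X Y x c f g hc
    let cv : X ⟶ x v := (slotSameApp M v X).inv ≫ c v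
    let gc : ∀ w, w ≠ v → (M w ⟶ x w) := fun w h => (slotNeApp M h X).inv ≫ c w
    have hcv : Mono cv := by have := hc v; exact mono_comp _ (c v)
    have hgc : ∀ w h, Mono (gc w h) := fun w h => by have := hc w; exact mono_comp _ (c w)
    let u₁ := pushout.inr cv f
    let u₂ := pushout.inr cv (g ≫ u₁)
    refine ⟨(x, v), x v, _, cv, u₁ ≫ u₂, inv (slotSelf x v), slotChange v gc Y ≫
      (slot x v).map (u₁ ≫ u₂), pushout.inl cv f ≫ u₂, pushout.inl cv (g ≫ u₁), ?_, ?_, ?_, ?_⟩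
    · exact piMono_comp _ _ (piMono_slotDesc _ _ _ _ inferInstance
        fun w h => by have := hgc w h; infer_instance) (piMono_slot _ _ _)
    · rw [← Category.assoc, ← pushout.condition, Category.assoc]
    · rw [← Category.assoc, ← pushout.condition]
    · intro h h' hh
      have e : c = slotDesc M v cv gc := eq_slotDesc M v c
      change c ≫ inv (slotSelf x v) ≫ (slot x v).map h' = (slot M v).map h ≫ slotChange v gc Y ≫
        (slot x v).map (u₁ ≫ u₂)
      refine (congrArg (· ≫ inv (slotSelf x v) ≫ (slot x v).map h')
        (e.trans (slotDesc_eq _ _ _))).trans ?_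
      rw [reassoc_of% (slotChange_natural v gc h), Category.assoc, Category.assoc,
        IsIso.hom_inv_id_assoc, ← Functor.map_comp, ← Functor.map_comp, hh]
  pair Q hQ hinj p X Y Z a b w hab ha e he x r s hrs :=
    slot_pair Q (fun M v => hQ (M, v)) (fun M v _ _ a _ => hinj _ (piMono_slot M v a))
      p.1 p.2 a b w hab e he r s hrs

end Site
end CyclicHH

namespace CyclicHH

section CycMaps

variable {D : Type u} [SmallCategory D] [MonoidalCategory D]

namespace Cyc

theorem lift_comp_fiber {m n : CyclicCat} (f : m ⟶ n) {M : m.V → D} {N : n.V → D}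
    (φ : (push f).obj M ⟶ N) :
    lift f M ≫ (fiber n).map φ = (⟨f, φ⟩ : Hom ((fiber m).obj M) ((fiber n).obj N)) :=
  Hom.ext' (Category.comp_id f) fun (v : n.V) => by
    have h := (reassoc_of% (tensFlat_one M f.fib v)) (h := show tens M (f.fib v) ⟶ N v from φ v)
    have e : (tensFlat M f.fib [v]).hom ≫ tensMap (fun i => 𝟙 (tens M (f.fib i))) [v] ≫
        (tensOne (fun i => tens M (f.fib i)) v).hom ≫ φ v =
      tensCast M (List.flatMap_singleton f.fib v) ≫ φ v := by
      rw [tensMap_id, Category.id_comp]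
      exact h
    exact e

theorem eq_lift_comp {m n : CyclicCat} {M : m.V → D} {N : n.V → D}
    (g : (fiber m).obj M ⟶ (fiber n).obj N) :
    ∃ (f : m ⟶ n) (φ : (push f).obj M ⟶ N), g = lift f M ≫ (fiber n).map φ :=
  ⟨g.base, g.ι, (lift_comp_fiber g.base (M := M) (N := N) g.ι).symm⟩

theorem lift_comp_injective {m n : CyclicCat} (f : m ⟶ n) {M : m.V → D} {N : n.V → D}
    {φ ψ : (push f).obj M ⟶ N} (h : lift f M ≫ (fiber n).map φ = lift f M ≫ (fiber n).map ψ) :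
    φ = ψ := by
  rw [lift_comp_fiber, lift_comp_fiber] at h
  injection h

/-- Maps in the fibres of `D_#` over `Λ` which are monomorphisms in each component. -/
def fiberMono : MorphismProperty (Cyc D) := fun X Y c =>
  ∃ (N : X.base.V → D) (a : X.fam ⟶ N) (e : (fiber X.base).obj N = Y), piMono D _ a ∧
    (fiber X.base).map a ≫ eqToHom e = c

theorem fiberMono.exists {n : CyclicCat} {M : n.V → D} {Y : Cyc D} {c : (fiber n).obj M ⟶ Y}
    (h : fiberMono c) : ∃ (N : n.V → D) (a : M ⟶ N) (e : (fiber n).obj N = Y), piMono D _ a ∧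
      (fiber n).map a ≫ eqToHom e = c := h

@[elab_as_elim]
theorem fiber_induction {P : Cyc D → Prop} (h : ∀ (n : CyclicCat) (M : n.V → D), P ((fiber n).obj M))
    (X : Cyc D) : P X := h X.base X.fam

theorem fiberMono_map {n : CyclicCat} {M N : n.V → D} (a : M ⟶ N) (h : piMono D _ a) :
    fiberMono ((fiber n).map a) := ⟨N, a, rfl, h, Category.comp_id _⟩

end Cyc

theorem tensMap_mono {X : Type} [∀ X : D, (tensorLeft X).PreservesMonomorphisms]
    [∀ X : D, (tensorRight X).PreservesMonomorphisms] {M N : X → D} (a : M ⟶ N)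
    (h : piMono D X a) (l : List X) : Mono (tensMap a l) := by
  induction l with
  | nil => exact inferInstanceAs (Mono (𝟙 _))
  | cons i l ih =>
    have h1 := h i
    have h2 : Mono (a i ▷ tens M l) := inferInstanceAs (Mono ((tensorRight (tens M l)).map (a i)))
    have h3 : Mono (N i ◁ tensMap a l) := inferInstanceAs (Mono ((tensorLeft (N i)).map _))
    change Mono (a i ⊗ₘ tensMap a l)
    rw [MonoidalCategory.tensorHom_def]
    exact mono_comp _ _

end CycMaps

section SharpSite

variable {D : Type u} [SmallCategory D] [Abelian D] (k : Type u) [Field k] [Linear k D]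
  [MonoidalCategory D] [MonoidalPreadditive D] [MonoidalLinear k D]
  [∀ X : D, PreservesFiniteLimits (tensorLeft X)] [∀ X : D, PreservesFiniteLimits (tensorRight X)]

omit [Abelian D] [MonoidalPreadditive D] in
theorem piMono_push {m n : CyclicCat} (f : m ⟶ n) {M N : m.V → D} (a : M ⟶ N)
    (h : piMono D _ a) : piMono D _ ((push f).map a) := fun w => tensMap_mono a h (f.fib w)

variable (D) in
/-- The functors `D ⥤ D_#` given by a slot. -/
def slotSharp (p : Σ n : CyclicCat, (n.V → D) × n.V) : D ⥤ Cyc D :=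
  slot p.2.1 p.2.2 ⋙ Cyc.fiber p.1

theorem sharp_pair (Q : Cyc D ⥤ ModuleCat.{u} k) (hQ : ∀ p, (slotSharp D p ⋙ Q).Additive)
    (hinj : ∀ {x y : Cyc D} (c : x ⟶ y), Cyc.fiberMono c → Function.Injective (Q.map c).hom)
    {n m : CyclicCat} (M : n.V → D) (v : n.V) {X Y Z : D} (a : X ⟶ Y) (b : Y ⟶ Z) (w : a ≫ b = 0)
    (hab : (ShortComplex.mk a b w).Exact) (ha : Mono a)
    (e : Q.obj ((Cyc.fiber n).obj ((slot M v).obj Y)))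
    (he : (Q.map ((Cyc.fiber n).map ((slot M v).map b))).hom e = 0) {L : m.V → D} {f : n ⟶ m}
    (φ ψ : (push f).obj ((slot M v).obj Y) ⟶ L)
    (h : (Cyc.fiber n).map ((slot M v).map a) ≫ Cyc.lift f _ ≫ (Cyc.fiber m).map φ =
      (Cyc.fiber n).map ((slot M v).map a) ≫ Cyc.lift f _ ≫ (Cyc.fiber m).map ψ) :
    (Q.map (Cyc.lift f _ ≫ (Cyc.fiber m).map φ)).hom e =
      (Q.map (Cyc.lift f _ ≫ (Cyc.fiber m).map ψ)).hom e := by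
  obtain ⟨x, hx⟩ := CyclicCat.exists_mem_fib f v
  have h1 := reassoc_of% (Cyc.lift_natural f ((slot M v).map a))
  rw [h1, h1, ← Functor.map_comp, ← Functor.map_comp] at h
  have h2 := Cyc.lift_comp_injective f h
  let θ := slotPush f M v x hx
  let T := slot M v ⋙ tensFunctor (f.fib x)
  have hT : IsLinearLex k T := isLinearLex_tens k M v _ (CyclicCat.nodup_fib f x) hx
  have := hT.lex
  have := hT.additive
  have hTe := (Functor.preservesFiniteLimits_tfae T|>.out 1 3 rfl rfl).2 hT.lex
    (ShortComplex.mk a b w) ⟨hab, ha⟩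
  set e' := (Q.map (Cyc.lift f ((slot M v).obj Y))).hom e with he'
  have h3 : (Q.map ((Cyc.fiber m).map ((push f).map ((slot M v).map b)))).hom e' = 0 := by
    rw [he', ← IsLexSite.map_comp_apply, ← Cyc.lift_natural, IsLexSite.map_comp_apply, he, map_zero]
  let N := (push f).obj M
  let Q' := Cyc.fiber m ⋙ Q
  let e'' : Q'.obj ((slot N x).obj (T.obj Y)) := (Q'.map (θ.hom.app Y)).hom e'
  have h4 : (Q'.map ((slot N x).map (T.map b))).hom e'' = 0 := by
    have h5 : (push f).map ((slot M v).map b) ≫ θ.hom.app Z =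
      θ.hom.app Y ≫ (slot N x).map (T.map b) := θ.hom.naturality b
    have h6 := congrArg (fun t => (Q'.map t).hom e') h5
    refine ((IsLexSite.map_comp_apply Q' _ _ e').symm.trans h6.symm).trans ?_
    refine (IsLexSite.map_comp_apply Q' _ _ e').trans ?_
    exact (congrArg (Q'.map (θ.hom.app Z)).hom h3).trans (map_zero _)
  have h7 := slot_pair Q' (fun M v => hQ ⟨m, M, v⟩)
    (fun M v _ _ a _ => hinj _ (Cyc.fiberMono_map _ (piMono_slot M v a))) N x (T.map a) (T.map b)
    _ hTe.1 e'' h4 (θ.inv.app Y ≫ φ) (θ.inv.app Y ≫ ψ) (by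
      have h5 : θ.inv.app X ≫ (push f).map ((slot M v).map a) =
        (slot N x).map (T.map a) ≫ θ.inv.app Y := (θ.inv.naturality a).symm
      rw [← reassoc_of% h5, ← reassoc_of% h5, h2])
  have h8 : ∀ χ : (push f).obj ((slot M v).obj Y) ⟶ L, (Q'.map (θ.inv.app Y ≫ χ)).hom e'' =
      (Q.map (Cyc.lift f _ ≫ (Cyc.fiber m).map χ)).hom e := by
    intro χ
    refine (IsLexSite.map_comp_apply Q' (θ.hom.app Y) _ e').symm.trans ?_
    rw [Iso.hom_inv_id_app_assoc]
    exact (IsLexSite.map_comp_apply Q _ _ e).symm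
  exact ((h8 φ).symm.trans h7).trans (h8 ψ)

variable (D) in
theorem isLexSite_slotSharp : IsLexSite k (slotSharp D) (Cyc.fiberMono (D := D)) where
  mult :=
    { id_mem := fun X => by
        induction X using Cyc.fiber_induction with | _ n M
        rw [← CategoryTheory.Functor.map_id]
        exact Cyc.fiberMono_map _ (piMono_of_isIso _)
      comp_mem := by
        intro X Y Z f g hf hg
        induction X using Cyc.fiber_induction with | _ n M
        obtain ⟨N, a, rfl, ha, rfl⟩ := hf.exists
        obtain ⟨N', a', rfl, ha', rfl⟩ := hg.exists
        rw [eqToHom_refl, eqToHom_refl, Category.comp_id, Category.comp_id, ← Functor.map_comp]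
        exact Cyc.fiberMono_map _ (piMono_comp _ _ ha ha') }
  ore := by
    intro X X' Y c g hc
    induction X using Cyc.fiber_induction with | _ m M
    induction Y using Cyc.fiber_induction with | _ n L
    obtain ⟨M', a, rfl, ha, rfl⟩ := hc.exists
    obtain ⟨f, φ, rfl⟩ := Cyc.eq_lift_comp g
    obtain ⟨y', c', g', hc', e⟩ := (isLexSite_slot D k n.V).ore ((push f).map a) φ
      (piMono_push f a ha)
    refine ⟨(Cyc.fiber n).obj y', (Cyc.fiber _).map c', Cyc.lift f M' ≫ (Cyc.fiber _).map g',
      Cyc.fiberMono_map c' hc', ?_⟩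
    rw [eqToHom_refl, Category.comp_id, reassoc_of% (Cyc.lift_natural f a), ← Functor.map_comp, e,
      Functor.map_comp, Category.assoc]
  map_mem p X Y a ha := Cyc.fiberMono_map _ (piMono_slot _ _ a)
  le_of_map_mem := by
    intro Q hQ hiso hs X Y c hc
    induction X using Cyc.fiber_induction with | _ n M
    obtain ⟨N, a, rfl, ha, rfl⟩ := hc.exists
    rw [eqToHom_refl, Category.comp_id]
    refine (isLexSite_slot D k n.V).le_of_map_mem (Q.inverseImage (Cyc.fiber n))
      ⟨fun f g hf hg => ?_⟩ (fun f hf hf' => hiso _ inferInstance (Cyc.fiberMono_map f hf'))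
      (fun p _ _ a ha => hs ⟨_, p⟩ a ha) _ ha
    change Q ((Cyc.fiber n).map (f ≫ g))
    rw [Functor.map_comp]
    exact hQ.comp_mem _ _ hf hg
  lift := by
    rintro ⟨n, p⟩ X Y x c f g hc
    obtain ⟨N, a, rfl, ha, rfl⟩ := Cyc.fiberMono.exists hc
    obtain ⟨j, X', Y', a', b, t, s, f', g', hs, hf, hg, H⟩ := (isLexSite_slot D k n.V).lift p a f g ha
    refine ⟨⟨n, j⟩, X', Y', a', b, (Cyc.fiber n).map t, (Cyc.fiber n).map s, f', g',
      Cyc.fiberMono_map s hs, hf, hg, fun h h' hh => ?_⟩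
    rw [eqToHom_refl, Category.comp_id]
    have e := congrArg (Cyc.fiber n).map (H h h' hh)
    exact ((congrArg ((Cyc.fiber n).map a ≫ ·) (Functor.map_comp _ _ _).symm).trans
      (Functor.map_comp _ _ _).symm).trans (e.trans (Functor.map_comp _ _ _))
  pair Q hQ hinj := by
    rintro ⟨n, M, v⟩ X Y Z a b w hab ha e he x p q hpq
    induction x using Cyc.fiber_induction with | _ m L
    obtain ⟨f, φ, rfl⟩ := Cyc.eq_lift_comp p
    obtain ⟨f', ψ, rfl⟩ := Cyc.eq_lift_comp q
    have hff : f = f' := by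
      have := congrArg Cyc.Hom.base hpq
      change 𝟙 n ≫ f ≫ 𝟙 m = 𝟙 n ≫ f' ≫ 𝟙 m at this
      rwa [Category.id_comp, Category.id_comp, Category.comp_id, Category.comp_id] at this
    subst hff
    exact sharp_pair k Q hQ hinj M v a b w hab ha e he φ ψ hpq

end SharpSite
section Abelian

variable (C : Type u) [SmallCategory C] [Abelian C] (k : Type u) [Field k] [Linear k C]

theorem shvProp_eq_lexAlong (n : CyclicCat) : shvProp (D := Cᵒᵖ) k n.V =
    lexAlong k (fun p : (n.V → Cᵒᵖ) × n.V => slot p.1 p.2) := by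
  ext E
  exact ⟨fun h p => h p.1 p.2, fun h M v => h (M, v)⟩

theorem isEquivalence_ιOfLE {A : Type*} [Category* A] {P Q : ObjectProperty A} (h : P = Q) :
    (ObjectProperty.ιOfLE h.le).IsEquivalence := by
  subst h
  exact { essSurj := ⟨fun X => ⟨X, ⟨Iso.refl _⟩⟩⟩ }

noncomputable instance shvAbelian (n : CyclicCat) : Abelian (Shv C k n) :=
  letI := (isLexSite_slot Cᵒᵖ k n.V).abelian
  have := isEquivalence_ιOfLE (shvProp_eq_lexAlong C k n)
  have : HasLimits (Shv C k n) := by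
    have := lexAlong_hasLimits (k := k) (fun p : (n.V → Cᵒᵖ) × n.V => slot p.1 p.2)
    exact Adjunction.has_limits_of_equivalence
      (ObjectProperty.ιOfLE (shvProp_eq_lexAlong C k n).le)
  abelianOfEquivalence (ObjectProperty.ιOfLE (shvProp_eq_lexAlong C k n).le)

instance shvGrothendieck (n : CyclicCat) : IsGrothendieckAbelian.{u} (Shv C k n) := by
  let := (isLexSite_slot Cᵒᵖ k n.V).abelian
  have := (isLexSite_slot Cᵒᵖ k n.V).isGrothendieckAbelian
  have := isEquivalence_ιOfLE (shvProp_eq_lexAlong C k n)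
  exact IsGrothendieckAbelian.of_equivalence
    (ObjectProperty.ιOfLE (shvProp_eq_lexAlong C k n).le).asEquivalence.symm

variable [MonoidalCategory C]

theorem sharpShv_eq_lexAlong : sharpShv C k = lexAlong k (slotSharp Cᵒᵖ) := by
  ext E
  exact ⟨fun h p => h p.1 p.2.1 p.2.2, fun h n M v => h ⟨n, M, v⟩⟩

theorem sharpShv_isRightAdjoint_ι : (sharpShv C k).ι.IsRightAdjoint := by
  rw [sharpShv_eq_lexAlong]
  exact lexAlong_isRightAdjoint_ι _

variable [MonoidalPreadditive C] [MonoidalLinear k C]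
  [∀ X : C, PreservesFiniteColimits (tensorLeft X)]
  [∀ X : C, PreservesFiniteColimits (tensorRight X)]

theorem isLexSite_sharp : IsLexSite k (slotSharp Cᵒᵖ) (Cyc.fiberMono (D := Cᵒᵖ)) :=
  have := tensorLeft_op (C := C)
  have := tensorRight_op (C := C)
  isLexSite_slotSharp Cᵒᵖ k

noncomputable instance shvSharpAbelian : Abelian (ShvSharp C k) :=
  letI := (isLexSite_sharp C k).abelian
  have := isEquivalence_ιOfLE (sharpShv_eq_lexAlong C k)
  have : HasLimits (ShvSharp C k) := by
    have := lexAlong_hasLimits (k := k) (slotSharp Cᵒᵖ)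
    exact Adjunction.has_limits_of_equivalence
      (ObjectProperty.ιOfLE (sharpShv_eq_lexAlong C k).le)
  abelianOfEquivalence (ObjectProperty.ιOfLE (sharpShv_eq_lexAlong C k).le)

instance shvSharpGrothendieck : IsGrothendieckAbelian.{u} (ShvSharp C k) := by
  let := (isLexSite_sharp C k).abelian
  have := (isLexSite_sharp C k).isGrothendieckAbelian
  have := isEquivalence_ιOfLE (sharpShv_eq_lexAlong C k)
  exact IsGrothendieckAbelian.of_equivalence
    (ObjectProperty.ιOfLE (sharpShv_eq_lexAlong C k).le).asEquivalence.symm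

end Abelian

end CyclicHH

namespace CyclicHH

section CotenAdj

variable {k : Type u} [Field k] {J : Type u} [SmallCategory J]

/-- The functor `V ↦ Hom(A(-), V)`. -/
def homFun (A : Jᵒᵖ ⥤ ModuleCat.{u} k) : ModuleCat.{u} k ⥤ (J ⥤ ModuleCat.{u} k) :=
  linearYoneda k (ModuleCat.{u} k) ⋙ (Functor.whiskeringLeft _ _ _).obj A.rightOp

namespace coten

variable (A : Jᵒᵖ ⥤ ModuleCat.{u} k)

theorem condition_apply (E : J ⥤ ModuleCat.{u} k) {X Y : J} (f : X ⟶ Y) (a : A.obj (op Y))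
    (e : E.obj X) : (ι A E X).hom ((A.map f.op).hom a ⊗ₜ e) = (ι A E Y).hom (a ⊗ₜ (E.map f).hom e) :=
  congrArg (fun t => t.hom (a ⊗ₜ[k] e)) (condition A E f)

theorem ι_mapRight_apply {E E' : J ⥤ ModuleCat.{u} k} (g : E ⟶ E') {X : J} (a : A.obj (op X))
    (e : E.obj X) : (mapRight A g).hom ((ι A E X).hom (a ⊗ₜ e)) =
      (ι A E' X).hom (a ⊗ₜ (g.app X).hom e) :=
  congrArg (fun t => t.hom (a ⊗ₜ[k] e)) (ι_mapRight A g X)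

theorem hom_ext_apply {E : J ⥤ ModuleCat.{u} k} {V : ModuleCat.{u} k} {a b : coten A E ⟶ V}
    (h : ∀ X (x : A.obj (op X)) (e : E.obj X), a.hom ((ι A E X).hom (x ⊗ₜ e)) =
      b.hom ((ι A E X).hom (x ⊗ₜ e))) : a = b :=
  hom_ext fun X => ModuleCat.hom_ext (TensorProduct.ext' fun x e => h X x e)

/-- The map `E ⟶ Hom(A(-), V)` of a map from the coend to `V`. -/
noncomputable def curry {E : J ⥤ ModuleCat.{u} k} {V : ModuleCat.{u} k} (φ : coten A E ⟶ V) :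
    E ⟶ (homFun A).obj V where
  app X := ModuleCat.ofHom ((ModuleCat.homLinearEquiv (S := k)).symm.toLinearMap ∘ₗ
    (TensorProduct.curry (ι A E X ≫ φ).hom).flip)
  naturality X Y f := by
    ext e
    refine ModuleCat.hom_ext (LinearMap.ext fun a => ?_)
    exact congrArg φ.hom (condition_apply A E f a e).symm

/-- The map from the coend to `V` of a map `E ⟶ Hom(A(-), V)`. -/
noncomputable def uncurry {E : J ⥤ ModuleCat.{u} k} {V : ModuleCat.{u} k} (g : E ⟶ (homFun A).obj V) :
    coten A E ⟶ V :=
  coend.desc (fun X => ModuleCat.ofHom (TensorProduct.lift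
    ((ModuleCat.homLinearEquiv (S := k)).toLinearMap ∘ₗ (g.app X).hom).flip)) (by
    intro X Y f
    refine ModuleCat.hom_ext (TensorProduct.ext' fun x e => ?_)
    have h := congrArg (fun t => (show A.obj (op Y) ⟶ V from t.hom e).hom x) (g.naturality f)
    exact h.symm)

theorem uncurry_apply {E : J ⥤ ModuleCat.{u} k} {V : ModuleCat.{u} k} (g : E ⟶ (homFun A).obj V)
    {X : J} (a : A.obj (op X)) (e : E.obj X) : (uncurry A g).hom ((ι A E X).hom (a ⊗ₜ e)) =
      (show A.obj (op X) ⟶ V from (g.app X).hom e).hom a :=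
  congrArg (fun t : A.obj (op X) ⊗ E.obj X ⟶ V => t.hom (a ⊗ₜ[k] e))
    (show ι A E X ≫ uncurry A g = _ from coend.ι_desc _ _ X)

/-- The adjunction between the coend with `A` and `Hom(A(-), -)`, in terms of hom-sets. -/
noncomputable def curryEquiv (E : J ⥤ ModuleCat.{u} k) (V : ModuleCat.{u} k) :
    (coten A E ⟶ V) ≃ (E ⟶ (homFun A).obj V) where
  toFun := curry A
  invFun := uncurry A
  left_inv φ := hom_ext_apply A fun X x e => uncurry_apply A _ x e
  right_inv g := by
    ext X e
    exact ModuleCat.hom_ext (LinearMap.ext fun a => uncurry_apply A g a e)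

theorem curry_natural {E : J ⥤ ModuleCat.{u} k} {V V' : ModuleCat.{u} k} (φ : coten A E ⟶ V)
    (g : V ⟶ V') : curry A (φ ≫ g) = curry A φ ≫ (homFun A).map g := rfl

theorem mapRight_curry {E E' : J ⥤ ModuleCat.{u} k} {V : ModuleCat.{u} k} (g : E ⟶ E')
    (φ : coten A E' ⟶ V) : curry A (mapRight A g ≫ φ) = g ≫ curry A φ := by
  ext X e
  refine ModuleCat.hom_ext (LinearMap.ext fun a => ?_)
  exact congrArg φ.hom (ι_mapRight_apply A g a e)

end coten

end CotenAdj

namespace TraceFunctor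

variable {C : Type u} [SmallCategory C] [Abelian C] {k : Type u} [Field k] [Linear k C]
  [MonoidalCategory C] (T : TraceFunctor C k)

/-- The functor `tr` on `(Cᵒᵖ)^n`. -/
def onFam (n : CyclicCat) : (n.V → Cᵒᵖ)ᵒᵖ ⥤ ModuleCat.{u} k := unopFam n ⋙ Cyc.fiber n ⋙ T.toFunctor

/-- The trace functor is invariant under `f_!`. -/
noncomputable def onFamIso {m n : CyclicCat} (f : m ⟶ n) : T.onFam m ≅ (push f).op ⋙ T.onFam n :=
  have h (N : (m.V → Cᵒᵖ)ᵒᵖ) : IsIso ((Functor.whiskerRight (unopTrans f) T.toFunctor).app N) := by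
    have h1 : IsIso (T.toFunctor.map (Cyc.lift f ((unopFam m).obj N))) :=
      T.isIso_map _ fun v => inferInstanceAs (IsIso (𝟙 _))
    have h2 : IsIso (unopPush f N) := isIso_pi _ fun v =>
      inferInstanceAs (IsIso (tensUnop N.unop (f.fib v)).hom)
    change IsIso (T.toFunctor.map (Cyc.lift f ((unopFam m).obj N) ≫ (Cyc.fiber n).map (unopPush f N)))
    rw [Functor.map_comp]
    infer_instance
  @asIso _ _ _ _ (Functor.whiskerRight (unopTrans f) T.toFunctor) (@NatIso.isIso_of_isIso_app _ _ _ _ _ _ _ h)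

/-- The trace functor is invariant under `f_!`, for opposite categories. -/
noncomputable def onFamOpIso {m n : CyclicCat} (f : m ⟶ n) :
    push f ⋙ (T.onFam n).rightOp ≅ (T.onFam m).rightOp :=
  NatIso.ofComponents (fun N => ((T.onFamIso f).app (op N)).op)
    (fun {N N'} g => Quiver.Hom.unop_inj ((T.onFamIso f).hom.naturality g.op).symm)

/-- Coefficients `Hom(tr(-), V)` are invariant under restriction. -/
noncomputable def homFunIso {m n : CyclicCat} (f : m ⟶ n) (V : ModuleCat.{u} k) :
    push f ⋙ (homFun (T.onFam n)).obj V ≅ (homFun (T.onFam m)).obj V :=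
  Functor.isoWhiskerRight (T.onFamOpIso f) ((linearYoneda k (ModuleCat.{u} k)).obj V)

/-- A map from `[n]` to `[1]`. -/
def toOne (n : CyclicCat) : n ⟶ CyclicCat.one :=
  (⟨fun _ => List.finRange n.card, by
    change (List.finRange n.card ++ []) ~r _
    rw [List.append_nil]⟩ : CyclicCat.Hom n CyclicCat.one)

theorem isLinearLex_homFun_one (V : ModuleCat.{u} k) (M : CyclicCat.one.V → Cᵒᵖ)
    (v : CyclicCat.one.V) :
    IsLinearLex k (slot M v ⋙ (homFun (T.onFam CyclicCat.one)).obj V) := by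
  let F : C ⥤ ModuleCat.{u} k := single C ⋙ Cyc.fiber CyclicCat.one ⋙ T.toFunctor
  have h1 : F.Additive := T.additive
  have h2 : F.Linear k := T.linear
  have h3 : PreservesFiniteColimits F := T.rightExact
  have h4 : PreservesFiniteLimits F.op := preservesFiniteLimits_op F
  have h5 : PreservesLimits ((linearYoneda k (ModuleCat.{u} k)).obj V ⋙ forget _) :=
    inferInstanceAs (PreservesLimits (yoneda.obj V))
  have h6 : PreservesLimitsOfSize.{0,0} ((linearYoneda k (ModuleCat.{u} k)).obj V ⋙ forget _) :=
    preservesLimitsOfSize_shrink.{0, u, 0, u} _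
  have h7 : PreservesLimitsOfSize.{0,0} ((linearYoneda k (ModuleCat.{u} k)).obj V) :=
    ⟨fun {J _} => ⟨fun {K} => preservesLimit_of_reflects_of_preserves _
      (forget (ModuleCat.{u} k))⟩⟩
  have h8 : PreservesFiniteLimits ((linearYoneda k (ModuleCat.{u} k)).obj V) := inferInstance
  have hv : ∀ w : CyclicCat.one.V, w = v := fun w => Subsingleton.elim (α := Fin 1) w v
  let e : slot M v ≅ Functor.pi' fun _ => 𝟭 Cᵒᵖ :=
    NatIso.pi' fun w => by
      obtain rfl := hv w
      exact slotSame M w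
  have h9 : IsLinearLex k (F.op ⋙ (linearYoneda k (ModuleCat.{u} k)).obj V) := by
    refine ⟨⟨fun {X Y f g} => ?_⟩, ⟨fun {X Y} f r => ?_⟩, comp_preservesFiniteLimits _ _⟩
    · ext t
      refine (congrArg (· ≫ t) (F.map_add (f := f.unop) (g := g.unop))).trans ?_
      exact Preadditive.add_comp _ _ _ _ _ _
    · ext t
      refine (congrArg (· ≫ t) (F.map_smul r f.unop)).trans ?_
      exact Linear.smul_comp (R := k) _ _ _ _ _ _
  exact IsLinearLex.of_iso k h9 (Functor.isoWhiskerRight e.symm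
    ((homFun (T.onFam CyclicCat.one)).obj V))

variable [MonoidalPreadditive C] [MonoidalLinear k C]
  [∀ X : C, PreservesFiniteColimits (tensorLeft X)]
  [∀ X : C, PreservesFiniteColimits (tensorRight X)]

theorem shvProp_homFun (n : CyclicCat) (V : ModuleCat.{u} k) :
    shvProp k n.V ((homFun (T.onFam n)).obj V) := by
  have := tensorLeft_op (C := C)
  have := tensorRight_op (C := C)
  have h1 : shvProp k CyclicCat.one.V ((homFun (T.onFam CyclicCat.one)).obj V) :=
    T.isLinearLex_homFun_one V
  intro M v
  exact IsLinearLex.of_iso k (shvProp_push k (toOne n) h1 M v)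
    (Functor.isoWhiskerLeft (slot M v) (T.homFunIso (toOne n) V))

omit [MonoidalPreadditive C] [MonoidalLinear k C]
  [∀ X : C, PreservesFiniteColimits (tensorLeft X)]
  [∀ X : C, PreservesFiniteColimits (tensorRight X)] in
theorem uncurry_natural (n : CyclicCat) {E E' : (n.V → Cᵒᵖ) ⥤ ModuleCat.{u} k}
    {V : ModuleCat.{u} k} (f : E ⟶ E') (g : E' ⟶ (homFun (T.onFam n)).obj V) :
    coten.uncurry (T.onFam n) (f ≫ g) = coten.mapRight (T.onFam n) f ≫
      coten.uncurry (T.onFam n) g := by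
  refine (coten.curryEquiv (T.onFam n) E V).injective ?_
  refine ((coten.curryEquiv (T.onFam n) E V).apply_symm_apply _).trans ?_
  refine Eq.trans ?_ (coten.mapRight_curry (T.onFam n) f _).symm
  exact congrArg (f ≫ ·) ((coten.curryEquiv (T.onFam n) E' V).apply_symm_apply g).symm

/-- The right adjoint of `tr` on `Shv(C^n)`. -/
def trRight (n : CyclicCat) : ModuleCat.{u} k ⥤ Shv C k n :=
  ObjectProperty.lift _ (homFun (T.onFam n)) (T.shvProp_homFun n)

/-- The adjunction between `tr` and `V ↦ Hom(tr(-), V)`, in terms of hom-sets. -/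
noncomputable def trHomEquiv (n : CyclicCat) (E : Shv C k n) (V : ModuleCat.{u} k) :
    ((T.tr n).obj E ⟶ V) ≃ (E ⟶ (T.trRight n).obj V) where
  toFun φ := ObjectProperty.homMk (coten.curry (T.onFam n) φ)
  invFun g := coten.uncurry (T.onFam n) g.hom
  left_inv φ := (coten.curryEquiv (T.onFam n) E.obj V).left_inv φ
  right_inv g := ObjectProperty.hom_ext _ ((coten.curryEquiv (T.onFam n) E.obj V).right_inv g.hom)

/-- The adjunction between `tr` and `V ↦ Hom(tr(-), V)`. -/
noncomputable def trAdj (n : CyclicCat) : T.tr n ⊣ T.trRight n :=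
  Adjunction.mkOfHomEquiv
    { homEquiv := T.trHomEquiv n
      homEquiv_naturality_left_symm := fun f g => T.uncurry_natural n f.hom g.hom
      homEquiv_naturality_right := fun {E V V'} φ g =>
        ObjectProperty.hom_ext _ (coten.curry_natural (T.onFam n) φ g) }

theorem trAdj_homEquiv (n : CyclicCat) (E : Shv C k n) (V : ModuleCat.{u} k)
    (φ : (T.tr n).obj E ⟶ V) : (T.trAdj n).homEquiv E V φ =
      ObjectProperty.homMk (coten.curry (T.onFam n) φ) := by
  unfold trAdj
  rw [Adjunction.mkOfHomEquiv_homEquiv]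
  rfl

instance (n : CyclicCat) : (T.tr n).IsLeftAdjoint := (T.trAdj n).isLeftAdjoint

instance (n : CyclicCat) : (T.tr n).Additive := by
  have : PreservesBinaryBiproducts (T.tr n) := preservesBinaryBiproducts_of_preservesBinaryCoproducts _
  exact Functor.additive_of_preservesBinaryBiproducts _

/-- The right adjoints of `tr` are compatible with restriction. -/
noncomputable def trRightIso {m n : CyclicCat} (f : m ⟶ n) :
    T.trRight n ⋙ restr k f ≅ T.trRight m :=
  NatIso.ofComponents (fun V => ObjectProperty.isoMk _ (T.homFunIso f V)) (fun {V V'} g => by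
    ext N e
    refine ModuleCat.hom_ext (LinearMap.ext fun a => rfl))

end TraceFunctor
end CyclicHH

namespace CyclicHH

section Ran

variable {C : Type u} [SmallCategory C] [MonoidalCategory C] {k : Type u} [Field k]
  {n : CyclicCat} (E : (n.V → Cᵒᵖ) ⥤ ModuleCat.{u} k)

/-- The right Kan extension from a fibre of `(Cᵒᵖ)_#`. -/
noncomputable abbrev ranFiber : Cyc Cᵒᵖ ⥤ ModuleCat.{u} k := (Cyc.fiber n).ran.obj E

/-- The projection from the right Kan extension given by a map to `[n]`. -/
noncomputable def ranProj {m : CyclicCat} (f : m ⟶ n) : Cyc.fiber m ⋙ ranFiber E ⟶ push f ⋙ E :=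
  liftTrans (ranFiber E) f ≫ Functor.whiskerLeft (push f) ((Cyc.fiber n).ranCounit.app E)

theorem ranProj_apply {m : CyclicCat} (f : m ⟶ n) (M : m.V → Cᵒᵖ)
    (x : (ranFiber E).obj ((Cyc.fiber m).obj M)) : ((ranProj E f).app M).hom x =
      (((Cyc.fiber n).ranCounit.app E).app _).hom (((ranFiber E).map (Cyc.lift f M)).hom x) := rfl

theorem ranProj_injective {m : CyclicCat} (M : m.V → Cᵒᵖ)
    (x x' : (ranFiber E).obj ((Cyc.fiber m).obj M))
    (h : ∀ f, ((ranProj E f).app M).hom x = ((ranProj E f).app M).hom x') : x = x' := by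
  obtain ⟨φ, rfl⟩ := evalFree_surj k x
  obtain ⟨φ', rfl⟩ := evalFree_surj k x'
  congr 1
  refine (ranFiber E).hom_ext_of_isRightKanExtension ((Cyc.fiber n).ranCounit.app E) _ _ ?_
  ext N : 2
  refine ModuleCat.free_hom_ext fun c => ?_
  obtain ⟨f, ψ, rfl⟩ := Cyc.eq_lift_comp c
  have key : ∀ χ : freeOn k ((Cyc.fiber m).obj M) ⟶ ranFiber E,
      (((Cyc.fiber n).ranCounit.app E).app N).hom ((χ.app ((Cyc.fiber n).obj N)).hom
        (ModuleCat.freeMk (Cyc.lift f M ≫ (Cyc.fiber n).map ψ))) =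
      (E.map ψ).hom (((ranProj E f).app M).hom (evalFree (x := (Cyc.fiber m).obj M) (E := ranFiber E) χ)) := by
    intro χ
    rw [app_freeMk, ranProj_apply, IsLexSite.map_comp_apply]
    exact congrArg (fun t => t.hom (((ranFiber E).map (Cyc.lift f M)).hom (evalFree (x := (Cyc.fiber m).obj M) (E := ranFiber E) χ)))
      (((Cyc.fiber n).ranCounit.app E).naturality ψ)
  exact (key φ).trans ((congrArg _ (h f)).trans (key φ').symm)

theorem ranProj_surjective {m : CyclicCat} (M : m.V → Cᵒᵖ)
    (y : ∀ f : m ⟶ n, E.obj ((push f).obj M)) :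
    ∃ x, ∀ f, ((ranProj E f).app M).hom x = y f := by
  let val : ∀ {N : n.V → Cᵒᵖ} (_ : (Cyc.fiber m).obj M ⟶ (Cyc.fiber n).obj N), E.obj N :=
    fun {N} c => (E.map (show (push c.base).obj M ⟶ N from c.ι)).hom (y c.base)
  have hval : ∀ {N : n.V → Cᵒᵖ} (f : m ⟶ n) (ψ : (push f).obj M ⟶ N),
      val (Cyc.lift f M ≫ (Cyc.fiber n).map ψ) = (E.map ψ).hom (y f) := by
    intro N f ψ
    rw [Cyc.lift_comp_fiber]
    rfl
  let g : Cyc.fiber n ⋙ freeOn k ((Cyc.fiber m).obj M) ⟶ E :=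
    { app := fun N => ModuleCat.freeDesc (↾fun c => val c)
      naturality := by
        intro N N' ψ
        refine ModuleCat.free_hom_ext fun c => ?_
        obtain ⟨f, χ, rfl⟩ := Cyc.eq_lift_comp c
        have h2 : ((freeOn k ((Cyc.fiber m).obj M)).map ((Cyc.fiber n).map ψ)).hom
            (ModuleCat.freeMk (Cyc.lift f M ≫ (Cyc.fiber n).map χ)) =
            ModuleCat.freeMk (Cyc.lift f M ≫ (Cyc.fiber n).map (χ ≫ ψ)) := by
          refine (ModuleCat.free_map_apply _ _).trans (congrArg _ ?_)
          rw [Functor.map_comp]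
          exact (Category.assoc (Cyc.lift f M) ((Cyc.fiber n).map χ) ((Cyc.fiber n).map ψ))
        refine (congrArg _ h2).trans ((ModuleCat.freeDesc_apply _ _).trans ?_)
        refine Eq.trans ?_ (congrArg (E.map ψ).hom (ModuleCat.freeDesc_apply _ _).symm)
        refine (hval f (χ ≫ ψ)).trans ?_
        refine Eq.trans ?_ (congrArg (E.map ψ).hom (hval f χ).symm)
        exact IsLexSite.map_comp_apply E χ ψ (y f) }
  let φ := (ranFiber E).liftOfIsRightKanExtension ((Cyc.fiber n).ranCounit.app E) _ g
  have hφ := (ranFiber E).liftOfIsRightKanExtension_fac ((Cyc.fiber n).ranCounit.app E) _ g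
  refine ⟨evalFree (x := (Cyc.fiber m).obj M) (E := ranFiber E) φ, fun f => ?_⟩
  rw [ranProj_apply, ← app_freeMk]
  have h1 := congrArg (fun t => (t.app ((push f).obj M)).hom (ModuleCat.freeMk (Cyc.lift f M))) hφ
  refine h1.trans ((ModuleCat.freeDesc_apply _ _).trans ?_)
  exact IsLexSite.map_id_apply E _ (y f)

end Ran

section JointlyBijective

variable {D : Type u} [SmallCategory D] [Abelian D] {k : Type u} [Field k] [Linear k D]

/-- A functor which is the product of left exact functors is left exact. -/
theorem isLinearLex_of_bijective {ι : Type} {F : D ⥤ ModuleCat.{u} k} (G : ι → D ⥤ ModuleCat.{u} k)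
    (π : ∀ i, F ⟶ G i) (hinj : ∀ X (x x' : F.obj X), (∀ i, ((π i).app X).hom x =
      ((π i).app X).hom x') → x = x')
    (hsurj : ∀ X (y : ∀ i, (G i).obj X), ∃ x, ∀ i, ((π i).app X).hom x = y i)
    (hG : ∀ i, IsLinearLex k (G i)) : IsLinearLex k F := by
  have hnat : ∀ i {X Y : D} (f : X ⟶ Y) (x : F.obj X), ((π i).app Y).hom ((F.map f).hom x) =
      ((G i).map f).hom (((π i).app X).hom x) := fun i X Y f x =>
    congrArg (fun t => t.hom x) ((π i).naturality f)
  have ha : F.Additive := ⟨fun {X Y f g} => by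
    ext x
    refine hinj _ _ _ fun i => ?_
    have := (hG i).additive
    rw [hnat, (G i).map_add]
    refine Eq.trans ?_ (map_add ((π i).app Y).hom _ _).symm
    exact congrArg₂ (· + ·) (hnat i f x).symm (hnat i g x).symm⟩
  refine ⟨ha, ⟨fun {X Y} f r => ?_⟩, ?_⟩
  · ext x
    refine hinj _ _ _ fun i => ?_
    have := (hG i).linear
    rw [hnat, (G i).map_smul]
    refine Eq.trans ?_ (map_smul ((π i).app Y).hom r _).symm
    exact congrArg (r • ·) (hnat i f x).symm
  · refine (Functor.preservesFiniteLimits_tfae F|>.out 1 3 rfl rfl).1 fun T hT => ?_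
    have hT' := fun i =>
      have := (hG i).additive
      (Functor.preservesFiniteLimits_tfae (G i)|>.out 1 3 rfl rfl).2 (hG i).lex T hT
    constructor
    · refine (ShortComplex.moduleCat_exact_iff _).2 fun e he => ?_
      have h1 : ∀ i, ∃ d, ((G i).map T.f).hom d = ((π i).app T.X₂).hom e := fun i => by
        refine (ShortComplex.moduleCat_exact_iff _).1 (hT' i).1 _ ?_
        refine (hnat i T.g e).symm.trans ?_
        exact (congrArg _ he).trans (map_zero _)
      choose d hd using h1
      obtain ⟨x, hx⟩ := hsurj _ d
      refine ⟨x, hinj _ _ _ fun i => ?_⟩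
      refine (hnat i T.f x).trans ?_
      rw [hx, hd]
    · refine (ModuleCat.mono_iff_injective _).2 fun x x' hxx => hinj _ _ _ fun i => ?_
      refine (ModuleCat.mono_iff_injective _).1 (hT' i).2 ?_
      rw [← hnat, ← hnat, hxx]

end JointlyBijective

section Coinduction

variable (C : Type u) [SmallCategory C] [Abelian C] (k : Type u) [Field k] [Linear k C]
  [MonoidalCategory C] [MonoidalPreadditive C] [MonoidalLinear k C]
  [∀ X : C, PreservesFiniteColimits (tensorLeft X)]
  [∀ X : C, PreservesFiniteColimits (tensorRight X)]

theorem sharpShv_ranFiber {n : CyclicCat} (E : Shv C k n) : sharpShv C k (ranFiber E.obj) := by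
  have := tensorLeft_op (C := C)
  have := tensorRight_op (C := C)
  intro m M v
  exact isLinearLex_of_bijective (fun f : m ⟶ n => slot M v ⋙ push f ⋙ E.obj)
    (fun f => Functor.whiskerLeft (slot M v) (ranProj E.obj f))
    (fun X x x' h => ranProj_injective E.obj _ x x' h)
    (fun X y => ranProj_surjective E.obj _ y)
    (fun f => shvProp_push k f E.property M v)

/-- The right adjoint of the functor `E ↦ E([n])`. -/
noncomputable def coind (n : CyclicCat) : Shv C k n ⥤ ShvSharp C k :=
  ObjectProperty.lift _ ((shvProp k n.V).ι ⋙ (Cyc.fiber n).ran) fun E => sharpShv_ranFiber C k E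

variable {C k} in
/-- The functor `E ↦ E([n])` is left adjoint to `coind`. -/
noncomputable def componentAdj (n : CyclicCat) : component (C := C) (k := k) n ⊣ coind C k n :=
  ((Cyc.fiber n).ranAdjunction (ModuleCat.{u} k)).restrictFullyFaithful
    (iC := (sharpShv C k).ι) (iD := (shvProp (D := Cᵒᵖ) k n.V).ι)
    (ObjectProperty.fullyFaithfulι _) (ObjectProperty.fullyFaithfulι _)
    (comm1 := Iso.refl _) (comm2 := Iso.refl _)

instance component_isRightAdjoint (n : CyclicCat) : (component (C := C) (k := k) n).IsRightAdjoint := by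
  have := sharpShv_isRightAdjoint_ι C k
  have adj := ((Cyc.fiber (C := Cᵒᵖ) n).lanAdjunction (ModuleCat.{u} k)).comp
    (Adjunction.ofIsRightAdjoint (sharpShv C k).ι)
  exact (adj.restrictFullyFaithful (iC := (shvProp (D := Cᵒᵖ) k n.V).ι) (iD := 𝟭 _)
    (ObjectProperty.fullyFaithfulι _) (Functor.FullyFaithful.id _)
    (comm1 := (Functor.rightUnitor ((shvProp (D := Cᵒᵖ) k n.V).ι ⋙ (Cyc.fiber n).lan ⋙
      (sharpShv C k).ι.leftAdjoint)).symm)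
    (comm2 := Iso.refl _) : _ ⊣ component (C := C) (k := k) n).isRightAdjoint

instance (n : CyclicCat) : (component (C := C) (k := k) n).IsLeftAdjoint :=
  (componentAdj n).isLeftAdjoint

instance (n : CyclicCat) : (component (C := C) (k := k) n).Additive where
  map_add := rfl

end Coinduction
end CyclicHH

namespace CyclicHH

variable {C : Type u} [SmallCategory C] [Abelian C] {k : Type u} [Field k] [Linear k C]
  [MonoidalCategory C] [MonoidalPreadditive C] [MonoidalLinear k C]
  [∀ X : C, PreservesFiniteColimits (tensorLeft X)]
  [∀ X : C, PreservesFiniteColimits (tensorRight X)]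

/-- The adjunction between direct image and restriction. -/
noncomputable def directImageAdj {m n : CyclicCat} (f : m ⟶ n) :
    directImage (C := C) k f ⊣ restr k f := Adjunction.ofIsRightAdjoint (restr k f)

theorem transitionAdj_eq (E : ShvSharp C k) {m n : CyclicCat} (f : m ⟶ n) :
    transitionAdj E f = ((directImageAdj f).homEquiv _ _).symm (transition E f) := rfl

theorem transition_naturality {E E' : ShvSharp C k} (g : E ⟶ E') {m n : CyclicCat} (f : m ⟶ n) :
    transition E f ≫ (restr k f).map ((component n).map g) =
      (component m).map g ≫ transition E' f := by
  ext M : 3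
  exact g.hom.naturality (Cyc.lift f M)

theorem pushComp_natural {D : Type u} [SmallCategory D] [MonoidalCategory D] {m n p : CyclicCat}
    (f : m ⟶ n) (g : n ⟶ p) {M N : m.V → D} (a : M ⟶ N) :
    (push (f ≫ g)).map a ≫ (pushComp f g N).hom =
      (pushComp f g M).hom ≫ (push g).map ((push f).map a) :=
  funext fun w => tensFlat_natural a f.fib (g.fib w)

/-- The isomorphism between `(g ∘ f)_!` and `g_! ∘ f_!`. -/
def pushCompIso {D : Type u} [SmallCategory D] [MonoidalCategory D] {m n p : CyclicCat}
    (f : m ⟶ n) (g : n ⟶ p) : push (C := D) (f ≫ g) ≅ push f ⋙ push g :=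
  NatIso.ofComponents (fun N => pushComp f g N) (fun a => pushComp_natural f g a)

/-- Restriction is functorial. -/
noncomputable def restrComp {m n p : CyclicCat} (f : m ⟶ n) (g : n ⟶ p) :
    restr (C := C) k (f ≫ g) ≅ restr k g ⋙ restr k f :=
  NatIso.ofComponents (fun E => ObjectProperty.isoMk _
    (Functor.isoWhiskerRight (pushCompIso (D := Cᵒᵖ) f g) E.obj))
    (fun {E E'} a => by
      ext N : 3
      exact (a.hom.naturality (pushComp f g N).hom).symm)

/-- Direct image is functorial. -/
noncomputable def directImageComp {m n p : CyclicCat} (f : m ⟶ n) (g : n ⟶ p) :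
    directImage (C := C) k f ⋙ directImage k g ≅ directImage k (f ≫ g) :=
  (conjugateIsoEquiv (directImageAdj (f ≫ g)) ((directImageAdj f).comp (directImageAdj g))).symm
    (restrComp f g)

section Exactness

variable {A : Type*} [Category* A] [Abelian A]

theorem IsExactFor.of_iso {𝒵 : ObjectProperty (CochainComplex A ℤ)} {E E' : A}
    (h : IsExactFor 𝒵 E) (e : E ≅ E') : IsExactFor 𝒵 E' := by
  intro Z hZ q φ hφ
  obtain ⟨t, ht⟩ := h hZ q (e.hom ≫ φ) (by rw [Category.assoc, hφ, comp_zero])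
  exact ⟨e.inv ≫ t, by rw [Category.assoc, ht, Iso.inv_hom_id_assoc]⟩

theorem IsExactFor.of_jointly_bijective {𝒵 : ObjectProperty (CochainComplex A ℤ)} {ι : Type*}
    {E : ι → A} {E' : A} (j : ∀ i, E i ⟶ E') (h : ∀ i, IsExactFor 𝒵 (E i))
    (hinj : ∀ {X : A} (a b : E' ⟶ X), (∀ i, j i ≫ a = j i ≫ b) → a = b)
    (hsurj : ∀ {X : A} (a : ∀ i, E i ⟶ X), ∃ b : E' ⟶ X, ∀ i, j i ≫ b = a i) :
    IsExactFor 𝒵 E' := by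
  intro Z hZ q φ hφ
  have h1 := fun i => h i hZ q (j i ≫ φ) (by rw [Category.assoc, hφ, comp_zero])
  choose t ht using h1
  obtain ⟨b, hb⟩ := hsurj t
  exact ⟨b, hinj _ _ fun i => by rw [← Category.assoc, hb, ht]⟩

end Exactness

section Induction

/-- The left adjoint of the functor `E ↦ E([n])`. -/
noncomputable def ind (n : CyclicCat) : Shv C k n ⥤ ShvSharp C k := (component n).leftAdjoint

/-- The left adjoint of the functor `E ↦ E([n])`. -/
noncomputable def indAdj (n : CyclicCat) : ind (C := C) (k := k) n ⊣ component n :=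
  Adjunction.ofIsRightAdjoint _

/-- The projection from the components of a coinduced object. -/
noncomputable def coindProj {m n : CyclicCat} (f : m ⟶ n) (F : Shv C k n) :
    (component m).obj ((coind C k n).obj F) ⟶ (restr k f).obj F :=
  transition ((coind C k n).obj F) f ≫ (restr k f).map ((componentAdj n).counit.app F)

theorem componentAdj_counit_hom (n : CyclicCat) (F : Shv C k n) :
    ((componentAdj n).counit.app F).hom = (Cyc.fiber n).ranCounit.app F.obj := by
  have h : ((componentAdj n).counit.app F).hom =
      ((Cyc.fiber n).ranAdjunction (ModuleCat.{u} k)).counit.app F.obj := by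
    simp [componentAdj]
    rfl
  rw [h, Functor.ranAdjunction_counit]

theorem coindProj_hom {m n : CyclicCat} (f : m ⟶ n) (F : Shv C k n) :
    (coindProj f F).hom = ranProj F.obj f := by
  have h := componentAdj_counit_hom n F
  exact congrArg (fun t => liftTrans (ranFiber F.obj) f ≫ Functor.whiskerLeft (push f) t) h

theorem coindProj_injective {m n : CyclicCat} {E : Shv C k m} {F : Shv C k n}
    (a b : E ⟶ (component m).obj ((coind C k n).obj F))
    (h : ∀ f : m ⟶ n, a ≫ coindProj f F = b ≫ coindProj f F) : a = b := by
  ext M e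
  refine ranProj_injective F.obj M _ _ fun f => ?_
  have h1 := congrArg (fun t => (t.hom.app M).hom e) (h f)
  rw [← coindProj_hom]
  exact h1

theorem coindProj_surjective {m n : CyclicCat} {E : Shv C k m} {F : Shv C k n}
    (a : ∀ f : m ⟶ n, E ⟶ (restr k f).obj F) :
    ∃ b : E ⟶ (component m).obj ((coind C k n).obj F), ∀ f, b ≫ coindProj f F = a f := by
  have h1 := fun M (e : E.obj.obj M) => ranProj_surjective F.obj M fun f => ((a f).hom.app M).hom e
  choose b hb using h1
  let β : E.obj ⟶ Cyc.fiber m ⋙ ranFiber F.obj :=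
    { app := fun M => ModuleCat.ofHom
        { toFun := b M
          map_add' := fun e e' => ranProj_injective F.obj M _ _ fun f => by
            rw [hb, map_add, map_add]
            exact congrArg₂ (· + ·) (hb M e f).symm (hb M e' f).symm
          map_smul' := fun r e => ranProj_injective F.obj M _ _ fun f => by
            rw [hb, map_smul]
            refine Eq.trans ?_ (map_smul ((ranProj F.obj f).app M).hom r _).symm
            exact congrArg (r • ·) (hb M e f).symm }
      naturality := fun M N g => by
        ext e
        refine ranProj_injective F.obj N _ _ fun f => ?_
        refine (hb N _ f).trans ?_
        have h2 := congrArg (fun t => t.hom e) ((a f).hom.naturality g)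
        have h3 := congrArg (fun t => t.hom (b M e)) ((ranProj F.obj f).naturality g)
        refine h2.trans (Eq.trans ?_ h3.symm)
        exact congrArg ((push f ⋙ F.obj).map g).hom (hb M e f).symm }
  refine ⟨ObjectProperty.homMk β, fun f => ?_⟩
  ext M e
  have h2 := hb M e f
  rw [← coindProj_hom] at h2
  exact h2

/-- The inclusions of the direct images into the components of an induced object. -/
noncomputable def indIncl {m n : CyclicCat} (f : m ⟶ n) (E : Shv C k m) :
    (directImage k f).obj E ⟶ (component n).obj ((ind m).obj E) :=
  ((directImageAdj f).homEquiv _ _).symm ((indAdj m).unit.app E ≫ transition _ f)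

theorem indIncl_comp {m n : CyclicCat} (f : m ⟶ n) (E : Shv C k m) {F : Shv C k n}
    (ψ : (ind m).obj E ⟶ (coind C k n).obj F) :
    indIncl f E ≫ ((componentAdj n).homEquiv _ _).symm ψ =
      ((directImageAdj f).homEquiv _ _).symm ((indAdj m).homEquiv _ _ ψ ≫ coindProj f F) := by
  unfold indIncl coindProj
  rw [← Adjunction.homEquiv_naturality_right_symm]
  congr 1
  rw [Adjunction.homEquiv_counit, Functor.map_comp, Category.assoc, Adjunction.homEquiv_unit,
    Category.assoc]
  congr 1
  have h := transition_naturality ψ f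
  exact (reassoc_of% h) _

theorem isExactFor_component_ind
    {m n : CyclicCat} (E : Shv C k m) {𝒵 : ObjectProperty (CochainComplex (Shv C k n) ℤ)}
    (h : ∀ f : m ⟶ n, IsExactFor 𝒵 ((directImage k f).obj E)) :
    IsExactFor 𝒵 ((component n).obj ((ind m).obj E)) := by
  refine IsExactFor.of_jointly_bijective (fun f : m ⟶ n => indIncl f E) h (fun {F} a b hab => ?_)
    (fun {F} a => ?_)
  · obtain ⟨a, rfl⟩ := ((componentAdj n).homEquiv _ _).symm.surjective a
    obtain ⟨b, rfl⟩ := ((componentAdj n).homEquiv _ _).symm.surjective b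
    congr 1
    refine ((indAdj m).homEquiv _ _).injective (coindProj_injective _ _ fun f => ?_)
    have := hab f
    rw [indIncl_comp, indIncl_comp] at this
    exact ((directImageAdj f).homEquiv _ _).symm.injective this
  · obtain ⟨b, hb⟩ := coindProj_surjective fun f : m ⟶ n => (directImageAdj f).homEquiv _ _ (a f)
    refine ⟨((componentAdj n).homEquiv _ _).symm (((indAdj m).homEquiv _ _).symm b), fun f => ?_⟩
    rw [indIncl_comp, Equiv.apply_symm_apply, hb, Equiv.symm_apply_apply]

end Induction

namespace TraceFunctor

variable (T : TraceFunctor C k)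

/-- The trace functor is invariant under direct images. -/
noncomputable def trDirectImage {m n : CyclicCat} (f : m ⟶ n) :
    T.tr m ≅ directImage k f ⋙ T.tr n :=
  (conjugateIsoEquiv ((directImageAdj f).comp (T.trAdj n)) (T.trAdj m)).symm (T.trRightIso f)

theorem trAdj_unit_app (n : CyclicCat) (E : Shv C k n) : (T.trAdj n).unit.app E =
    ObjectProperty.homMk (coten.curry (T.onFam n) (𝟙 _)) :=
  ((T.trAdj n).homEquiv_id E).symm.trans (T.trAdj_homEquiv n E _ (𝟙 _))

theorem homEquiv_trDirectImage {m n : CyclicCat} (f : m ⟶ n) (E : Shv C k m) (F : Shv C k n)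
    (t : (directImage k f).obj E ⟶ F) :
    (T.trAdj m).homEquiv E ((T.tr n).obj F)
      ((T.trDirectImage f).hom.app E ≫ (T.tr n).map t) =
      (directImageAdj f).homEquiv E F t ≫ (restr k f).map ((T.trAdj n).unit.app F) ≫
        (T.trRightIso f).hom.app ((T.tr n).obj F) := by
  have h1 : ((directImageAdj f).comp (T.trAdj n)).unit.app E ≫ (T.trRightIso f).hom.app _ =
      (T.trAdj m).unit.app E ≫ (T.trRight m).map ((T.trDirectImage f).hom.app E) :=
    unit_conjugateEquiv_symm ((directImageAdj f).comp (T.trAdj n)) (T.trAdj m)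
      (T.trRightIso f).hom E
  have h2 : ((directImageAdj f).comp (T.trAdj n)).unit.app E =
      (directImageAdj f).unit.app E ≫
        (restr k f).map ((T.trAdj n).unit.app ((directImage k f).obj E)) :=
    Adjunction.comp_unit_app ..
  have h3 : (restr k f).map ((T.trAdj n).unit.app ((directImage k f).obj E)) ≫
      (restr k f).map ((T.trRight n).map ((T.tr n).map t)) =
      (restr k f).map t ≫ (restr k f).map ((T.trAdj n).unit.app F) := by
    rw [← Functor.map_comp, ← Functor.map_comp]
    exact congrArg (restr k f).map ((T.trAdj n).unit.naturality t).symm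
  have h4 : (restr k f).map ((T.trRight n).map ((T.tr n).map t)) ≫
      (T.trRightIso f).hom.app ((T.tr n).obj F) =
      (T.trRightIso f).hom.app _ ≫ (T.trRight m).map ((T.tr n).map t) :=
    (T.trRightIso f).hom.naturality ((T.tr n).map t)
  rw [Adjunction.homEquiv_naturality_right, Adjunction.homEquiv_unit, Adjunction.homEquiv_unit,
    ← h1, h2, Category.assoc, Category.assoc]
  change _ ≫ _ ≫ (T.trRightIso f).hom.app ((T.tr n).obj ((directImage k f).obj E)) ≫ _ = _
  rw [← h4, reassoc_of% h3, Category.assoc]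

theorem trSharp_map (E : ShvSharp C k) {m n : CyclicCat} (f : m ⟶ n) :
    (T.trSharp.obj E).map f = (T.trDirectImage f).hom.app ((component m).obj E) ≫
      (T.tr n).map (transitionAdj E f) := by
  have h1 := T.homEquiv_trDirectImage f ((component m).obj E) ((component n).obj E)
    (transitionAdj E f)
  rw [transitionAdj_eq, Equiv.apply_symm_apply] at h1
  rw [transitionAdj_eq]
  refine Equiv.injective ((T.trAdj m).homEquiv ((component m).obj E)
    ((T.tr n).obj ((component n).obj E))) (Eq.trans ?_ h1.symm)
  refine (T.trAdj_homEquiv m ((component m).obj E) ((T.tr n).obj ((component n).obj E))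
    ((T.trSharp.obj E).map f)).trans ?_
  rw [T.trAdj_unit_app]
  refine ObjectProperty.hom_ext _ (NatTrans.ext (funext fun M => ModuleCat.hom_ext
    (LinearMap.ext fun e => ModuleCat.hom_ext (LinearMap.ext fun a => ?_))))
  have h2 := coten.ι_map (A := T.onFam m) (A' := T.onFam n) (push f) (T.onFamIso f).hom
    (liftTrans E.obj f) M
  exact congrArg (fun t : (T.onFam m).obj (op M) ⊗ (Cyc.fiber m ⋙ E.obj).obj M ⟶ _ =>
    t.hom (a ⊗ₜ[k] e)) h2

end TraceFunctor
end CyclicHH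

namespace CyclicHH

section Degeneracy

/-- The object `[n + 1]`. -/
def CyclicCat.succ (n : CyclicCat) : CyclicCat := ⟨n.card + 1, n.card.succ_pos⟩

/-- The vertex `0` of `[n + 1]`. -/
abbrev CyclicCat.origin (n : CyclicCat) : n.succ.V := (0 : Fin (n.card + 1))

/-- The other vertices of `[n + 1]`. -/
abbrev CyclicCat.next {n : CyclicCat} (i : n.V) : n.succ.V := (Fin.succ i : Fin (n.card + 1))

theorem CyclicCat.next_ne {n : CyclicCat} (i : n.V) : CyclicCat.next i ≠ n.origin := Fin.succ_ne_zero i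

/-- Case distinction for the vertices of `[n + 1]`. -/
@[elab_as_elim]
def CyclicCat.succCases {n : CyclicCat} {motive : n.succ.V → Sort*} (h0 : motive n.origin)
    (h1 : ∀ i : n.V, motive (CyclicCat.next i)) (w : n.succ.V) : motive w := Fin.cases h0 h1 w

/-- The map `[n] ⟶ [n + 1]` which leaves out the vertex `0`. -/
def CyclicCat.skip (n : CyclicCat) : n ⟶ n.succ :=
  (⟨CyclicCat.succCases [] (fun i => [i]), by
    change (List.finRange (n.card + 1)).flatMap (Fin.cases [] (fun i => [i])) ~r _
    rw [List.finRange_succ, List.flatMap_cons, List.flatMap_map]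
    change List.flatMap (fun i => [i]) _ ~r _
    rw [List.flatMap_singleton']⟩ : CyclicCat.Hom n n.succ)

variable {D : Type u} [SmallCategory D] [MonoidalCategory D]

/-- The family without its component at the vertex `0`. -/
def famTail (n : CyclicCat) : (n.succ.V → D) ⥤ (n.V → D) :=
  Pi.comap (fun _ => D) (CyclicCat.next : n.V → n.succ.V)

variable {n : CyclicCat}

/-- The family which is obtained by a shift and adding the unit object, compared to the original
family. -/
def tailPush (M : n.V → D) : M ≅ (famTail n).obj ((push n.skip).obj M) :=
  Pi.isoMk fun i => (tensOne M i).symm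

/-- The map to a family from a map from the unit object to its component at `0`. -/
def pushTail (N : n.succ.V → D) (h : 𝟙_ D ⟶ N n.origin) :
    (push n.skip).obj ((famTail n).obj N) ⟶ N :=
  CyclicCat.succCases (motive := fun w => tens ((famTail n).obj N) (n.skip.fib w) ⟶ N w) h
    (fun i => (tensOne ((famTail n).obj N) i).hom)

omit [MonoidalCategory D] in
theorem fam_hom_ext {M N : n.succ.V → D} {a b : M ⟶ N}
    (h0 : a n.origin = b n.origin)
    (h1 : ∀ i : n.V, a (CyclicCat.next i) = b (CyclicCat.next i)) :
    a = b :=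
  funext fun w => CyclicCat.succCases (motive := fun w => a w = b w) h0 h1 w

theorem pushTail_comp {N N' : n.succ.V → D} (h : 𝟙_ D ⟶ N n.origin) (g : N ⟶ N') :
    pushTail N h ≫ g = (push n.skip).map ((famTail n).map g) ≫
      pushTail N' (h ≫ g n.origin) :=
  fam_hom_ext (Category.id_comp _).symm
    fun i => (tensOne_naturality ((famTail n).map g) i).symm

theorem tailPush_pushTail (N : n.succ.V → D) (h : 𝟙_ D ⟶ N n.origin) :
    (tailPush ((famTail n).obj N)).hom ≫ (famTail n).map (pushTail N h) = 𝟙 _ :=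
  funext fun i => (tensOne ((famTail n).obj N) i).inv_hom_id

theorem push_tailPush_comp (M : n.V → D) :
    (push n.skip).map (tailPush M).hom ≫ pushTail ((push n.skip).obj M) (𝟙 (𝟙_ D)) = 𝟙 _ :=
  fam_hom_ext (Category.id_comp _) fun i => by
    refine (tensOne_naturality (tailPush M).hom i).trans ?_
    exact (tensOne M i).hom_inv_id

/-- The part of `pushTail` which does not depend on the map from the unit object. -/
def pushTailSlot (N : n.succ.V → D) : (push n.skip).obj ((famTail n).obj N) ⟶
    (slot N n.origin).obj (𝟙_ D) :=
  CyclicCat.succCases (motive := fun w => tens ((famTail n).obj N) (n.skip.fib w) ⟶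
      (slot N n.origin).obj (𝟙_ D) w)
    (slotSameApp N n.origin _).inv
    (fun i => (tensOne ((famTail n).obj N) i).hom ≫ (slotNeApp N (CyclicCat.next_ne i) _).inv)

theorem pushTail_eq (N : n.succ.V → D) (h : 𝟙_ D ⟶ N n.origin) :
    pushTail N h = pushTailSlot N ≫ (slot N n.origin).map h ≫ slotSelf N _ := by
  unfold slotSelf
  rw [slot_map_slotDesc]
  refine fam_hom_ext ?_ fun i => ?_
  · change h = (slotSameApp N n.origin _).inv ≫ slotDesc N _ _ _ n.origin
    rw [slotDesc_same, Iso.inv_hom_id_assoc, Category.comp_id]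
  · change (tensOne ((famTail n).obj N) i).hom = ((tensOne ((famTail n).obj N) i).hom ≫
      (slotNeApp N (CyclicCat.next_ne i) _).inv) ≫ slotDesc N _ _ _ (CyclicCat.next i)
    rw [slotDesc_ne _ (CyclicCat.next_ne i)]
    refine Eq.symm ((Category.assoc _ _ _).trans ?_)
    refine Eq.trans (congrArg _ (Iso.inv_hom_id_assoc _ _)) (Category.comp_id _)

variable (k : Type u) [Field k] [Preadditive D] [Linear k D]

variable (D n) in
/-- The functor of maps from the unit object to the component at `0`. -/
def unitHom : (n.succ.V → D) ⥤ ModuleCat.{u} k :=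
  Pi.eval _ n.origin ⋙ (linearCoyoneda k D).obj (op (𝟙_ D))

variable (n) in
/-- The functor `E ↦ E(N₁, …, Nₙ) ⊗ Hom(𝟙, N₀)`. -/
def skipFun : ((n.V → D) ⥤ ModuleCat.{u} k) ⥤ ((n.succ.V → D) ⥤ ModuleCat.{u} k) :=
  (Functor.whiskeringLeft _ _ _).obj (famTail n) ⋙ tensorRight (unitHom D n k)

end Degeneracy

section Skip

variable {D : Type u} [SmallCategory D] [MonoidalCategory D] [Abelian D] {k : Type u} [Field k]
  [Linear k D] {n : CyclicCat}

omit [MonoidalCategory D] in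
theorem isLinearLex_tensorLeft (V : ModuleCat.{u} k) {F : D ⥤ ModuleCat.{u} k}
    (hF : IsLinearLex k F) : IsLinearLex k (F ⋙ tensorLeft V) := by
  have := hF.additive
  have := hF.linear
  have := hF.lex
  exact ⟨inferInstance, inferInstance, comp_preservesFiniteLimits _ _⟩

omit [MonoidalCategory D] in
theorem isLinearLex_tensorRight (V : ModuleCat.{u} k) {F : D ⥤ ModuleCat.{u} k}
    (hF : IsLinearLex k F) : IsLinearLex k (F ⋙ tensorRight V) := by
  have := hF.additive
  have := hF.linear
  have := hF.lex
  exact ⟨inferInstance, inferInstance, comp_preservesFiniteLimits _ _⟩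

omit [MonoidalCategory D] in
theorem isLinearLex_linearCoyoneda (X : Dᵒᵖ) : IsLinearLex k ((linearCoyoneda k D).obj X) := by
  have h5 : PreservesLimits ((linearCoyoneda k D).obj X ⋙ forget _) :=
    inferInstanceAs (PreservesLimits (coyoneda.obj X))
  have h6 : PreservesLimitsOfSize.{0,0} ((linearCoyoneda k D).obj X ⋙ forget _) :=
    preservesLimitsOfSize_shrink.{0, u, 0, u} _
  have h7 : PreservesLimitsOfSize.{0,0} ((linearCoyoneda k D).obj X) :=
    ⟨fun {J _} => ⟨fun {K} => preservesLimit_of_reflects_of_preserves _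
      (forget (ModuleCat.{u} k))⟩⟩
  refine ⟨inferInstance, ⟨fun {Y Z} f r => ?_⟩, inferInstance⟩
  ext t
  exact Linear.comp_smul (R := k) _ _ _ _ _ _

theorem shvProp_skipFun {E : (n.V → D) ⥤ ModuleCat.{u} k} (hE : shvProp k n.V E) :
    shvProp k n.succ.V ((skipFun n k).obj E) := by
  intro M v
  induction v using CyclicCat.succCases with
  | h0 =>
    let e1 : slot M n.origin ⋙ famTail n ≅ (Functor.const D).obj ((famTail n).obj M) :=
      NatIso.pi' fun i => slotNe M (CyclicCat.next_ne i)
    let e2 : slot M n.origin ⋙ unitHom D n k ≅ (linearCoyoneda k D).obj (op (𝟙_ D)) :=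
      Functor.isoWhiskerRight (slotSame M n.origin) ((linearCoyoneda k D).obj (op (𝟙_ D)))
    let e : slot M n.origin ⋙ (skipFun n k).obj E ≅
        (linearCoyoneda k D).obj (op (𝟙_ D)) ⋙ tensorLeft (E.obj ((famTail n).obj M)) :=
      (Functor.isoWhiskerRight e1 E ⊗ᵢ e2 :) ≪≫
        NatIso.ofComponents (fun _ => Iso.refl _) (fun f => by
          refine (Category.comp_id _).trans (Eq.trans ?_ (Category.id_comp _).symm)
          refine Eq.trans ?_ (id_tensorHom _ _)
          exact congrArg (· ⊗ₘ _) (E.map_id _))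
    exact IsLinearLex.of_iso k (isLinearLex_tensorLeft _ (isLinearLex_linearCoyoneda _)) e.symm
  | h1 i =>
    let e1 : slot M (CyclicCat.next i) ⋙ famTail n ≅ slot ((famTail n).obj M) i :=
      NatIso.pi' fun j => if h : j = i then by
          subst h
          exact slotSame M (CyclicCat.next j) ≪≫ (slotSame ((famTail n).obj M) j).symm
        else slotNe M (fun h' => h (Fin.succ_injective _ h')) ≪≫
          (slotNe ((famTail n).obj M) h).symm
    let e2 : slot M (CyclicCat.next i) ⋙ unitHom D n k ≅
        (Functor.const D).obj (M n.origin) ⋙ (linearCoyoneda k D).obj (op (𝟙_ D)) :=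
      Functor.isoWhiskerRight (slotNe M (CyclicCat.next_ne i).symm)
        ((linearCoyoneda k D).obj (op (𝟙_ D)))
    let e : slot M (CyclicCat.next i) ⋙ (skipFun n k).obj E ≅
        (slot ((famTail n).obj M) i ⋙ E) ⋙
          tensorRight (((linearCoyoneda k D).obj (op (𝟙_ D))).obj (M n.origin)) :=
      (Functor.isoWhiskerRight e1 E ⊗ᵢ e2 :) ≪≫
        NatIso.ofComponents (fun _ => Iso.refl _) (fun f => by
          refine (Category.comp_id _).trans (Eq.trans ?_ (Category.id_comp _).symm)
          refine Eq.trans ?_ (tensorHom_id _ _)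
          exact congrArg (_ ⊗ₘ ·) (((linearCoyoneda k D).obj (op (𝟙_ D))).map_id _))
    exact IsLinearLex.of_iso k (isLinearLex_tensorRight _ (hE _ i)) e.symm

theorem map_pushTail_add {F : (n.succ.V → D) ⥤ ModuleCat.{u} k} (hF : shvProp k n.succ.V F)
    (N : n.succ.V → D) (h h' : 𝟙_ D ⟶ N n.origin) :
    F.map (pushTail N (h + h')) = F.map (pushTail N h) + F.map (pushTail N h') := by
  have h1 : F.map ((slot N n.origin).map (h + h')) = F.map ((slot N n.origin).map h) +
    F.map ((slot N n.origin).map h') := (hF N n.origin).additive.map_add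
  rw [pushTail_eq, pushTail_eq, pushTail_eq, Functor.map_comp, Functor.map_comp, h1,
    Functor.map_comp, Functor.map_comp, Functor.map_comp, Functor.map_comp,
    Preadditive.add_comp, Preadditive.comp_add]

theorem map_pushTail_smul {F : (n.succ.V → D) ⥤ ModuleCat.{u} k} (hF : shvProp k n.succ.V F)
    (N : n.succ.V → D) (r : k) (h : 𝟙_ D ⟶ N n.origin) :
    F.map (pushTail N (r • h)) = r • F.map (pushTail N h) := by
  have h1 : F.map ((slot N n.origin).map (r • h)) = r • F.map ((slot N n.origin).map h) :=
    (hF N n.origin).linear.map_smul h r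
  rw [pushTail_eq, pushTail_eq, Functor.map_comp, Functor.map_comp, h1,
    Functor.map_comp, Functor.map_comp, Linear.smul_comp, Linear.comp_smul]

/-- A map out of `skipFun`. -/
noncomputable def skipDesc {E : (n.V → D) ⥤ ModuleCat.{u} k} {F : (n.succ.V → D) ⥤ ModuleCat.{u} k}
    (hF : shvProp k n.succ.V F) (β : E ⟶ push n.skip ⋙ F) : (skipFun n k).obj E ⟶ F where
  app N := ModuleCat.ofHom (TensorProduct.lift (LinearMap.mk₂ k
      (fun (e : E.obj ((famTail n).obj N)) (h : 𝟙_ D ⟶ N n.origin) =>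
        (F.map (pushTail N h)).hom ((β.app _).hom e))
      (fun e e' h => by rw [map_add, map_add])
      (fun r e h => by rw [map_smul, map_smul])
      (fun e h h' => congrArg (fun t => t.hom ((β.app _).hom e)) (map_pushTail_add hF N h h'))
      (fun r e h => congrArg (fun t => t.hom ((β.app _).hom e)) (map_pushTail_smul hF N r h))))
  naturality N N' g := by
    refine ModuleCat.hom_ext (TensorProduct.ext' fun e h => ?_)
    have h1 := congrArg F.map (pushTail_comp h g)
    rw [Functor.map_comp, Functor.map_comp] at h1
    have h2 := congrArg (fun t => t.hom e) (β.naturality ((famTail n).map g))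
    have h3 := congrArg (fun t => t.hom ((β.app _).hom e)) h1
    exact (congrArg (F.map (pushTail N' (h ≫ g n.origin))).hom h2).trans h3.symm

theorem skipDesc_apply {E : (n.V → D) ⥤ ModuleCat.{u} k} {F : (n.succ.V → D) ⥤ ModuleCat.{u} k}
    (hF : shvProp k n.succ.V F) (β : E ⟶ push n.skip ⋙ F) {N : n.succ.V → D}
    (e : E.obj ((famTail n).obj N)) (h : 𝟙_ D ⟶ N n.origin) :
    ((skipDesc hF β).app N).hom (e ⊗ₜ[k] h) = (F.map (pushTail N h)).hom ((β.app _).hom e) := rfl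

theorem skipFun_map_apply (E : (n.V → D) ⥤ ModuleCat.{u} k) {N N' : n.succ.V → D} (g : N ⟶ N')
    (e : E.obj ((famTail n).obj N)) (h : 𝟙_ D ⟶ N n.origin) :
    (((skipFun n k).obj E).map g).hom (e ⊗ₜ[k] h) =
      (E.map ((famTail n).map g)).hom e ⊗ₜ[k] (show 𝟙_ D ⟶ N' n.origin from h ≫ g n.origin) := rfl

omit [Abelian D] in
theorem tailPush_natural {M M' : n.V → D} (g : M ⟶ M') :
    g ≫ (tailPush M').hom = (tailPush M).hom ≫ (famTail n).map ((push n.skip).map g) :=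
  funext fun i => by
    change g i ≫ (tensOne M' i).inv = (tensOne M i).inv ≫ tensMap g [i]
    rw [Iso.eq_inv_comp, ← Category.assoc, ← tensOne_naturality, Category.assoc, Iso.hom_inv_id,
      Category.comp_id]

/-- The universal map to `skipFun`. -/
noncomputable def skipUnit (E : (n.V → D) ⥤ ModuleCat.{u} k) : E ⟶ push n.skip ⋙ (skipFun n k).obj E where
  app M := ModuleCat.ofHom ((TensorProduct.mk k _ (𝟙_ D ⟶ 𝟙_ D)).flip (𝟙 (𝟙_ D)) ∘ₗ
    (E.map (tailPush M).hom).hom)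
  naturality M M' g := by
    ext e
    have h1 := congrArg E.map (tailPush_natural g)
    rw [Functor.map_comp, Functor.map_comp] at h1
    have h2 : (E.map (tailPush M').hom).hom ((E.map g).hom e) =
      (E.map ((famTail n).map ((push n.skip).map g))).hom ((E.map (tailPush M).hom).hom e) :=
      congrArg (fun t => t.hom e) h1
    refine (congrArg (· ⊗ₜ[k] (𝟙 (𝟙_ D))) h2).trans ?_
    refine Eq.trans ?_ (skipFun_map_apply E ((push n.skip).map g) _ (𝟙 (𝟙_ D))).symm
    exact congrArg (fun t : 𝟙_ D ⟶ 𝟙_ D => _ ⊗ₜ[k] t) (Category.comp_id _).symm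

/-- The universal property of `skipFun`. -/
noncomputable def skipEquiv (E : (n.V → D) ⥤ ModuleCat.{u} k) {F : (n.succ.V → D) ⥤ ModuleCat.{u} k}
    (hF : shvProp k n.succ.V F) : ((skipFun n k).obj E ⟶ F) ≃ (E ⟶ push n.skip ⋙ F) where
  toFun α := skipUnit E ≫ Functor.whiskerLeft (push n.skip) α
  invFun β := skipDesc hF β
  left_inv α := by
    refine NatTrans.ext (funext fun N => ModuleCat.hom_ext (TensorProduct.ext' fun e h => ?_))
    refine (skipDesc_apply hF _ e h).trans ?_
    have h1 := congrArg (fun t => t.hom ((E.map (tailPush ((famTail n).obj N)).hom).hom e ⊗ₜ[k]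
      (𝟙 (𝟙_ D)))) (α.naturality (pushTail N h))
    refine h1.symm.trans (congrArg (α.app N).hom ((skipFun_map_apply E _ _ _).trans ?_))
    have h2 := congrArg E.map (tailPush_pushTail N h)
    rw [Functor.map_comp, CategoryTheory.Functor.map_id] at h2
    exact congrArg₂ (fun s (t : 𝟙_ D ⟶ N n.origin) => s ⊗ₜ[k] t)
      (congrArg (fun t => t.hom e) h2) (Category.id_comp _)
  right_inv β := by
    ext M e
    refine (skipDesc_apply hF β ((E.map (tailPush M).hom).hom e) (𝟙 (𝟙_ D))).trans ?_
    have h1 := congrArg (fun t => t.hom e) (β.naturality (tailPush M).hom)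
    refine (congrArg (F.map (pushTail _ _)).hom h1).trans ?_
    have h2 := congrArg F.map (push_tailPush_comp M)
    rw [Functor.map_comp, CategoryTheory.Functor.map_id] at h2
    exact congrArg (fun t => t.hom ((β.app M).hom e)) h2

end Skip

section SkipImage

variable {C : Type u} [SmallCategory C] [Abelian C] {k : Type u} [Field k] [Linear k C]
  [MonoidalCategory C] [MonoidalPreadditive C] [MonoidalLinear k C]
  [∀ X : C, PreservesFiniteColimits (tensorLeft X)]
  [∀ X : C, PreservesFiniteColimits (tensorRight X)]

/-- The direct image for the map `[n] ⟶ [n + 1]`. -/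
noncomputable def skipImage (n : CyclicCat) : Shv C k n ⥤ Shv C k n.succ :=
  ObjectProperty.lift _ ((shvProp k n.V).ι ⋙ skipFun n k) fun E => shvProp_skipFun E.property

/-- The functor `skipImage` is left adjoint to restriction. -/
noncomputable def skipAdj (n : CyclicCat) : skipImage (C := C) (k := k) n ⊣ restr k n.skip :=
  Adjunction.mkOfHomEquiv
    { homEquiv := fun E F =>
        { toFun := fun α => ObjectProperty.homMk (skipEquiv E.obj F.property α.hom)
          invFun := fun β => ObjectProperty.homMk ((skipEquiv E.obj F.property).symm β.hom)
          left_inv := fun α => ObjectProperty.hom_ext _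
            ((skipEquiv E.obj F.property).symm_apply_apply α.hom)
          right_inv := fun β => ObjectProperty.hom_ext _
            ((skipEquiv E.obj F.property).apply_symm_apply β.hom) }
      homEquiv_naturality_left_symm := fun {E E' F} f g => by
        refine ObjectProperty.hom_ext _ (NatTrans.ext (funext fun N =>
          ModuleCat.hom_ext (TensorProduct.ext' fun e h => ?_)))
        rfl
      homEquiv_naturality_right := fun f g => rfl }

instance (n : CyclicCat) : (directImage (C := C) k n.skip).PreservesMonomorphisms := by
  let e : directImage (C := C) k n.skip ≅ skipImage n :=
    (directImageAdj n.skip).leftAdjointUniq (skipAdj n)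
  have : (skipImage (C := C) (k := k) n).PreservesMonomorphisms := ⟨fun {E E'} f hf => by
    have := shvProp_isRightAdjoint_ι C k n
    have h1 : Mono f.hom := inferInstanceAs (Mono ((shvProp (D := Cᵒᵖ) k n.V).ι.map f))
    have h2 : Mono ((shvProp k n.succ.V).ι.map ((skipImage n).map f)) := by
      have h3 : ∀ N, Mono (((skipFun n k).map f.hom).app N) := fun N =>
        inferInstanceAs (Mono ((tensorRight ((unitHom Cᵒᵖ n k).obj N)).map
          (f.hom.app ((famTail n).obj N))))
      exact NatTrans.mono_of_mono_app ((skipFun n k).map f.hom)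
    exact (shvProp k n.succ.V).ι.mono_of_mono_map h2⟩
  exact Functor.PreservesMonomorphisms.of_iso e.symm

instance {m n : CyclicCat} (f : m ⟶ n) : (restr (C := C) k f).Additive where

instance {m n : CyclicCat} (f : m ⟶ n) : (directImage (C := C) k f).Additive :=
  (directImageAdj f).left_adjoint_additive

instance (n : CyclicCat) : (directImage (C := C) k n.skip).PreservesHomology :=
  Functor.preservesHomology_of_preservesMonos_and_cokernels _

end SkipImage

end CyclicHH

namespace CyclicHH

section Adapted

variable {A B : Type*} [Category* A] [Category* B] [Abelian A] [Abelian B]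

/-- Functorial resolutions are adapted to a left adjoint functor. -/
theorem isAdapted_resolution {A : Type*} [Category.{v} A] [Abelian A] [EnoughInjectives A]
    [HasCoproducts.{v} A] [HasCoproducts.{0} A] [EnoughInjectives B]
    [HasDerivedCategory.{w₁} B] {F : A ⥤ B} {G : B ⥤ A} (adj : F ⊣ G) [F.Additive]
    {ι : Type v} (E : ι → A)
    (hE : ∀ X : A, ∀ {Y : A} (f g : X ⟶ Y), (∀ i (h : E i ⟶ X), h ≫ f = h ≫ g) → f = g)
    (hE' : ∀ i, IsExactFor (coresolutions G) (E i)) :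
    IsAdapted (HomologicalComplex.quasiIso A (.up ℤ))
      (F.mapHomologicalComplex (.up ℤ) ⋙ DerivedCategory.Q) (resolutionMap E)
      (leftPerp (coresolutions G)) where
  weq X := quasiIso_resolutionMap E hE X
  prop X := leftPerp_resolution E hE' X
  isIso_map f hf hX hY := by
    have := quasiIso_map adj f hf hX hY
    exact Localization.inverts DerivedCategory.Q (HomologicalComplex.quasiIso B (.up ℤ)) _
      (by assumption)

omit [Abelian B] in
/-- A projective object is exact for coresolutions. -/
theorem isExactFor_of_projective (G : B ⥤ A) (P : A) [Projective P] :
    IsExactFor (coresolutions G) P := by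
  intro Z hZ q φ hφ
  have h1 := (Z.exactAt_iff' (q - 1) q (q + 1) (by simp) (by simp)).1 (hZ.1 q)
  exact ⟨h1.liftFromProjective φ hφ, h1.liftFromProjective_comp φ hφ⟩

theorem hasTwoOutOfThreeProperty_qis : (qis A).HasTwoOutOfThreeProperty := by
  rw [qis_eq]; infer_instance

/-- A natural transformation with invertible components as a natural isomorphism. -/
noncomputable def natIsoOfApp {C D : Type*} [Category* C] [Category* D] {F G : C ⥤ D} (τ : F ⟶ G)
    (h : ∀ X, IsIso (τ.app X)) : F ≅ G :=
  NatIso.ofComponents (fun X => @asIso _ _ _ _ (τ.app X) (h X)) (fun f => τ.naturality f)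

namespace IsAdapted

variable {C D H : Type*} [Category* C] [Category* D] [Category* H]
  {W : MorphismProperty C} {F : C ⥤ H} {R : C ⥤ C} {p : R ⟶ 𝟭 C} {P : ObjectProperty C}
  [W.HasTwoOutOfThreeProperty]

/-- The values of a left derived functor are obtained by resolutions. -/
noncomputable def resolveIso (h : IsAdapted W F p P) {L : C ⥤ D} [L.IsLocalization W] (LF : D ⥤ H)
    (α : L ⋙ LF ⟶ F) [LF.IsLeftDerivedFunctor α W] : L ⋙ LF ≅ R ⋙ F :=
  (natIsoOfApp (Functor.whiskerRight p (L ⋙ LF)) fun X => by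
    have : IsIso (L.map (p.app X)) := Localization.inverts L W _ (h.weq X)
    exact inferInstanceAs (IsIso (LF.map (L.map (p.app X))))).symm ≪≫
  natIsoOfApp (Functor.whiskerLeft R α) fun X => h.isIso_app LF α (h.prop X)

end IsAdapted

end Adapted

section FunctorCategories

variable {J : Type} [SmallCategory J] {A : Type*} [Category* A] [Abelian A]

theorem enoughInjectives_functor [EnoughInjectives A] [HasProducts.{0} A] :
    EnoughInjectives (J ⥤ A) where
  presentation E := by
    let G : J → (J ⥤ A) := fun x => (evaluationRightAdjoint A x).obj (Injective.under (E.obj x))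
    have hG : ∀ x, Injective (G x) := fun x =>
      Injective.injective_of_adjoint (evaluationAdjunctionLeft A x) _
    let f : E ⟶ ∏ᶜ G := Pi.lift fun x =>
      (evaluationAdjunctionLeft A x).homEquiv _ _ (Injective.ι (E.obj x))
    refine ⟨⟨∏ᶜ G, inferInstance, f, ?_⟩⟩
    have h1 : ∀ x, Mono (f.app x) := fun x => by
      have h2 : f ≫ Pi.π G x = (evaluationAdjunctionLeft A x).homEquiv _ _ (Injective.ι (E.obj x)) :=
        Pi.lift_π _ _
      have h3 : ((evaluationAdjunctionLeft A x).homEquiv _ _).symm (f ≫ Pi.π G x) =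
          Injective.ι (E.obj x) := by rw [h2, Equiv.symm_apply_apply]
      rw [Adjunction.homEquiv_counit, Functor.map_comp, Category.assoc] at h3
      have h4 : f.app x ≫ ((evaluation J A).obj x).map (Pi.π G x) ≫
        (evaluationAdjunctionLeft A x).counit.app _ = Injective.ι (E.obj x) := h3
      exact mono_of_mono_fac h4
    exact NatTrans.mono_of_mono_app f

variable (k : Type u) [Field k]

/-- The functor corepresenting the evaluation at `x`. -/
noncomputable def evalObj (x : J) : J ⥤ ModuleCat.{u} k :=
  (evaluationLeftAdjoint (ModuleCat.{u} k) x).obj (ModuleCat.of k k)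

instance (x : J) : Projective (evalObj k x) :=
  have : Projective (ModuleCat.of k k) := ModuleCat.projective_of_free (Module.Basis.singleton Unit k)
  (evaluationAdjunctionRight (ModuleCat.{u} k) x).map_projective _ this

theorem evalObj_hom_ext {X Y : J ⥤ ModuleCat.{u} k} (f g : X ⟶ Y)
    (h : ∀ (x : ULift.{u} J) (t : evalObj k x.down ⟶ X), t ≫ f = t ≫ g) : f = g := by
  ext x e
  let t : ModuleCat.of k k ⟶ X.obj x := ModuleCat.ofHom (LinearMap.toSpanSingleton k _ e)
  have h1 := h ⟨x⟩ (((evaluationAdjunctionRight (ModuleCat.{u} k) x).homEquiv _ _).symm t)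
  let adj := evaluationAdjunctionRight (C := J) (ModuleCat.{u} k) x
  have h2 := congrArg (fun s : ModuleCat.of k k ⟶ Y.obj x => s.hom (1 : k)) ((adj.homEquiv _ _).symm.injective
    ((adj.homEquiv_naturality_right_symm t f).trans
      (h1.trans (adj.homEquiv_naturality_right_symm t g).symm)))
  have h3 : t.hom (1 : k) = e := one_smul k e
  have h4 : (f.app x).hom (t.hom (1 : k)) = (g.app x).hom (t.hom (1 : k)) := h2
  rwa [h3] at h4

instance injective_vect (V : ModuleCat.{u} k) : Injective V := by
  have := Module.injective_of_isSemisimpleRing k V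
  exact Module.injective_object_of_injective_module k V

end FunctorCategories

end CyclicHH

namespace CyclicHH

section Colimits

variable (k : Type u) [Field k]

instance : EnoughInjectives (DeltaOp ⥤ ModuleCat.{u} k) := enoughInjectives_functor

/-- Functorial resolutions are adapted to the colimit functor. -/
theorem isAdapted_colim [HasDerivedCategory.{w₁} (ModuleCat.{u} k)] :
    IsAdapted (HomologicalComplex.quasiIso (DeltaOp ⥤ ModuleCat.{u} k) (.up ℤ)) (colimQ k)
      (resolutionMap fun x : ULift.{u} DeltaOp => evalObj k x.down)
      (leftPerp (coresolutions (Functor.const DeltaOp (C := ModuleCat.{u} k)))) :=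
  isAdapted_resolution (colimConstAdj (J := DeltaOp) (C := ModuleCat.{u} k)) _
    (fun _ _ f g h => evalObj_hom_ext k f g h)
    (fun x => isExactFor_of_projective _ (evalObj k x.down))

/-- The initial object of `DeltaOp`. -/
abbrev deltaInit : DeltaOp := Under.mk (𝟙 CyclicCat.one)

/-- The maps from the initial object of `DeltaOp`. -/
abbrev fromInit (v : DeltaOp) : deltaInit ⟶ v := Under.homMk v.hom (Category.id_comp _)

theorem fromInit_comp {v w : DeltaOp} (a : v ⟶ w) : fromInit v ≫ a = fromInit w := by
  ext1
  exact Under.w a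

theorem fromInit_init : fromInit deltaInit = 𝟙 _ := by
  ext1
  rfl

/-- The functor of constant functors is left adjoint to the evaluation at the initial object. -/
def constAdj (A : Type*) [Category* A] :
    Functor.const DeltaOp (C := A) ⊣ (evaluation DeltaOp A).obj deltaInit where
  unit := { app := fun X => 𝟙 X }
  counit :=
    { app := fun F =>
        { app := fun v => F.map (fromInit v)
          naturality := fun v w a => by
            refine (Category.id_comp _).trans ?_
            exact (congrArg F.map (fromInit_comp a)).symm.trans (F.map_comp _ _) }
      naturality := fun F G g => by
        ext v
        exact (g.naturality (fromInit v)).symm }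
  left_triangle_components X := by
    ext v
    exact Category.id_comp _
  right_triangle_components F := by
    refine (Category.id_comp _).trans ?_
    change F.map (fromInit deltaInit) = _
    rw [fromInit_init, CategoryTheory.Functor.map_id]
    rfl

instance : (Functor.const DeltaOp (C := ModuleCat.{u} k)).Additive where

theorem leftPerp_const (V : CochainComplex (ModuleCat.{u} k) ℤ) :
    leftPerp (coresolutions (Functor.const DeltaOp (C := ModuleCat.{u} k)))
      (((Functor.const DeltaOp).mapHomologicalComplex _).obj V) := by
  rw [← leftPerp_mapClass_iff (constAdj _)]
  rintro Y ⟨Z, ⟨hZ, m, -, -, -, h0, -⟩, ⟨e⟩⟩ f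
  let W : CochainComplex (ModuleCat.{u} k) ℤ :=
    (((evaluation DeltaOp (ModuleCat.{u} k)).obj deltaInit).mapHomologicalComplex (.up ℤ)).obj Z
  have h1 : W.IsStrictlyGE m := by
    rw [CochainComplex.isStrictlyGE_iff]
    exact fun i hi => ((evaluation DeltaOp (ModuleCat.{u} k)).obj deltaInit).map_isZero (h0 i hi)
  have h2 : W.IsKInjective := CochainComplex.isKInjective_of_injective W m
  have h3 : W.Acyclic := fun i => (hZ i).map ((evaluation DeltaOp (ModuleCat.{u} k)).obj deltaInit)
  obtain ⟨h⟩ := CochainComplex.IsKInjective.nonempty_homotopy_zero (𝟙 W) h3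
  rw [← homotopy_zero_iff_of_iso f e]
  exact ⟨(Homotopy.ofEq (Category.comp_id _).symm).trans
    ((h.compLeft (f ≫ e.hom)).trans (Homotopy.ofEq comp_zero))⟩

end Colimits

variable {C : Type u} [SmallCategory C] [Abelian C] {k : Type u} [Field k] [Linear k C]
  [MonoidalCategory C] [MonoidalPreadditive C] [MonoidalLinear k C]
  [∀ X : C, PreservesFiniteColimits (tensorLeft X)]
  [∀ X : C, PreservesFiniteColimits (tensorRight X)]

instance (n : CyclicCat) : (coind C k n).Additive := (componentAdj n).right_adjoint_additive

namespace TraceFunctor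

variable (T : TraceFunctor C k)

/-- The class of complexes which detects objects adapted to `tr` and its composition with direct
images, in all components. -/
def sharpClass : ObjectProperty (CochainComplex (ShvSharp C k) ℤ) := fun Z =>
  (∃ n, mapClass (coind C k n) (coresolutions (T.trRight n)) Z) ∨
    ∃ (m n : CyclicCat) (f : m ⟶ n),
      mapClass (coind C k m) (mapClass (restr k f) (coresolutions (T.trRight n))) Z

instance : T.sharpClass.IsStableUnderShift ℤ where
  isStableUnderShiftBy a := ⟨fun Z hZ => by
    rcases hZ with ⟨n, h⟩ | ⟨m, n, f, h⟩
    · exact Or.inl ⟨n, (mapClass (coind C k n) (coresolutions (T.trRight n))).le_shift a _ h⟩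
    · exact Or.inr ⟨m, n, f, (mapClass (coind C k m) (mapClass (restr k f)
        (coresolutions (T.trRight n)))).le_shift a _ h⟩⟩

theorem leftPerp_component {X : CochainComplex (ShvSharp C k) ℤ} (hX : leftPerp T.sharpClass X)
    (n : CyclicCat) : leftPerp (coresolutions (T.trRight n))
      (((component n).mapHomologicalComplex _).obj X) := by
  rw [← leftPerp_mapClass_iff (componentAdj n)]
  exact fun Z hZ => hX (Or.inl ⟨n, hZ⟩)

theorem leftPerp_directImage {X : CochainComplex (ShvSharp C k) ℤ} (hX : leftPerp T.sharpClass X)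
    {m n : CyclicCat} (f : m ⟶ n) : leftPerp (coresolutions (T.trRight n))
      (((directImage k f).mapHomologicalComplex _).obj
        (((component m).mapHomologicalComplex _).obj X)) := by
  rw [← leftPerp_mapClass_iff (directImageAdj f), ← leftPerp_mapClass_iff (componentAdj m)]
  exact fun Z hZ => hX (Or.inr ⟨m, n, f, hZ⟩)

variable {T} (hT : T.HomologicallyClean)

namespace HomologicallyClean
include hT

/-- There are separators which satisfy the acyclicity conditions. -/
theorem exists_separator (n : CyclicCat) : ∃ E : Shv C k n,
    (∀ {X Y : Shv C k n} (f g : X ⟶ Y), (∀ h : E ⟶ X, h ≫ f = h ≫ g) → f = g) ∧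
    IsLeftAcyclic (T.tr n) E ∧
    ∀ (n' : CyclicCat) (f : n ⟶ n'), IsLeftAcyclic (T.tr n') ((directImage k f).obj E) := by
  obtain ⟨E, p, hp, -, h1, h2⟩ := hT n (separator (Shv C k n))
  refine ⟨E, fun {X Y} f g h => ?_, h1, h2⟩
  refine (isSeparator_separator (Shv C k n)).def _ _ fun t => ?_
  rw [← cancel_epi p]
  simpa using h (p ≫ t)

/-- A separator of `Shv(C^n)` with the acyclicity conditions. -/
noncomputable def gen (n : CyclicCat) : Shv C k n := (exists_separator hT n).choose

theorem gen_hom_ext (n : CyclicCat) {X Y : Shv C k n} (f g : X ⟶ Y)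
    (h : ∀ t : gen hT n ⟶ X, t ≫ f = t ≫ g) : f = g :=
  (exists_separator hT n).choose_spec.1 f g h

theorem isLeftAcyclic_gen (n : CyclicCat) : IsLeftAcyclic (T.tr n) (gen hT n) :=
  (exists_separator hT n).choose_spec.2.1

theorem isLeftAcyclic_directImage_gen {m n : CyclicCat} (f : m ⟶ n) :
    IsLeftAcyclic (T.tr n) ((directImage k f).obj (gen hT m)) :=
  (exists_separator hT m).choose_spec.2.2 n f

theorem ind_gen_hom_ext {X Y : ShvSharp C k} (f g : X ⟶ Y)
    (h : ∀ (n : ULift.{u} CyclicCat) (t : (ind n.down).obj (gen hT n.down) ⟶ X), t ≫ f = t ≫ g) :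
    f = g := by
  have h1 : ∀ n, (component n).map f = (component n).map g := fun n =>
    gen_hom_ext hT n _ _ fun t => by
      have h2 := h ⟨n⟩ (((indAdj n).homEquiv _ _).symm t)
      exact ((indAdj n).homEquiv _ _).symm.injective
        (((indAdj n).homEquiv_naturality_right_symm t f).trans
          (h2.trans ((indAdj n).homEquiv_naturality_right_symm t g).symm))
  refine ObjectProperty.hom_ext _ (NatTrans.ext (funext fun M => ?_))
  exact congrArg (fun t => t.hom.app M.fam) (h1 M.base)

theorem isExactFor_ind_gen (m : CyclicCat) : IsExactFor T.sharpClass ((ind m).obj (gen hT m)) := by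
  intro Z hZ
  rcases hZ with ⟨n, h⟩ | ⟨n, n', g, h⟩
  · exact isExactFor_mapClass (componentAdj n) (isExactFor_component_ind _ fun f =>
      isExactFor_of_isLeftAcyclic (T.trAdj n) (isLeftAcyclic_directImage_gen hT f)) h
  · exact isExactFor_mapClass (componentAdj n) (isExactFor_component_ind _ fun f =>
      isExactFor_mapClass (directImageAdj g) (IsExactFor.of_iso
        (isExactFor_of_isLeftAcyclic (T.trAdj n') (isLeftAcyclic_directImage_gen hT (f ≫ g)))
        ((directImageComp f g).app _).symm)) h

/-- Functorial resolutions are adapted to `tr`. -/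
theorem isAdapted_tr [HasDerivedCategory.{w₁} (ModuleCat.{u} k)] :
    IsAdapted (qis (Shv C k CyclicCat.one)) T.trQ
      (resolutionMap fun _ : PUnit.{u + 1} => gen hT CyclicCat.one)
      (leftPerp (coresolutions (T.trRight CyclicCat.one))) := by
  rw [qis_eq]
  exact isAdapted_resolution (T.trAdj CyclicCat.one) _
    (fun _ _ f g h => gen_hom_ext hT _ f g (h ⟨⟩))
    (fun _ => isExactFor_of_isLeftAcyclic (T.trAdj _) (isLeftAcyclic_gen hT _))

/-- Functorial resolutions in `Shv(C_#)`. -/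
noncomputable def res : CochainComplex (ShvSharp C k) ℤ ⥤ CochainComplex (ShvSharp C k) ℤ :=
  resolution fun n : ULift.{u} CyclicCat => (ind n.down).obj (gen hT n.down)

/-- The map from the resolution. -/
noncomputable def resMap : res hT ⟶ 𝟭 _ :=
  resolutionMap fun n : ULift.{u} CyclicCat => (ind n.down).obj (gen hT n.down)

theorem quasiIso_resMap (K : CochainComplex (ShvSharp C k) ℤ) : QuasiIso ((resMap hT).app K) :=
  quasiIso_resolutionMap _ (fun _ _ f g h => ind_gen_hom_ext hT f g h) K

theorem leftPerp_res (K : CochainComplex (ShvSharp C k) ℤ) :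
    leftPerp T.sharpClass ((res hT).obj K) :=
  leftPerp_resolution (𝒵 := T.sharpClass)
    (fun n : ULift.{u} CyclicCat => (ind n.down).obj (gen hT n.down))
    (fun n => isExactFor_ind_gen hT n.down) K

end HomologicallyClean

theorem quasiIso_component {X Y : CochainComplex (ShvSharp C k) ℤ} (f : X ⟶ Y) (hf : QuasiIso f)
    (n : CyclicCat) : QuasiIso (((component n).mapHomologicalComplex _).map f) := by
  infer_instance

/-- Functorial resolutions are adapted to `tr_#`. -/
theorem HomologicallyClean.isAdapted_trSharp [HasDerivedCategory.{w₂} (CyclicCat ⥤ ModuleCat.{u} k)] :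
    IsAdapted (qis (ShvSharp C k)) T.trSharpQ (resMap hT) (leftPerp T.sharpClass) := by
  rw [qis_eq]
  refine ⟨quasiIso_resMap hT, leftPerp_res hT, fun {X Y} f hf hX hY => ?_⟩
  have h1 : QuasiIso ((T.trSharp.mapHomologicalComplex (.up ℤ)).map f) := by
    rw [HomologicalComplex.quasiIso_iff_evaluation]
    intro n
    exact quasiIso_map (T.trAdj n) _ (quasiIso_component f hf n) (T.leftPerp_component hX n)
      (T.leftPerp_component hY n)
  exact Localization.inverts DerivedCategory.Q (HomologicalComplex.quasiIso _ (.up ℤ)) _ h1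

end TraceFunctor

end CyclicHH

namespace CyclicHH

section Exact

variable {A B : Type*} [Category* A] [Category* B] [Abelian A] [Abelian B]

/-- A natural transformation between exact functors is a quasi-isomorphism on a complex if it is an
isomorphism on its homology. -/
theorem quasiIso_mapHomologicalComplex {F G : A ⥤ B} [F.PreservesZeroMorphisms]
    [G.PreservesZeroMorphisms] [F.PreservesHomology] [G.PreservesHomology] (τ : F ⟶ G)
    (X : CochainComplex A ℤ) (h : ∀ i, IsIso (τ.app (X.homology i))) :
    QuasiIso ((NatTrans.mapHomologicalComplex τ (.up ℤ)).app X) := by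
  refine ⟨fun i => ?_⟩
  rw [quasiIsoAt_iff_isIso_homologyMap]
  have h1 := NatTrans.app_homology τ (X.sc i)
  have h2 : IsIso (τ.app (X.sc i).homology) := h i
  rw [h1, isIso_comp_left_iff, isIso_comp_right_iff] at h2
  exact h2

end Exact

theorem end_one_eq_id (f : CyclicCat.one ⟶ CyclicCat.one) : f = 𝟙 _ := by
  have h : f.fib (0 : Fin 1) ~r [(0 : Fin 1)] := by
    have h1 : ∀ φ : Fin 1 → List (Fin 1), [0].flatMap φ ~r [0] → φ 0 ~r [0] := fun φ h => by
      rwa [List.flatMap_singleton] at h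
    exact h1 f.fib f.cyclic
  refine CyclicCat.hom_ext (funext fun v => ?_)
  obtain rfl : v = (0 : Fin 1) := Subsingleton.elim (α := Fin 1) _ _
  exact List.isRotated_singleton_iff.1 h

/-- All vertices `[1] ⟶ [n]` are obtained from the maps `[n] ⟶ [n + 1]`. -/
theorem skip_induction (P : MorphismProperty CyclicCat) [P.HasTwoOutOfThreeProperty]
    [P.ContainsIdentities]
    (h : ∀ n : CyclicCat, P n.skip) {n : CyclicCat} (v : CyclicCat.one ⟶ n) : P v := by
  have h1 : ∀ c : ℕ, ∃ s : CyclicCat.one ⟶ ⟨c + 1, c.succ_pos⟩, P s := by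
    intro c
    induction c with
    | zero => exact ⟨𝟙 _, P.id_mem _⟩
    | succ c ih =>
      obtain ⟨s, hs⟩ := ih
      exact ⟨s ≫ CyclicCat.skip ⟨c + 1, c.succ_pos⟩, P.comp_mem _ _ hs (h _)⟩
  obtain ⟨_ | c, hc⟩ := n
  · exact absurd hc (lt_irrefl 0)
  · obtain ⟨s, hs⟩ := h1 c
    have h2 : P (TraceFunctor.toOne ⟨c + 1, hc⟩) := P.of_precomp s _ hs (by
      rw [end_one_eq_id (s ≫ _)]
      exact P.id_mem _)
    refine P.of_postcomp v _ h2 ?_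
    rw [end_one_eq_id (v ≫ _)]
    exact P.id_mem _

variable {C : Type u} [SmallCategory C] [Abelian C] {k : Type u} [Field k] [Linear k C]
  [MonoidalCategory C] [MonoidalPreadditive C] [MonoidalLinear k C]
  [∀ X : C, PreservesFiniteColimits (tensorLeft X)]
  [∀ X : C, PreservesFiniteColimits (tensorRight X)]

theorem transitionAdj_naturality {E E' : ShvSharp C k} (g : E ⟶ E') {m n : CyclicCat} (f : m ⟶ n) :
    transitionAdj E f ≫ (component n).map g =
      (directImage k f).map ((component m).map g) ≫ transitionAdj E' f := by
  rw [transitionAdj_eq, transitionAdj_eq, ← Adjunction.homEquiv_naturality_right_symm,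
    ← Adjunction.homEquiv_naturality_left_symm, transition_naturality]

/-- The transition maps in adjoint form as a natural transformation. -/
noncomputable def transitionTrans {m n : CyclicCat} (f : m ⟶ n) :
    component (C := C) (k := k) m ⋙ directImage k f ⟶ component n where
  app E := transitionAdj E f
  naturality _ _ g := (transitionAdj_naturality g f).symm

theorem isIso_transitionAdj_of_iso {E E' : ShvSharp C k} (e : E ≅ E') {m n : CyclicCat} (f : m ⟶ n)
    (h : IsIso (transitionAdj E f)) : IsIso (transitionAdj E' f) :=
  (NatTrans.isIso_app_iff_of_iso (transitionTrans f) e).1 h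

/-- The transition maps for the maps `[n] ⟶ [n + 1]` are quasi-isomorphisms if they are invertible on
homology, because the direct image functor is exact. -/
theorem quasiIso_transitionTrans_skip {X : CochainComplex (ShvSharp C k) ℤ} (n : CyclicCat)
    (hX : ∀ i, IsIso (transitionAdj (X.homology i) n.skip)) :
    QuasiIso ((NatTrans.mapHomologicalComplex (transitionTrans n.skip) (.up ℤ)).app X) := by
  have : (component (C := C) (k := k) n ⋙ directImage k n.skip).PreservesHomology := by
    have h1 := Functor.preservesFiniteLimits_of_preservesHomology (directImage (C := C) k n.skip)
    have h2 : PreservesFiniteLimits (component (C := C) (k := k) n ⋙ directImage k n.skip) :=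
      comp_preservesFiniteLimits _ _
    have h3 : PreservesFiniteColimits (component (C := C) (k := k) n ⋙ directImage k n.skip) :=
      comp_preservesFiniteColimits _ _
    infer_instance
  exact quasiIso_mapHomologicalComplex (transitionTrans n.skip) X hX

namespace TraceFunctor

variable (T : TraceFunctor C k)

/-- The values of `tr_#` at a map as a natural transformation. -/
noncomputable def trSharpTrans {m n : CyclicCat} (f : m ⟶ n) :
    component m ⋙ T.tr m ⟶ component n ⋙ T.tr n where
  app E := (T.trSharp.obj E).map f
  naturality _ _ g := ((T.trSharp.map g).naturality f).symm

/-- The maps in the cyclic category which induce quasi-isomorphisms. -/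
def invertedBy (X : CochainComplex (ShvSharp C k) ℤ) : MorphismProperty CyclicCat := fun _ _ f =>
  QuasiIso ((NatTrans.mapHomologicalComplex (T.trSharpTrans f) (.up ℤ)).app X)

theorem mapHomologicalComplex_trSharpTrans_comp (X : CochainComplex (ShvSharp C k) ℤ)
    {m n p : CyclicCat} (f : m ⟶ n) (g : n ⟶ p) :
    (NatTrans.mapHomologicalComplex (T.trSharpTrans (f ≫ g)) (.up ℤ)).app X =
      (NatTrans.mapHomologicalComplex (T.trSharpTrans f) (.up ℤ)).app X ≫
        (NatTrans.mapHomologicalComplex (T.trSharpTrans g) (.up ℤ)).app X := by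
  ext i : 1
  exact (T.trSharp.obj (X.X i)).map_comp f g

theorem mapHomologicalComplex_trSharpTrans_id (X : CochainComplex (ShvSharp C k) ℤ)
    (n : CyclicCat) :
    (NatTrans.mapHomologicalComplex (T.trSharpTrans (𝟙 n)) (.up ℤ)).app X = 𝟙 _ := by
  ext i : 1
  exact (T.trSharp.obj (X.X i)).map_id n

instance (X : CochainComplex (ShvSharp C k) ℤ) : (T.invertedBy X).ContainsIdentities where
  id_mem n := by
    unfold invertedBy
    rw [mapHomologicalComplex_trSharpTrans_id]
    infer_instance

instance (X : CochainComplex (ShvSharp C k) ℤ) : (T.invertedBy X).HasTwoOutOfThreeProperty where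
  comp_mem f g hf hg := by
    have h1 : QuasiIso ((NatTrans.mapHomologicalComplex (T.trSharpTrans f) (.up ℤ)).app X) := hf
    have h2 : QuasiIso ((NatTrans.mapHomologicalComplex (T.trSharpTrans g) (.up ℤ)).app X) := hg
    unfold invertedBy
    rw [mapHomologicalComplex_trSharpTrans_comp]
    infer_instance
  of_postcomp f g hg hfg := by
    have h2 : QuasiIso ((NatTrans.mapHomologicalComplex (T.trSharpTrans g) (.up ℤ)).app X) := hg
    unfold invertedBy at hfg ⊢
    rwa [mapHomologicalComplex_trSharpTrans_comp, quasiIso_iff_comp_right] at hfg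
  of_precomp f g hf hfg := by
    have h1 : QuasiIso ((NatTrans.mapHomologicalComplex (T.trSharpTrans f) (.up ℤ)).app X) := hf
    unfold invertedBy at hfg ⊢
    rwa [mapHomologicalComplex_trSharpTrans_comp, quasiIso_iff_comp_left] at hfg

theorem quasiIso_tr_transitionTrans_skip {X : CochainComplex (ShvSharp C k) ℤ}
    (hX : leftPerp T.sharpClass X) (n : CyclicCat)
    (hX' : ∀ i, IsIso (transitionAdj (X.homology i) n.skip)) :
    QuasiIso (((T.tr n.succ).mapHomologicalComplex (.up ℤ)).map
      ((NatTrans.mapHomologicalComplex (transitionTrans n.skip) (.up ℤ)).app X)) :=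
  quasiIso_map (T.trAdj n.succ) _ (quasiIso_transitionTrans_skip n hX')
    (T.leftPerp_directImage hX n.skip) (T.leftPerp_component hX n.succ)

theorem trSharpTrans_eq {m n : CyclicCat} (f : m ⟶ n) : T.trSharpTrans f =
    Functor.whiskerLeft (component m) (T.trDirectImage f).hom ≫
      Functor.whiskerRight (transitionTrans f) (T.tr n) := by
  ext1
  funext E
  exact T.trSharp_map E f

theorem invertedBy_skip {X : CochainComplex (ShvSharp C k) ℤ} (hX : leftPerp T.sharpClass X)
    (n : CyclicCat) (hX' : ∀ i, IsIso (transitionAdj (X.homology i) n.skip)) :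
    T.invertedBy X n.skip := by
  have h1 : QuasiIso ((NatTrans.mapHomologicalComplex
      (Functor.whiskerRight (transitionTrans n.skip) (T.tr n.succ)) (.up ℤ)).app X) :=
    T.quasiIso_tr_transitionTrans_skip hX n hX'
  have h3 : IsIso ((NatTrans.mapHomologicalComplex
      (Functor.whiskerLeft (component n) (T.trDirectImage n.skip).hom) (.up ℤ)).app X) :=
    inferInstanceAs (IsIso ((NatIso.mapHomologicalComplex
      (Functor.isoWhiskerLeft (component n) (T.trDirectImage n.skip)) (.up ℤ)).hom.app X))
  unfold invertedBy
  rw [trSharpTrans_eq, NatTrans.mapHomologicalComplex_comp, NatTrans.comp_app]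
  infer_instance

/-- The cyclic vector spaces attached to a complex which is adapted to `tr` and has homology in
`Shv_cart(C_#)` are locally constant on `Δᵒᵖ`. -/
theorem invertedBy_of_isIso {X : CochainComplex (ShvSharp C k) ℤ} (hX : leftPerp T.sharpClass X)
    (hX' : ∀ i (n : CyclicCat), IsIso (transitionAdj (X.homology i) n.skip)) {n : CyclicCat}
    (v : CyclicCat.one ⟶ n) : T.invertedBy X v :=
  skip_induction _ (fun n => T.invertedBy_skip hX n fun i => hX' i n) v

end TraceFunctor

end CyclicHH

namespace CyclicHH

section Constant

variable (k : Type u) [Field k]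

/-- The colimit of a constant functor on `Δᵒᵖ`. -/
noncomputable def constColimIso : Functor.const DeltaOp (C := ModuleCat.{u} k) ⋙ colim ≅ 𝟭 _ :=
  ((constAdj (ModuleCat.{u} k)).comp colimConstAdj).leftAdjointUniq
    (Adjunction.id : 𝟭 (ModuleCat.{u} k) ⊣ 𝟭 _)

variable {k} [HasDerivedCategory.{w₁} (ModuleCat.{u} k)]
  [HasDerivedCategory.{w₃} (DeltaOp ⥤ ModuleCat.{u} k)]

/-- The derived colimit of constant functors on `Δᵒᵖ`. -/
noncomputable def derivedColimConst
    (Lcolim : DerivedCategory (DeltaOp ⥤ ModuleCat.{u} k) ⥤ DerivedCategory (ModuleCat.{u} k))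
    (γ : DerivedCategory.Q ⋙ Lcolim ⟶ colimQ k)
    [Lcolim.IsLeftDerivedFunctor γ (HomologicalComplex.quasiIso _ _)] :
    (Functor.const DeltaOp (C := ModuleCat.{u} k)).mapHomologicalComplex (.up ℤ) ⋙
      DerivedCategory.Q ⋙ Lcolim ≅ DerivedCategory.Q :=
  natIsoOfApp (Functor.whiskerLeft
      ((Functor.const DeltaOp (C := ModuleCat.{u} k)).mapHomologicalComplex (.up ℤ)) γ)
    (fun V => (isAdapted_colim k).isIso_app Lcolim γ (leftPerp_const k V)) ≪≫
  Functor.isoWhiskerRight (NatIso.mapHomologicalComplex (constColimIso k) (.up ℤ)) DerivedCategory.Q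

end Constant

variable {C : Type u} [SmallCategory C] [Abelian C] {k : Type u} [Field k] [Linear k C]
  [MonoidalCategory C] [MonoidalPreadditive C] [MonoidalLinear k C]
  [∀ X : C, PreservesFiniteColimits (tensorLeft X)]
  [∀ X : C, PreservesFiniteColimits (tensorRight X)]

namespace TraceFunctor

variable (T : TraceFunctor C k)

/-- The map from the constant functor to the restriction of `tr_#` to `Δᵒᵖ`. -/
noncomputable def constTrans : (component CyclicCat.one ⋙ T.tr CyclicCat.one) ⋙
    Functor.const DeltaOp ⟶ T.trSharp ⋙ simplicialRestr k where
  app E := (constAdj (ModuleCat.{u} k)).counit.app ((simplicialRestr k).obj (T.trSharp.obj E))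
  naturality _ _ g := (constAdj (ModuleCat.{u} k)).counit.naturality
    ((simplicialRestr k).map (T.trSharp.map g))

theorem quasiIso_constTrans {X : CochainComplex (ShvSharp C k) ℤ} (hX : leftPerp T.sharpClass X)
    (hX' : ∀ i (n : CyclicCat), IsIso (transitionAdj (X.homology i) n.skip)) :
    QuasiIso ((NatTrans.mapHomologicalComplex T.constTrans (.up ℤ)).app X) := by
  rw [HomologicalComplex.quasiIso_iff_evaluation]
  exact fun v => T.invertedBy_of_isIso hX hX' v.hom

variable {T} (hT : T.HomologicallyClean)

namespace HomologicallyClean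
include hT

theorem isIso_transitionAdj_res {K : CochainComplex (ShvSharp C k) ℤ} (hK : dLambda C k K) (i : ℤ)
    (n : CyclicCat) : IsIso (transitionAdj (((res hT).obj K).homology i) n.skip) := by
  have := quasiIso_resMap hT K
  obtain ⟨_, h⟩ := hK i
  exact isIso_transitionAdj_of_iso
    (asIso (HomologicalComplex.homologyMap ((resMap hT).app K) i)).symm _ (h.cocartesian n.skip)

variable [HasDerivedCategory.{w₁} (ModuleCat.{u} k)]
    [HasDerivedCategory.{w₂} (CyclicCat ⥤ ModuleCat.{u} k)]
    [HasDerivedCategory.{w₃} (DeltaOp ⥤ ModuleCat.{u} k)]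

/-- The first components of resolutions compute the Hochschild homology. -/
noncomputable def componentIso
    (Ltr : (qis (Shv C k CyclicCat.one)).Localization ⥤ DerivedCategory (ModuleCat.{u} k))
    (α : (qis _).Q ⋙ Ltr ⟶ T.trQ) [Ltr.IsLeftDerivedFunctor α (qis _)] :
    (component CyclicCat.one).mapHomologicalComplex _ ⋙ (qis _).Q ⋙ Ltr ≅
      res hT ⋙ (component CyclicCat.one).mapHomologicalComplex _ ⋙ T.trQ :=
  have := hasTwoOutOfThreeProperty_qis (A := Shv C k CyclicCat.one)
  (natIsoOfApp (Functor.whiskerRight (resMap hT)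
      ((component CyclicCat.one).mapHomologicalComplex _ ⋙ (qis _).Q ⋙ Ltr)) (fun X => by
    have h2 : qis _ (((component (C := C) (k := k) CyclicCat.one).mapHomologicalComplex _).map
        ((resMap hT).app X)) := by
      rw [qis_eq]
      exact quasiIso_component _ (quasiIso_resMap hT X) _
    have h3 := Localization.inverts (qis (Shv C k CyclicCat.one)).Q _ _ h2
    exact inferInstanceAs (IsIso (Ltr.map ((qis (Shv C k CyclicCat.one)).Q.map _))))).symm ≪≫
  natIsoOfApp (Functor.whiskerLeft (res hT ⋙ (component CyclicCat.one).mapHomologicalComplex _) α)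
    (fun X => (isAdapted_tr hT).isIso_app Ltr α (T.leftPerp_component (leftPerp_res hT X) _))

/-- The comparison of constant functors and `tr_#` on resolutions of objects of `DΛ(C)`. -/
noncomputable def constIso :
    (dLambda C k).ι ⋙ res hT ⋙ (component CyclicCat.one).mapHomologicalComplex _ ⋙
      (T.tr CyclicCat.one).mapHomologicalComplex _ ⋙
      (Functor.const DeltaOp).mapHomologicalComplex (.up ℤ) ⋙ DerivedCategory.Q ≅
    (dLambda C k).ι ⋙ res hT ⋙ T.trSharp.mapHomologicalComplex _ ⋙
      (simplicialRestr k).mapHomologicalComplex (.up ℤ) ⋙ DerivedCategory.Q :=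
  natIsoOfApp
    { app := fun K => DerivedCategory.Q.map
        ((NatTrans.mapHomologicalComplex T.constTrans (.up ℤ)).app ((res hT).obj K.obj))
      naturality := fun K L f => by
        have h := (NatTrans.mapHomologicalComplex T.constTrans (.up ℤ)).naturality
          ((res hT).map f.hom)
        have h2 := congrArg (DerivedCategory.Q (C := DeltaOp ⥤ ModuleCat.{u} k)).map h
        rw [Functor.map_comp, Functor.map_comp] at h2
        exact h2 }
    (fun K => Localization.inverts DerivedCategory.Q (HomologicalComplex.quasiIso _ (.up ℤ)) _
      (T.quasiIso_constTrans (leftPerp_res hT K.obj) (isIso_transitionAdj_res hT K.property)))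

/-- The comparison of Hochschild homology. -/
noncomputable def mainIso
    (Ltr : (qis (Shv C k CyclicCat.one)).Localization ⥤ DerivedCategory (ModuleCat.{u} k))
    (α : (qis _).Q ⋙ Ltr ⟶ T.trQ) [Ltr.IsLeftDerivedFunctor α (qis _)]
    (LtrSharp : (qis (ShvSharp C k)).Localization ⥤ DerivedCategory (CyclicCat ⥤ ModuleCat.{u} k))
    (β : (qis _).Q ⋙ LtrSharp ⟶ T.trSharpQ) [LtrSharp.IsLeftDerivedFunctor β (qis _)]
    (Lcolim : DerivedCategory (DeltaOp ⥤ ModuleCat.{u} k) ⥤ DerivedCategory (ModuleCat.{u} k))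
    (γ : DerivedCategory.Q ⋙ Lcolim ⟶ colimQ k)
    [Lcolim.IsLeftDerivedFunctor γ (HomologicalComplex.quasiIso _ _)] :
    (dLambda C k).ι ⋙ (component CyclicCat.one).mapHomologicalComplex _ ⋙ (qis _).Q ⋙ Ltr ≅
      (dLambda C k).ι ⋙ (qis _).Q ⋙ LtrSharp ⋙
        (simplicialRestr k).mapDerivedCategory ⋙ Lcolim :=
  have := hasTwoOutOfThreeProperty_qis (A := ShvSharp C k)
  let e1 := Functor.isoWhiskerLeft (dLambda C k).ι (componentIso hT Ltr α)
  let e2 := Functor.isoWhiskerLeft ((dLambda C k).ι ⋙ res hT ⋙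
      (component CyclicCat.one).mapHomologicalComplex _ ⋙
      (T.tr CyclicCat.one).mapHomologicalComplex _) (derivedColimConst Lcolim γ)
  let e3 := Functor.isoWhiskerRight (constIso hT) Lcolim
  let e4 := Functor.isoWhiskerLeft ((dLambda C k).ι ⋙ res hT ⋙ T.trSharp.mapHomologicalComplex _)
    (Functor.isoWhiskerRight (simplicialRestr k).mapDerivedCategoryFactors Lcolim)
  let e5 := Functor.isoWhiskerLeft (dLambda C k).ι (Functor.isoWhiskerRight
    ((isAdapted_trSharp hT).resolveIso LtrSharp β) ((simplicialRestr k).mapDerivedCategory ⋙ Lcolim))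
  e1 ≪≫ e2.symm ≪≫ e3 ≪≫ e4.symm ≪≫ e5.symm

end HomologicallyClean

end TraceFunctor

end CyclicHH

theorem mainTheorem5 (C : Type u) [SmallCategory C] [Abelian C] (k : Type u) [Field k] [Linear k C]
    [MonoidalCategory C] [MonoidalPreadditive C] [MonoidalLinear k C]
    [∀ X : C, PreservesFiniteColimits (tensorLeft X)]
    [∀ X : C, PreservesFiniteColimits (tensorRight X)]
    [HasDerivedCategory.{w₁} (ModuleCat.{u} k)]
    [HasDerivedCategory.{w₂} (CyclicCat ⥤ ModuleCat.{u} k)]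
    [HasDerivedCategory.{w₃} (DeltaOp ⥤ ModuleCat.{u} k)]
    (T : TraceFunctor C k) (hT : T.HomologicallyClean) :
    T.trQ.HasLeftDerivedFunctor (qis (Shv C k CyclicCat.one)) ∧
    T.trSharpQ.HasLeftDerivedFunctor (qis (ShvSharp C k)) ∧
    (colimQ k).HasLeftDerivedFunctor (HomologicalComplex.quasiIso _ _) ∧
    ∀ (Ltr : (qis (Shv C k CyclicCat.one)).Localization ⥤ DerivedCategory (ModuleCat.{u} k))
      (α : (qis _).Q ⋙ Ltr ⟶ T.trQ) [Ltr.IsLeftDerivedFunctor α (qis _)]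
      (LtrSharp : (qis (ShvSharp C k)).Localization ⥤
        DerivedCategory (CyclicCat ⥤ ModuleCat.{u} k))
      (β : (qis _).Q ⋙ LtrSharp ⟶ T.trSharpQ) [LtrSharp.IsLeftDerivedFunctor β (qis _)]
      (Lcolim : DerivedCategory (DeltaOp ⥤ ModuleCat.{u} k) ⥤ DerivedCategory (ModuleCat.{u} k))
      (γ : DerivedCategory.Q ⋙ Lcolim ⟶ colimQ k)
      [Lcolim.IsLeftDerivedFunctor γ (HomologicalComplex.quasiIso _ _)],
      Nonempty ((dLambda C k).ι ⋙ (component CyclicCat.one).mapHomologicalComplex _ ⋙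
          (qis _).Q ⋙ Ltr ≅
        (dLambda C k).ι ⋙ (qis _).Q ⋙ LtrSharp ⋙
          (simplicialRestr k).mapDerivedCategory ⋙ Lcolim) := by
  have h1 := hasTwoOutOfThreeProperty_qis (A := ShvSharp C k)
  have h2 := hasTwoOutOfThreeProperty_qis
    (A := Shv C k CyclicCat.one)
  refine ⟨hT.isAdapted_tr.hasLeftDerivedFunctor, hT.isAdapted_trSharp.hasLeftDerivedFunctor,
    (isAdapted_colim k).hasLeftDerivedFunctor, ?_⟩
  intro Ltr α _ LtrSharp β _ Lcolim γ _
  exact ⟨hT.mainIso Ltr α LtrSharp β Lcolim γ⟩
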